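/- Let $K$ be a finite connected simplicial complex of dimension at most $2$, and let $n$ be its size, i.e. its number of simplices. All chains, cycles and homology have coefficients in $\mathbb Z_2$; $\partial_2$ is the boundary matrix whose columns are the boundaries of the triangles (in a given order), and $g=\dim H_1(K)$. An annotation of the edges is a map $a\colon\{\text{edges of }K\}\to(\mathbb Z_2)^g$ such that two $1$-cycles $z,z'$ are homologous if and only if $\sum_{e\in z}a(e)=\sum_{e\in z'}a(e)$. The earliest basis of a matrix $A$ consists of the columns of $A$ whose indices form the lexicographically smallest set of $\operatorname{rank}A$ indices with linearly independent columns. Consider the following algorithm. Step 1: choose a spanning tree $T$ of the $1$-skeleton of $K$ and an enumeration $e_1,\dots,e_k$ of the edges outside $T$ (the sentinel edges), and let $Z$ be the matrix whose columns are the sentinel cycles $\gamma(T,e_i)$, where $\gamma(T,e)$ is the simple path in $T$ between the endpoints of $e$ plus the edge $e$. Step 2: compute the earliest basis $\widetilde Z=[B\mid H]$ of $[\partial_2\mid Z]$, where $B$ consists of its first $\operatorname{rank}\partial_2$ columns and $H$ of the remaining ones. Step 3: for every sentinel edge $e$ solve $\widetilde Z x=\gamma(T,e)$ and let $a(e)$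 be the vector of the entries of $x$ that belong to the columns in $H$; for the edges $e$ of $T$ let $a(e)=0$. (1) For every choice of the spanning tree and of the orders, the three steps can be carried out, $H$ consists of exactly $g$ cycles whose classes form a basis of $H_1(K)$, the map $a$ is an annotation of the edges by vectors in $(\mathbb Z_2)^g$, and for every $1$-cycle $z$ the sum $\sum_{e\in z}a(e)$ is the coordinate vector of the class $[z]$ in the basis given by $H$. (2) Let $\omega>2$ be a real number such that two $m\times m$ matrices over $\mathbb Z_2$ can be multiplied in $O(m^\omega)$ time ($m\ge1$). Then there is a program that, given the list of the edges and triangles of $K$ (with the vertices numbered, in any order), computes the results of the three steps (a spanning tree, the sentinel edges and the matrix $Z$, the indices of the columns of the earliest basis $\widetilde Z$, and the annotation $a$ of all edges) in $O(n^\omega)$ time. Here the running time is the number of steps on a word RAM with words of $w\ge c\log_2(N+2)$ bits, where $N$ is the input parameter ($m$ or $n$), $c$ is a constant that depends only on the program, the bound holds uniformly in $w$, each elementary operation (assignment, addition, truncated subtraction, multiplication and division of words, array access, comparison with branching) costs one step, a procedure call costs one step plus one per argument in addition to the steps of the called procedure, and memory outside the input is not assumed to be initialized. -/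

import Mathlib

/-! ### Simplicial complexes and their first homology over `ℤ/2` -/

namespace EdgeAnnotation

/-- The `p`-simplices of `K`: the faces with `p + 1` vertices. -/
def Simplex {V : Type*} (K : AbstractSimplicialComplex V) (p : ℕ) : Type _ :=
  {σ : Finset V // σ ∈ K.faces ∧ σ.card = p + 1}

instance {V : Type*} [Finite V] (K : AbstractSimplicialComplex V) (p : ℕ) :
    Finite (Simplex K p) :=
  inferInstanceAs (Finite {σ : Finset V // σ ∈ K.faces ∧ σ.card = p + 1})

noncomputable instance {V : Type*} [Finite V] (K : AbstractSimplicialComplex V) (p : ℕ) :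
    Fintype (Simplex K p) :=
  Fintype.ofFinite _

/-- The `p`-chains of `K` with coefficients in `ℤ/2` (as coefficient vectors). -/
abbrev Chain {V : Type*} (K : AbstractSimplicialComplex V) (p : ℕ) : Type _ :=
  Simplex K p → ZMod 2

/-- A complex all of whose simplices have dimension at most `2`. -/
def IsTwoComplex {V : Type*} (K : AbstractSimplicialComplex V) : Prop :=
  ∀ σ ∈ K.faces, σ.card ≤ 3

/-- The size of a complex: its number of simplices (of all dimensions). -/
noncomputable def size {V : Type*} (K : AbstractSimplicialComplex V) : ℕ :=
  K.faces.ncard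

/-- The `1`-skeleton of `K`, as a graph on the vertices. -/
def oneSkeleton {V : Type*} [DecidableEq V] (K : AbstractSimplicialComplex V) :
    SimpleGraph V where
  Adj u v := u ≠ v ∧ ({u, v} : Finset V) ∈ K.faces
  symm := ⟨fun u v h => ⟨h.1.symm, by rw [Finset.pair_comm]; exact h.2⟩⟩
  loopless := ⟨fun _ h => h.1 rfl⟩

open Classical in
/-- The matrix of the boundary map `∂_{p+1} : C_{p+1} → C_p` in the bases of simplices:
the column of a `(p+1)`-simplex is the incidence vector of the set of its `p`-faces. -/
noncomputable def boundaryMatrix {V : Type*} (K : AbstractSimplicialComplex V) (p : ℕ) :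
    Matrix (Simplex K p) (Simplex K (p + 1)) (ZMod 2) :=
  Matrix.of fun τ σ => if τ.1 ⊆ σ.1 then 1 else 0

/-- The group `Z₁ = ker ∂₁` of `1`-cycles. -/
noncomputable def cycles {V : Type*} [Finite V] (K : AbstractSimplicialComplex V) :
    Submodule (ZMod 2) (Chain K 1) :=
  LinearMap.ker (boundaryMatrix K 0).mulVecLin

/-- The group `B₁ = im ∂₂` of `1`-boundaries. -/
noncomputable def boundaries {V : Type*} [Finite V] (K : AbstractSimplicialComplex V) :
    Submodule (ZMod 2) (Chain K 1) :=
  LinearMap.range (boundaryMatrix K 1).mulVecLin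

/-- The first homology group `H₁ = Z₁ / B₁` over `ℤ/2`. -/
abbrev H1 {V : Type*} [Finite V] (K : AbstractSimplicialComplex V) : Type _ :=
  cycles K ⧸ (boundaries K).submoduleOf (cycles K)

/-- The homology class `[z]` of a `1`-cycle `z`. -/
noncomputable def homologyClass {V : Type*} [Finite V] (K : AbstractSimplicialComplex V)
    (z : cycles K) : H1 K :=
  ((boundaries K).submoduleOf (cycles K)).mkQ z

/-! ### Annotations -/

/-- The sum of the annotations of the edges that occur in the `1`-chain `z`. -/
noncomputable def annotationSum {V : Type*} [Finite V] {K : AbstractSimplicialComplex V} {g : ℕ}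
    (a : Simplex K 1 → Fin g → ZMod 2) (z : Chain K 1) : Fin g → ZMod 2 :=
  ∑ e : Simplex K 1 with z e = 1, a e

/-- An annotation of the edges: a labelling by vectors of length `dim H₁` such that two `1`-cycles
are homologous if and only if the sums of the labels of their edges agree. -/
def IsAnnotation {V : Type*} [Finite V] (K : AbstractSimplicialComplex V) {g : ℕ}
    (a : Simplex K 1 → Fin g → ZMod 2) : Prop :=
  g = Module.finrank (ZMod 2) (H1 K) ∧
    ∀ z z' : cycles K,
      homologyClass K z = homologyClass K z' ↔ annotationSum a z.1 = annotationSum a z'.1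

/-! ### The three steps -/

/-- `T` is a spanning tree of the `1`-skeleton of `K`. -/
def IsSpanningTree {V : Type*} [DecidableEq V] (K : AbstractSimplicialComplex V)
    (T : SimpleGraph V) : Prop :=
  T ≤ oneSkeleton K ∧ T.IsTree

/-- `e` is an edge of the tree `T`; the edges for which this fails are the sentinel edges. -/
def InTree {V : Type*} [DecidableEq V] {K : AbstractSimplicialComplex V} (T : SimpleGraph V)
    (e : Simplex K 1) : Prop :=
  ∃ u v, T.Adj u v ∧ e.1 = {u, v}

/-- The edge `f` lies on the simple path of `T` that connects the two endpoints of `e`. -/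
def OnTreePath {V : Type*} [DecidableEq V] {K : AbstractSimplicialComplex V} (T : SimpleGraph V)
    (e f : Simplex K 1) : Prop :=
  ∃ (u v : V) (p : T.Walk u v), e.1 = {u, v} ∧ p.IsPath ∧
    ∃ x y, s(x, y) ∈ p.edges ∧ f.1 = {x, y}

open Classical in
/-- The sentinel cycle `γ(T, e)`: the simple path of `T` that connects the endpoints of `e`,
plus the edge `e`. -/
noncomputable def sentinelCycle {V : Type*} [DecidableEq V] {K : AbstractSimplicialComplex V}
    (T : SimpleGraph V) (e : Simplex K 1) : Chain K 1 :=
  fun f => (if OnTreePath T e f then 1 else 0) + (if f = e then 1 else 0)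

/-- `ι` lists, in increasing order, the column indices of the earliest basis of the matrix `A`:
the lexicographically smallest index set of `rank A` linearly independent columns. -/
def IsEarliestBasis {m : Type*} {n r : ℕ} (A : Matrix m (Fin n) (ZMod 2))
    (ι : Fin r → Fin n) : Prop :=
  r = A.rank ∧ StrictMono ι ∧ LinearIndependent (ZMod 2) (fun j => A.col (ι j)) ∧
    ∀ ι' : Fin r → Fin n, StrictMono ι' →
      LinearIndependent (ZMod 2) (fun j => A.col (ι' j)) → toLex ι ≤ toLex ι'

/-- The matrix `[∂₂ | Z]`: first the boundaries of the triangles, in the order `tri`, and then the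
sentinel cycles of the edges `s 0, s 1, …`. -/
noncomputable def cycleMatrix {V : Type*} [DecidableEq V] {K : AbstractSimplicialComplex V}
    {n₂ k : ℕ} (tri : Fin n₂ ≃ Simplex K 2) (T : SimpleGraph V) (s : Fin k → Simplex K 1) :
    Matrix (Simplex K 1) (Fin (n₂ + k)) (ZMod 2) :=
  Matrix.of fun e j =>
    Fin.append (fun i => boundaryMatrix K 1 e (tri i)) (fun i => sentinelCycle T (s i) e) j

/-- The `j`-th cycle of `H`, where `[B | H]` is the list of the columns `ι` of `[∂₂ | Z]` and `B`
consists of the first `b` of them. -/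
noncomputable def basisCycle {V : Type*} [DecidableEq V] {K : AbstractSimplicialComplex V}
    {n₂ k b g : ℕ} (tri : Fin n₂ ≃ Simplex K 2) (T : SimpleGraph V) (s : Fin k → Simplex K 1)
    (ι : Fin (b + g) → Fin (n₂ + k)) (j : Fin g) : Chain K 1 :=
  (cycleMatrix tri T s).col (ι (Fin.natAdd b j))

/-- `T, s, ι, a` are the results of the three steps on the complex `K`. -/
structure IsThreeStepResult {V : Type*} [Finite V] [DecidableEq V]
    (K : AbstractSimplicialComplex V) {n₂ k b g : ℕ} (tri : Fin n₂ ≃ Simplex K 2)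
    (T : SimpleGraph V) (s : Fin k → Simplex K 1) (ι : Fin (b + g) → Fin (n₂ + k))
    (a : Simplex K 1 → Fin g → ZMod 2) : Prop where
  /-- Step 1: `T` is a spanning tree of the `1`-skeleton. -/
  tree : IsSpanningTree K T
  /-- Step 1: `s` enumerates the sentinel edges without repetition. -/
  sentinel_injective : Function.Injective s
  sentinel_range : Set.range s = {e | ¬ InTree T e}
  /-- Step 2: `ι` is the earliest basis `[B | H]` of `[∂₂ | Z]`, where `B` consists of the first
  `rank ∂₂` columns and `H` of the remaining ones. -/
  rank_boundary : b = (boundaryMatrix K 1).rank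
  earliest : IsEarliestBasis (cycleMatrix tri T s) ι
  /-- Step 3: the annotation of a sentinel edge `e` consists of the last `g` entries of the
  solution of the linear system `[B | H] x = γ(T, e)`. -/
  solve : ∀ i, ∃ x : Fin (b + g) → ZMod 2,
    ((cycleMatrix tri T s).submatrix id ι).mulVec x = sentinelCycle T (s i) ∧
      a (s i) = fun j => x (Fin.natAdd b j)
  /-- Step 3: the annotation of an edge of the tree is the zero vector. -/
  tree_zero : ∀ e, InTree T e → a e = 0

/-! ### A word RAM

The memory consists of finitely many scalar variables per procedure (local to each call) and of
global arrays; all are named by natural numbers. A cell holds a word of `w` bits. Every elementary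
instruction takes one unit of time. -/

/-- The arithmetic operations on words. -/
inductive Op
  | add | sub | mul | div

/-- Arithmetic on words of `w` bits; subtraction is truncated at `0`, and division by `0`
gives `0`. -/
def Op.eval (w : ℕ) : Op → ℕ → ℕ → ℕ
  | .add, y, z => (y + z) % 2 ^ w
  | .sub, y, z => y - z
  | .mul, y, z => (y * z) % 2 ^ w
  | .div, y, z => y / z

/-- Commands. The arguments are names of variables, names of arrays or (in `const`, second
argument) a fixed constant, and in `call` the name of a procedure. -/
inductive Cmd
  /-- do nothing -/
  | skip
  /-- `x := c` -/
  | const (x c : ℕ)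
  /-- `x := y ∘ z` -/
  | op (o : Op) (x y z : ℕ)
  /-- `x := α[y]` -/
  | load (x α y : ℕ)
  /-- `α[y] := x` -/
  | store (α y x : ℕ)
  /-- `c; d` -/
  | seq (c d : Cmd)
  /-- `if y < z then c else d` -/
  | ite (y z : ℕ) (c d : Cmd)
  /-- `while y < z do c` -/
  | while (y z : ℕ) (c : Cmd)
  /-- `x := p(args)` -/
  | call (x p : ℕ) (args : List ℕ)

/-- A program: a finite list of (possibly mutually recursive) procedures. Procedure `0` is the
main procedure. -/
abbrev Program := List Cmd

/-- The body of procedure `p` (empty if there is no such procedure). -/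
def Program.body (P : Program) (p : ℕ) : Cmd := P.getD p .skip

/-- A memory state: the local variables and the global arrays. -/
structure State where
  var : ℕ → ℕ
  arr : ℕ → ℕ → ℕ

/-- The state after the assignment `x := v`. -/
def State.setVar (s : State) (x v : ℕ) : State :=
  ⟨Function.update s.var x v, s.arr⟩

/-- The state after the assignment `α[i] := v`. -/
def State.setArr (s : State) (α i v : ℕ) : State :=
  ⟨s.var, Function.update s.arr α (Function.update (s.arr α) i v)⟩

/-- A frame of local variables which starts with the given values and is zero elsewhere. -/
def frame (l : List ℕ) : ℕ → ℕ := fun x => l.getD x 0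

/-- `Exec w P c s t s'`: on the machine with word length `w` and in the program `P`, the command
`c`, started in the state `s`, halts after exactly `t` steps in the state `s'`. -/
inductive Exec (w : ℕ) (P : Program) : Cmd → State → ℕ → State → Prop
  | skip (s : State) : Exec w P .skip s 1 s
  | const (s : State) (x c : ℕ) : Exec w P (.const x c) s 1 (s.setVar x (c % 2 ^ w))
  | op (s : State) (o : Op) (x y z : ℕ) :
      Exec w P (.op o x y z) s 1 (s.setVar x (o.eval w (s.var y) (s.var z)))
  | load (s : State) (x α y : ℕ) :
      Exec w P (.load x α y) s 1 (s.setVar x (s.arr α (s.var y)))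
  | store (s : State) (α y x : ℕ) :
      Exec w P (.store α y x) s 1 (s.setArr α (s.var y) (s.var x))
  | seq {c d : Cmd} {s s' s'' : State} {t t' : ℕ} :
      Exec w P c s t s' → Exec w P d s' t' s'' → Exec w P (.seq c d) s (t + t') s''
  | ite_true {y z : ℕ} {c d : Cmd} {s s' : State} {t : ℕ} :
      s.var y < s.var z → Exec w P c s t s' → Exec w P (.ite y z c d) s (t + 1) s'
  | ite_false {y z : ℕ} {c d : Cmd} {s s' : State} {t : ℕ} :
      ¬ s.var y < s.var z → Exec w P d s t s' → Exec w P (.ite y z c d) s (t + 1) s'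
  | while_true {y z : ℕ} {c : Cmd} {s s' s'' : State} {t t' : ℕ} :
      s.var y < s.var z → Exec w P c s t s' → Exec w P (.while y z c) s' t' s'' →
        Exec w P (.while y z c) s (t + t' + 1) s''
  | while_false {y z : ℕ} {c : Cmd} {s : State} :
      ¬ s.var y < s.var z → Exec w P (.while y z c) s 1 s
  /-- The callee starts with its own local variables: the values of the arguments, then zeros.
  It works on the global arrays, and its variable `0` is the returned value. -/
  | call {x p : ℕ} {args : List ℕ} {s s' : State} {t : ℕ} :
      Exec w P (P.body p) ⟨frame (args.map s.var), s.arr⟩ t s' →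
        Exec w P (.call x p args) s (t + args.length + 1)
          ⟨Function.update s.var x (s'.var 0), s'.arr⟩

/-- The program `P`, started in `s`, halts after `t` steps in the state `s'`. -/
def Program.Runs (P : Program) (w : ℕ) (s : State) (t : ℕ) (s' : State) : Prop :=
  Exec w P (P.body 0) s t s'

/-- An initial state whose scalar input is the list `l`. The arrays hold arbitrary words, except
for what is said about them elsewhere: the memory outside the input is not initialized. -/
def IsInitial (w : ℕ) (l : List ℕ) (s : State) : Prop :=
  s.var = frame l ∧ ∀ α i, s.arr α i < 2 ^ w

/-- Array `α` of the state `s` holds the matrix `A` over `ℤ/2`, row by row. -/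
def HoldsMatrix {m n : ℕ} (s : State) (α : ℕ) (A : Matrix (Fin m) (Fin n) (ZMod 2)) : Prop :=
  ∀ (i : Fin m) (j : Fin n), s.arr α (i * n + j) = (A i j).val

/-- Two `n × n` matrices over `ℤ/2` can be multiplied in time `O(n ^ ω)`, on a word RAM whose words
have at least `c log₂ (n + 2)` bits for some constant `c`. -/
def MatrixMultiplicationInTime (ω : ℝ) : Prop :=
  ∃ (P : Program) (c : ℕ) (C : ℝ), ∀ (n : ℕ), 0 < n → ∀ (A B : Matrix (Fin n) (Fin n) (ZMod 2))
    (w : ℕ) (s : State), (n + 2) ^ c ≤ 2 ^ w → IsInitial w [n] s →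
    HoldsMatrix s 0 A → HoldsMatrix s 1 B →
      ∃ (t : ℕ) (s' : State), P.Runs w s t s' ∧ (t : ℝ) ≤ C * (n : ℝ) ^ ω ∧
        HoldsMatrix s' 2 (A * B)

/-! ### Complexes as inputs, and the outputs -/

/-- A numbering of the vertices, the edges and the triangles of a complex, in arbitrary order. -/
structure Numbering {V : Type*} (K : AbstractSimplicialComplex V) where
  n₀ : ℕ
  n₁ : ℕ
  n₂ : ℕ
  vert : Fin n₀ ≃ V
  edge : Fin n₁ ≃ Simplex K 1
  tri : Fin n₂ ≃ Simplex K 2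

/-- The state `s` is an initial state with the complex `K` as input: the scalar input consists of
the numbers of vertices, edges and triangles, array `0` lists the two endpoints of every edge, and
array `1` lists the three vertices of every triangle. -/
def IsInput {V : Type*} [DecidableEq V] {K : AbstractSimplicialComplex V} (N : Numbering K)
    (w : ℕ) (s : State) : Prop :=
  IsInitial w [N.n₀, N.n₁, N.n₂] s ∧
  (∀ i : Fin N.n₁, ∃ x y : Fin N.n₀, s.arr 0 (2 * i) = x ∧ s.arr 0 (2 * i + 1) = y ∧
    (N.edge i).1 = {N.vert x, N.vert y}) ∧
  (∀ i : Fin N.n₂, ∃ x y z : Fin N.n₀, s.arr 1 (3 * i) = x ∧ s.arr 1 (3 * i + 1) = y ∧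
    s.arr 1 (3 * i + 2) = z ∧ (N.tri i).1 = {N.vert x, N.vert y, N.vert z})

/-- The state `s` contains the results of the three steps: in the variables `0, 1, 2` the numbers
`k` of sentinel edges, `b = rank ∂₂` and `g`; in array `2` the list of the sentinel edges; in
array `3` the matrix `Z` of the sentinel cycles (one row per edge, one column per cycle); in array
`4` the list of the column indices of the earliest basis `[B | H]` of `[∂₂ | Z]`; and in array `5`
the annotations (one row per edge). -/
def IsOutput {V : Type*} [DecidableEq V] {K : AbstractSimplicialComplex V} (N : Numbering K)
    {k b g : ℕ} (T : SimpleGraph V) (σ : Fin k → Simplex K 1) (ι : Fin (b + g) → Fin (N.n₂ + k))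
    (a : Simplex K 1 → Fin g → ZMod 2) (s : State) : Prop :=
  s.var 0 = k ∧ s.var 1 = b ∧ s.var 2 = g ∧
  (∀ i : Fin k, s.arr 2 i = (N.edge.symm (σ i) : ℕ)) ∧
  HoldsMatrix s 3 (Matrix.of fun i j => sentinelCycle T (σ j) (N.edge i)) ∧
  (∀ j : Fin (b + g), s.arr 4 j = (ι j : ℕ)) ∧
  HoldsMatrix s 5 (Matrix.of fun i j => a (N.edge i) j)

end EdgeAnnotation

/-! Correctness. Off the tree, a sentinel cycle is the indicator of its sentinel edge, and a cycle
that vanishes off the tree is zero. Hence every cycle `z` is the sum of the sentinel cycles of the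
sentinel edges in `z` (`eq_sum_sentinelCycle`). The vanishing is proved by duality: deleting a tree
edge `f` splits the tree, the indicator of one side is a potential whose coboundary on the tree is
the indicator of `f`, and a cycle pairs to zero with every coboundary. An earliest basis is the same
thing as a greedy one, in which every column is a combination of basis columns that do not come
after it (`IsGreedyBasis.isEarliestBasis`, `IsEarliestBasis.isGreedyBasis`). So the basis columns of
`[∂₂ | Z]` that come from triangles form a basis of the boundaries, and all of them form a basis of
the cycles. Reading the last `g` coordinates is then a surjection `Φ` from the cycles to vectors of
length `g` whose kernel is the group of boundaries. Since `a e = Φ (γ(T, e))` on sentinel edges and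
`a = 0` on the tree, linearity gives `Φ z` as the annotation sum of `z`
(`IsThreeStepResult.isAnnotation`).

Running time. A quadratic search grows the tree and records, for each vertex, the edges of its path
from the root; adding two such rows and the edge itself yields a sentinel cycle. Steps 2 and 3 are
both read off from one Gauss–Jordan elimination of `[∂₂ | Z]`, padded to a size `m = 2 ^ L`: the
columns with pivots are the greedy basis, and the pivot rows contain the coordinates of all columns
(`Reduced.isGreedyBasis`). The elimination is recursive in the columns. The effect of a block of `c`
columns is kept in the compressed form `x ↦ x + U (S x)`, where `S` selects the pivot rows and `U`
is an `m × c` matrix; two such blocks compose to a block of the same form (`Reduced.merge`), at the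
price of `m / c` products of `c × c` matrices for each update (`Does.applyBlock`). With `c = 2 ^ l`
there are `2 ^ (L - l)` blocks, so the level costs about `4 ^ (L - l) * 2 ^ (l * ω)`. For `ω > 2`
this is a geometric sum dominated by its top term (`exists_eliminateTime_le`).

Machine. The program is verified by a calculus of total correctness with time bounds (`Does`), over
compiled arithmetic expressions that cannot overflow because the words exceed a fixed power of a
bound `M` on the data. The given multiplication program is embedded by renumbering its procedures
and arrays (`Exec.shift`); it tolerates repeated calls because its specification allows arbitrary
contents of the memory outside its input. -/

namespace EdgeAnnotation

/-! ### Arithmetic expressions and their compilation -/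

/-- Arithmetic expressions over variables, constants and array entries. -/
inductive AExp
  | var (x : ℕ)
  | const (c : ℕ)
  | op (o : Op) (a b : AExp)
  | get (α : ℕ) (a : AExp)

/-- The operations on unbounded natural numbers. -/
def Op.nat : Op → ℕ → ℕ → ℕ
  | .add, y, z => y + z
  | .sub, y, z => y - z
  | .mul, y, z => y * z
  | .div, y, z => y / z

namespace AExp

instance : Add AExp := ⟨op .add⟩
instance : Sub AExp := ⟨op .sub⟩
instance : Mul AExp := ⟨op .mul⟩
instance : Div AExp := ⟨op .div⟩
instance (n : ℕ) : OfNat AExp n := ⟨const n⟩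

/-- The code that puts the value into the variable `d`, using the variables from `d` on. -/
def code : AExp → ℕ → Cmd
  | var x, d => .seq (.const d 0) (.op .add d d x)
  | const c, d => .const d c
  | op o a b, d => .seq (a.code d) (.seq (b.code (d + 1)) (.op o d d (d + 1)))
  | get α a, d => .seq (a.code d) (.load d α d)

/-- The number of steps of the code. -/
def cost : AExp → ℕ
  | var _ => 2
  | const _ => 1
  | op _ a b => a.cost + (b.cost + 1)
  | get _ a => a.cost + 1

/-- The value of an expression in a state, without overflow. -/
def eval (s : State) : AExp → ℕ
  | var x => s.var x
  | const c => c
  | op o a b => o.nat (a.eval s) (b.eval s)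
  | get α a => s.arr α (a.eval s)

/-- A bound on the degree of the value in the variables and array entries. -/
def deg : AExp → ℕ
  | var _ => 1
  | const _ => 1
  | op .add a b => max a.deg b.deg + 1
  | op .mul a b => a.deg + b.deg
  | op .sub a b => max a.deg b.deg
  | op .div a b => max a.deg b.deg
  | get _ a => max 1 a.deg

/-- All variables are below `d`. -/
def varsLt (d : ℕ) : AExp → Bool
  | var x => decide (x < d)
  | const _ => true
  | op _ a b => a.varsLt d && b.varsLt d
  | get _ a => a.varsLt d

/-- A syntactic check: the variables are below `d`, and degree and cost are moderate. -/
def check (d : ℕ) (e : AExp) : Bool :=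
  e.varsLt d && (decide (e.deg ≤ 16) && decide (e.cost ≤ 100))

/-- All variables, constants and array entries that are read are at most `M`. -/
def Fine (M : ℕ) (s : State) : AExp → Prop
  | var x => s.var x ≤ M
  | const c => c ≤ M
  | op _ a b => a.Fine M s ∧ b.Fine M s
  | get α a => a.Fine M s ∧ s.arr α (a.eval s) ≤ M

section simps
variable (s : State) (M : ℕ) (a b : AExp)
@[simp] theorem eval_add : (a + b).eval s = a.eval s + b.eval s := rfl
@[simp] theorem eval_sub : (a - b).eval s = a.eval s - b.eval s := rfl
@[simp] theorem eval_mul : (a * b).eval s = a.eval s * b.eval s := rfl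
@[simp] theorem eval_div : (a / b).eval s = a.eval s / b.eval s := rfl
@[simp] theorem eval_zero : (0 : AExp).eval s = 0 := rfl
@[simp] theorem eval_one : (1 : AExp).eval s = 1 := rfl
@[simp] theorem eval_ofNat (n : ℕ) [n.AtLeastTwo] : (ofNat(n) : AExp).eval s = n := rfl
@[simp] theorem eval_var (x : ℕ) : (var x).eval s = s.var x := rfl
@[simp] theorem eval_get (α : ℕ) : (get α a).eval s = s.arr α (a.eval s) := rfl
@[simp] theorem fine_add : (a + b).Fine M s ↔ a.Fine M s ∧ b.Fine M s := Iff.rfl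
@[simp] theorem fine_sub : (a - b).Fine M s ↔ a.Fine M s ∧ b.Fine M s := Iff.rfl
@[simp] theorem fine_mul : (a * b).Fine M s ↔ a.Fine M s ∧ b.Fine M s := Iff.rfl
@[simp] theorem fine_div : (a / b).Fine M s ↔ a.Fine M s ∧ b.Fine M s := Iff.rfl
@[simp] theorem fine_zero : (0 : AExp).Fine M s ↔ True := by
  simp only [iff_true]; exact Nat.zero_le M
@[simp] theorem fine_one : (1 : AExp).Fine M s ↔ 1 ≤ M := Iff.rfl
@[simp] theorem fine_ofNat (n : ℕ) [n.AtLeastTwo] :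
    (ofNat(n) : AExp).Fine M s ↔ n ≤ M := Iff.rfl
@[simp] theorem fine_var (x : ℕ) : (var x).Fine M s ↔ s.var x ≤ M := Iff.rfl
@[simp] theorem fine_get (α : ℕ) :
    (get α a).Fine M s ↔ a.Fine M s ∧ s.arr α (a.eval s) ≤ M := Iff.rfl
end simps

/-- A sum doubles the larger bound at most, and `2 ≤ M` turns this factor into one more degree. -/
theorem eval_le {M : ℕ} (hM : 2 ≤ M) {s : State} :
    ∀ e : AExp, e.Fine M s → e.eval s ≤ M ^ e.deg
  | var _, h => by simpa [deg] using h
  | const _, h => by simpa [deg, eval, Fine] using h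
  | op o a b, ⟨h₁, h₂⟩ => by
    have ha := eval_le hM a h₁
    have hb := eval_le hM b h₂
    have ha' : a.eval s ≤ M ^ (max a.deg b.deg) :=
      ha.trans (Nat.pow_le_pow_right (by omega) (le_max_left _ _))
    have hb' : b.eval s ≤ M ^ (max a.deg b.deg) :=
      hb.trans (Nat.pow_le_pow_right (by omega) (le_max_right _ _))
    cases o with
    | add => simp only [eval, Op.nat, deg, pow_succ]; nlinarith
    | sub => simp only [eval, Op.nat, deg]; omega
    | mul => simp only [eval, Op.nat, deg, pow_add]; exact Nat.mul_le_mul ha hb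
    | div => simp only [eval, Op.nat, deg]; exact (Nat.div_le_self _ _).trans ha'
  | get _ a, h => by
    simp only [eval, deg]
    refine h.2.trans ?_
    calc M = M ^ 1 := (pow_one M).symm
      _ ≤ _ := Nat.pow_le_pow_right (by omega) (le_max_left _ _)

end AExp

/-- The two states agree on the arrays and on the variables below `d`. -/
def State.Agree (d : ℕ) (s s' : State) : Prop :=
  s.arr = s'.arr ∧ ∀ x < d, s.var x = s'.var x

theorem State.Agree.refl (d : ℕ) (s : State) : s.Agree d s := ⟨rfl, fun _ _ => rfl⟩

theorem State.Agree.trans {d : ℕ} {s s' s'' : State} (h : s.Agree d s') (h' : s'.Agree d s'') :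
    s.Agree d s'' :=
  ⟨h.1.trans h'.1, fun x hx => (h.2 x hx).trans (h'.2 x hx)⟩

theorem State.Agree.mono {d d' : ℕ} {s s' : State} (h : s.Agree d s') (hd : d' ≤ d) :
    s.Agree d' s' :=
  ⟨h.1, fun x hx => h.2 x (hx.trans_le hd)⟩

/-! ### Correctness of the compiled expressions -/

namespace AExp

theorem eval_congr {d : ℕ} {s s' : State} (h : s.Agree d s') :
    ∀ e : AExp, e.varsLt d = true → e.eval s = e.eval s'
  | var x, he => h.2 x (by simpa [varsLt] using he)
  | const _, _ => rfl
  | op o a b, he => by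
    simp only [varsLt, Bool.and_eq_true] at he
    simp only [eval, eval_congr h a he.1, eval_congr h b he.2]
  | get α a, he => by
    simp only [varsLt] at he
    simp only [eval, eval_congr h a he, h.1]

theorem fine_congr {d M : ℕ} {s s' : State} (h : s.Agree d s') :
    ∀ e : AExp, e.varsLt d = true → (e.Fine M s ↔ e.Fine M s')
  | var x, he => by simp only [Fine, h.2 x (by simpa [varsLt] using he)]
  | const _, _ => Iff.rfl
  | op o a b, he => by
    simp only [varsLt, Bool.and_eq_true] at he
    simp only [Fine, fine_congr h a he.1, fine_congr h b he.2]
  | get α a, he => by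
    simp only [varsLt] at he
    simp only [Fine, fine_congr h a he, eval_congr h a he, h.1]

theorem varsLt_mono {d d' : ℕ} (hd : d ≤ d') : ∀ e : AExp, e.varsLt d = true → e.varsLt d' = true
  | var x, he => by simp only [varsLt, decide_eq_true_eq] at he ⊢; omega
  | const _, _ => rfl
  | op o a b, he => by
    simp only [varsLt, Bool.and_eq_true] at he ⊢
    exact ⟨varsLt_mono hd a he.1, varsLt_mono hd b he.2⟩
  | get α a, he => varsLt_mono hd a he

/-- The code works like a stack machine: the left operand waits in register `d` while the right one
is computed from `d + 1` on. All variables of the expression lie below `d`, so the intermediate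
results never destroy them, and the degree bound removes the reduction modulo `2 ^ w`. -/
theorem exec_code {w M : ℕ} (P : Program) (hM : 2 ≤ M) :
    ∀ (e : AExp) (d : ℕ) (s : State), e.varsLt d = true → e.Fine M s → M ^ e.deg < 2 ^ w →
      ∃ s', Exec w P (e.code d) s e.cost s' ∧ s'.var d = e.eval s ∧ s'.Agree d s
  | var x, d, s, hb, hf, hw => by
    have hx : x ≠ d := by simp [varsLt] at hb; omega
    refine ⟨_, .seq (.const s d 0) (.op _ .add d d x), ?_, rfl, fun y hy => ?_⟩
    · have : s.var x < 2 ^ w := by simp [deg, Fine] at hf hw; omega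
      simp [State.setVar, Op.eval, hx, eval, Nat.mod_eq_of_lt this]
    · simp [State.setVar, hy.ne]
  | const c, d, s, _, hf, hw => by
    refine ⟨_, .const s d c, ?_, rfl, fun y hy => ?_⟩
    · have : c < 2 ^ w := by simp [deg, Fine] at hf hw; omega
      simp [State.setVar, eval, Nat.mod_eq_of_lt this]
    · simp [State.setVar, hy.ne]
  | op o a b, d, s, hb, hf, hw => by
    simp only [varsLt, Bool.and_eq_true] at hb
    have hda : M ^ a.deg ≤ M ^ (op o a b).deg := by
      apply Nat.pow_le_pow_right (by omega)
      cases o <;> simp only [deg] <;> omega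
    have hdb : M ^ b.deg ≤ M ^ (op o a b).deg := by
      apply Nat.pow_le_pow_right (by omega)
      cases o <;> simp only [deg] <;> omega
    obtain ⟨s₁, e₁, v₁, g₁⟩ := exec_code P hM a d s hb.1 hf.1 (hda.trans_lt hw)
    obtain ⟨s₂, e₂, v₂, g₂⟩ := exec_code P hM b (d + 1) s₁ (varsLt_mono (by omega) b hb.2)
      ((fine_congr g₁ b hb.2).2 hf.2) (hdb.trans_lt hw)
    refine ⟨_, .seq e₁ (.seq e₂ (.op s₂ o d d (d + 1))), ?_, ?_⟩
    · have hv := eval_le hM (op o a b) hf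
      have h1 : s₂.var d = a.eval s := by rw [g₂.2 d (by omega), v₁]
      have h2 : s₂.var (d + 1) = b.eval s := by rw [v₂, eval_congr g₁ b hb.2]
      have hlt := hv.trans_lt hw
      simp only [State.setVar, Function.update_self, h1, h2]
      cases o <;> simp only [Op.eval, eval, Op.nat] at hlt ⊢ <;> exact Nat.mod_eq_of_lt hlt
    · refine ⟨g₂.1.trans g₁.1, fun y hy => ?_⟩
      simp only [State.setVar, Function.update_of_ne hy.ne]
      rw [g₂.2 y (by omega), g₁.2 y hy]
  | get α a, d, s, hb, hf, hw => by
    have hda : M ^ a.deg ≤ M ^ (get α a).deg :=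
      Nat.pow_le_pow_right (by omega) (by simp [deg])
    obtain ⟨s₁, e₁, v₁, g₁⟩ := exec_code P hM a d s hb hf.1 (hda.trans_lt hw)
    refine ⟨_, .seq e₁ (.load s₁ d α d), ?_, g₁.1, fun y hy => ?_⟩
    · simp [State.setVar, v₁, g₁.1]
    · simp only [State.setVar, Function.update_of_ne hy.ne]
      exact g₁.2 y hy

end AExp

/-! ### Word-sized states -/

/-- All cells hold words of `w` bits. -/
def State.WF (w : ℕ) (s : State) : Prop :=
  (∀ x, s.var x < 2 ^ w) ∧ ∀ α i, s.arr α i < 2 ^ w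

theorem frame_lt {w : ℕ} {l : List ℕ} (h : ∀ a ∈ l, a < 2 ^ w) (x : ℕ) : frame l x < 2 ^ w := by
  unfold frame
  rcases lt_or_ge x l.length with hx | hx
  · rw [List.getD_eq_getElem _ _ hx]; exact h _ (List.getElem_mem hx)
  · rw [List.getD_eq_default _ _ hx]; positivity

theorem State.WF.setVar {w : ℕ} {s : State} (h : s.WF w) (x : ℕ) {v : ℕ} (hv : v < 2 ^ w) :
    (s.setVar x v).WF w := by
  refine ⟨fun y => ?_, h.2⟩
  rcases eq_or_ne y x with rfl | hy
  · simpa [State.setVar] using hv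
  · simpa [State.setVar, hy] using h.1 y

/-- This invariant makes copying by addition exact, and it supplies the word-size condition on the
memory that the multiplication program expects at each call. -/
theorem Exec.wf {w : ℕ} {P : Program} {c : Cmd} {s s' : State} {t : ℕ} (h : Exec w P c s t s') :
    s.WF w → s'.WF w := by
  induction h with
  | skip s => exact id
  | const s x c => exact fun h => h.setVar x (Nat.mod_lt _ (by positivity))
  | op s o x y z =>
    refine fun h => h.setVar x ?_
    cases o with
    | add => exact Nat.mod_lt _ (by positivity)
    | sub => exact (Nat.sub_le _ _).trans_lt (h.1 y)
    | mul => exact Nat.mod_lt _ (by positivity)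
    | div => exact (Nat.div_le_self _ _).trans_lt (h.1 y)
  | load s x α y => exact fun h => h.setVar x (h.2 _ _)
  | store s α y x =>
    refine fun h => ⟨h.1, fun β i => ?_⟩
    rcases eq_or_ne β α with rfl | hβ
    · rcases eq_or_ne i (s.var y) with rfl | hi
      · simpa [State.setArr] using h.1 x
      · simpa [State.setArr, hi] using h.2 β i
    · simpa [State.setArr, hβ] using h.2 β i
  | seq _ _ ih₁ ih₂ => exact fun h => ih₂ (ih₁ h)
  | ite_true _ _ ih => exact ih
  | ite_false _ _ ih => exact ih
  | while_true _ _ _ ih₁ ih₂ => exact fun h => ih₂ (ih₁ h)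
  | while_false _ => exact id
  | @call x p args s s' t _ ih =>
    intro h
    have h' := ih ⟨frame_lt (by simp; exact fun a _ => h.1 a), h.2⟩
    exact (State.WF.setVar (s := ⟨s.var, s'.arr⟩) ⟨h.1, h'.2⟩ x (h'.1 0))

/-! ### A calculus for total correctness with running times -/

/-- Started in any word-sized state which agrees with `σ` on the arrays and on the variables below
`d`, the command halts within `B` steps, in a state which agrees with a state that satisfies `Q`. -/
def Does (w : ℕ) (P : Program) (d : ℕ) (c : Cmd) (σ : State) (B : ℕ) (Q : State → Prop) : Prop :=
  ∀ s : State, s.WF w → s.Agree d σ →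
    ∃ t s' σ', Exec w P c s t s' ∧ t ≤ B ∧ s'.Agree d σ' ∧ Q σ'

section rules

variable {w : ℕ} {P : Program} {d : ℕ} {c c' : Cmd} {σ : State} {B B' : ℕ} {Q Q' : State → Prop}

theorem Does.mono (h : Does w P d c σ B Q) (hB : B ≤ B') (hQ : ∀ σ, Q σ → Q' σ) :
    Does w P d c σ B' Q' := fun s hs ha =>
  let ⟨t, s', σ', h₁, h₂, h₃, h₄⟩ := h s hs ha
  ⟨t, s', σ', h₁, h₂.trans hB, h₃, hQ _ h₄⟩

theorem Does.le (h : Does w P d c σ B Q) (hB : B ≤ B') : Does w P d c σ B' Q :=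
  h.mono hB fun _ => id

/-- The specification of the second command is the postcondition of the first, as in a
weakest-precondition calculus. Applied repeatedly, this executes a program symbolically within the
goal. -/
theorem Does.seq (h : Does w P d c σ B fun σ' => Does w P d c' σ' B' Q) :
    Does w P d (.seq c c') σ (B + B') Q := fun s hs ha => by
  obtain ⟨t, s', σ', h₁, h₂, h₃, h₄⟩ := h s hs ha
  obtain ⟨t', s'', σ'', h₁', h₂', h₃', h₄'⟩ := h₄ s' (h₁.wf hs) h₃
  exact ⟨_, s'', σ'', .seq h₁ h₁', by omega, h₃', h₄'⟩

theorem Does.seq' {R : State → Prop} (h : Does w P d c σ B R)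
    (h' : ∀ σ', R σ' → Does w P d c' σ' B' Q) : Does w P d (.seq c c') σ (B + B') Q :=
  .seq (h.mono le_rfl h')

/-- A specification on more variables gives one on fewer variables. -/
theorem Does.lower {d' : ℕ} (hd : d ≤ d')
    (h : ∀ s : State, s.Agree d σ → Does w P d' c s B fun s' => ∃ σ', s'.Agree d σ' ∧ Q σ') :
    Does w P d c σ B Q := fun s hs ha => by
  obtain ⟨t, s', s'', h₁, h₂, h₃, σ', h₄, h₅⟩ := h s ha s hs (.refl _ _)
  exact ⟨t, s', σ', h₁, h₂, (h₃.mono hd).trans h₄, h₅⟩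

theorem Does.ite {y z : ℕ} (hy : y < d) (hz : z < d)
    (h₁ : σ.var y < σ.var z → Does w P d c σ B Q)
    (h₂ : ¬ σ.var y < σ.var z → Does w P d c' σ B Q) :
    Does w P d (.ite y z c c') σ (B + 1) Q := fun s hs ha => by
  by_cases h : s.var y < s.var z
  · obtain ⟨t, s', σ', g₁, g₂, g₃, g₄⟩ := h₁ (by rwa [← ha.2 y hy, ← ha.2 z hz]) s hs ha
    exact ⟨_, s', σ', .ite_true h g₁, by omega, g₃, g₄⟩
  · obtain ⟨t, s', σ', g₁, g₂, g₃, g₄⟩ := h₂ (by rwa [← ha.2 y hy, ← ha.2 z hz]) s hs ha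
    exact ⟨_, s', σ', .ite_false h g₁, by omega, g₃, g₄⟩

/-- The procedure `p`, called with the given arguments and arrays. -/
def DoesProc (w : ℕ) (P : Program) (d p : ℕ) (args : List ℕ) (arr : ℕ → ℕ → ℕ) (B : ℕ)
    (Q : State → Prop) : Prop :=
  Does w P d (P.body p) ⟨frame args, arr⟩ B Q

/-- The callee has its own frame, so among the variables of the caller only `x` changes. The
positivity of `d` makes variable `0` of the callee, which is returned, one of the specified ones. -/
theorem Does.call {x p : ℕ} {args : List ℕ} (hd : 0 < d) (hargs : ∀ a ∈ args, a < d)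
    (h : DoesProc w P d p (args.map σ.var) σ.arr B
      fun σ' => Q ⟨Function.update σ.var x (σ'.var 0), σ'.arr⟩) :
    Does w P d (.call x p args) σ (B + args.length + 1) Q := fun s hs ha => by
  have hm : args.map s.var = args.map σ.var :=
    List.map_congr_left fun a h => ha.2 a (hargs a h)
  obtain ⟨t, s', σ', h₁, h₂, h₃, h₄⟩ := h ⟨frame (args.map s.var), s.arr⟩
    ⟨frame_lt (by simp; exact fun a _ => hs.1 a), hs.2⟩ (by rw [hm, ha.1]; exact .refl _ _)
  refine ⟨_, _, ⟨Function.update σ.var x (σ'.var 0), σ'.arr⟩, .call h₁, by omega,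
    ⟨h₃.1, fun y hy => ?_⟩, h₄⟩
  rcases eq_or_ne y x with rfl | hyx
  · simpa using h₃.2 0 hd
  · simpa [hyx] using ha.2 y hy

/-- The words are large enough for polynomials of degree `16` in `M`. -/
structure Big (w M : ℕ) : Prop where
  two_le : 2 ≤ M
  lt : M ^ 16 < 2 ^ w

theorem AExp.check_varsLt {d : ℕ} {e : AExp} (h : e.check d = true) : e.varsLt d = true := by
  simp only [check, Bool.and_eq_true] at h; exact h.1

theorem AExp.check_cost {d : ℕ} {e : AExp} (h : e.check d = true) : e.cost ≤ 100 := by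
  simp only [check, Bool.and_eq_true, decide_eq_true_eq] at h; exact h.2.2

theorem Big.pow_lt {M : ℕ} (hw : Big w M) {e : AExp} (h : e.check d = true) :
    M ^ e.deg < 2 ^ w := by
  simp only [AExp.check, Bool.and_eq_true, decide_eq_true_eq] at h
  exact (Nat.pow_le_pow_right (by have := hw.two_le; omega) h.2.1).trans_lt hw.lt

theorem AExp.check_var_add_one {i : ℕ} (hi : i < d) : (AExp.var i + 1).check d = true := by
  change (AExp.op .add (.var i) (.const 1)).check d = true
  simp [check, varsLt, deg, cost, hi]

/-- `x := e` -/
def assign (x : ℕ) (e : AExp) : Cmd :=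
  .seq (e.code 25) (.seq (.const x 0) (.op .add x x 25))

/-- The value is built in the scratch register `25`, since `x` may occur in `e`, and is then copied
as `x := 0; x := x + r`. -/
theorem Does.assign {M : ℕ} (hw : Big w M) {x : ℕ} {e : AExp} (hd : d ≤ 25) (hx : x < d)
    (he : e.check d = true) (hf : e.Fine M σ) (hQ : Q (σ.setVar x (e.eval σ))) :
    Does w P d (assign x e) σ 110 Q := fun s hs ha => by
  have hb := AExp.check_varsLt he
  obtain ⟨s', h₁, h₂, h₃⟩ := AExp.exec_code P hw.two_le e 25 s
    (AExp.varsLt_mono hd e hb) ((AExp.fine_congr ha e hb).2 hf) (hw.pow_lt he)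
  have hlt : s'.var 25 < 2 ^ w := (h₁.wf hs).1 25
  refine ⟨_, _, _, .seq h₁ (.seq (.const s' x 0) (.op _ .add x x 25)), ?_, ?_, hQ⟩
  · have := AExp.check_cost he; omega
  · refine ⟨h₃.1.trans ha.1, fun y hy => ?_⟩
    have hx' : 25 ≠ x := by omega
    rcases eq_or_ne y x with rfl | hyx
    · rw [h₂, AExp.eval_congr ha e hb] at hlt
      simp [State.setVar, Op.eval, hx', h₂, AExp.eval_congr ha e hb, Nat.mod_eq_of_lt hlt]
    · simp [State.setVar, hyx, h₃.2 y (by omega), ha.2 y hy]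

/-- `α[idx] := val` -/
def storeAt (α : ℕ) (idx val : AExp) : Cmd :=
  .seq (idx.code 25) (.seq (val.code 26) (.store α 25 26))

theorem Does.storeAt {M : ℕ} (hw : Big w M) {α : ℕ} {idx val : AExp} (hd : d ≤ 25)
    (hi : idx.check d = true) (hv : val.check d = true) (hfi : idx.Fine M σ) (hfv : val.Fine M σ)
    (hQ : Q (σ.setArr α (idx.eval σ) (val.eval σ))) :
    Does w P d (storeAt α idx val) σ 210 Q := fun s hs ha => by
  have hbi := AExp.check_varsLt hi
  have hbv := AExp.check_varsLt hv
  obtain ⟨s₁, h₁, h₂, h₃⟩ := AExp.exec_code P hw.two_le idx 25 s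
    (AExp.varsLt_mono hd _ hbi) ((AExp.fine_congr ha _ hbi).2 hfi) (hw.pow_lt hi)
  have ha₁ := (h₃.mono hd).trans ha
  obtain ⟨s₂, h₄, h₅, h₆⟩ := AExp.exec_code P hw.two_le val 26 s₁
    (AExp.varsLt_mono (by omega) _ hbv) ((AExp.fine_congr ha₁ _ hbv).2 hfv) (hw.pow_lt hv)
  have ha₂ := (h₆.mono (by omega : d ≤ 26)).trans ha₁
  refine ⟨_, _, _, .seq h₁ (.seq h₄ (.store s₂ α 25 26)), ?_, ?_, hQ⟩
  · have := AExp.check_cost hi; have := AExp.check_cost hv; omega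
  · refine ⟨?_, fun y hy => ha₂.2 y hy⟩
    simp only [State.setArr, h₅, h₆.2 25 (by omega), h₂, AExp.eval_congr ha _ hbi,
      AExp.eval_congr ha₁ _ hbv, ha₂.1]

/-- `while i < n do (c; i := i + 1)` -/
def loop (i n : ℕ) (c : Cmd) : Cmd :=
  .while i n (.seq c (assign i (.var i + 1)))

theorem Does.loop {M : ℕ} (hw : Big w M) {i n N : ℕ} (hd : d ≤ 25) (hi : i < d) (hn : n < d)
    (hin : i ≠ n) (hN : N ≤ M) (I : ℕ → State → Prop)
    (h0 : I 0 σ) (hσi : σ.var i = 0) (hσn : σ.var n = N)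
    (hbody : ∀ q < N, ∀ σ : State, I q σ → σ.var i = q → σ.var n = N →
      Does w P d c σ B fun σ' => σ'.var i = q ∧ σ'.var n = N ∧ I (q + 1) (σ'.setVar i (q + 1)))
    (hQ : ∀ σ : State, I N σ → σ.var i = N → σ.var n = N → Q σ) :
    Does w P d (loop i n c) σ (N * (B + 111) + 1) Q := by
  -- Induction on the number `r` of remaining rounds, with the current value `q` of the counter left
  -- free.
  suffices H : ∀ r q : ℕ, q + r = N → ∀ σ : State, I q σ → σ.var i = q → σ.var n = N →
      Does w P d (EdgeAnnotation.loop i n c) σ (r * (B + 111) + 1) Q from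
    H N 0 (by omega) σ h0 hσi hσn
  intro r
  induction r with
  | zero =>
    intro q hq σ hI hi' hn' s hs ha
    refine ⟨_, s, σ, .while_false ?_, by simp, ha, hQ σ (by simpa [← hq] using hI) (by omega) hn'⟩
    rw [ha.2 i hi, ha.2 n hn]; omega
  | succ r ih =>
    intro q hq σ hI hi' hn' s hs ha
    have hb : Does w P d (.seq c (EdgeAnnotation.assign i (.var i + 1))) σ (B + 110)
        fun σ' => σ'.var i = q + 1 ∧ σ'.var n = N ∧ I (q + 1) σ' := by
      refine .seq' (hbody q (by omega) σ hI hi' hn') ?_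
      rintro σ' ⟨h1, h2, h3⟩
      refine .assign hw hd hi (AExp.check_var_add_one hi) ?_ ?_
      · simp [h1]; have := hw.two_le; omega
      · simp [h1]
        refine ⟨by simp [State.setVar], by simp [State.setVar, hin.symm, h2], h3⟩
    obtain ⟨t, s', σ', g₁, g₂, g₃, g₄, g₅, g₆⟩ := hb s hs ha
    obtain ⟨t', s'', σ'', e₁, e₂, e₃, e₄⟩ := ih (q + 1) (by omega) σ' g₆ g₄ g₅ s' (g₁.wf hs) g₃
    refine ⟨_, s'', σ'', .while_true ?_ g₁ e₁, ?_, e₃, e₄⟩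
    · rw [ha.2 i hi, ha.2 n hn]; omega
    · rw [Nat.succ_mul]; omega

end rules

/-! ### Loops over rectangles, folds and filters -/

/-- For all `i < a` and `j < b` do `α[idx] := val`, where `i` and `j` are the variables
`20` and `21`. -/
def fill (α : ℕ) (a b idx val : AExp) : Cmd :=
  .seq (assign 24 b) <| .seq (assign 23 (a * .var 24)) <| .seq (assign 22 0) <| loop 22 23 <|
    .seq (assign 20 (.var 22 / .var 24)) <| .seq (assign 21 (.var 22 - .var 20 * .var 24)) <|
      storeAt α idx val

/-- For all `q < b` do `x := val`, where `q` is the variable `21`. -/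
def fold (x : ℕ) (b val : AExp) : Cmd :=
  .seq (assign 23 b) <| .seq (assign 21 0) <| loop 21 23 <| assign x val

/-- List in `α` the numbers `q < b` whose flag is `1`, and put their number into `x`; here `q` is
the variable `21`. -/
def collect (α x : ℕ) (b flag : AExp) : Cmd :=
  .seq (assign 23 b) <| .seq (assign 21 0) <| .seq (assign x 0) <| loop 21 23 <|
    .seq (storeAt α (.var x) (.var 21)) (assign x (.var x + flag))

theorem State.setVar_var (s : State) (x v y : ℕ) :
    (s.setVar x v).var y = if y = x then v else s.var y := by
  simp [State.setVar, Function.update_apply]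

@[simp] theorem State.setVar_arr (s : State) (x v : ℕ) : (s.setVar x v).arr = s.arr := rfl

@[simp] theorem State.setArr_var (s : State) (α i v : ℕ) : (s.setArr α i v).var = s.var := rfl

theorem State.setArr_arr (s : State) (α i v β j : ℕ) :
    (s.setArr α i v).arr β j = if β = α ∧ j = i then v else s.arr β j := by
  simp only [State.setArr, Function.update_apply]
  split_ifs <;> simp_all

section
variable {w M : ℕ} {P : Program} {σ : State} {Q : State → Prop}

theorem AExp.varsLt_of_check {d : ℕ} {e : AExp} (h : e.check d = true) {s s' : State}
    (hs : s.arr = s'.arr) (hv : ∀ x < d, s.var x = s'.var x) :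
    e.eval s = e.eval s' ∧ (e.Fine M s ↔ e.Fine M s') :=
  ⟨AExp.eval_congr ⟨hs, hv⟩ e (AExp.check_varsLt h), AExp.fine_congr ⟨hs, hv⟩ e
    (AExp.check_varsLt h)⟩

theorem AExp.check_of_le {d d' : ℕ} (hd : d ≤ d') {e : AExp} (h : e.check d = true) :
    e.check d' = true := by
  simp only [AExp.check, Bool.and_eq_true] at h ⊢
  exact ⟨AExp.varsLt_mono hd e h.1, h.2⟩

/-- One counter runs through the rectangle in row-major order and is split into row and column by
division. When `(i, j)` is treated, every cell of `α` not assigned to an earlier pair still has its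
old content. This is why `h` may assume it, so that `val` may read the array that is being
rewritten; injectivity of `I` keeps the writes apart. -/
theorem Does.fill (hw : Big w M) {α : ℕ} {a b idx val : AExp} {m n : ℕ}
    (hca : a.check 20 = true) (hca' : (a * .var 24).check 25 = true) (hcb : b.check 20 = true)
    (hci : idx.check 22 = true) (hcv : val.check 22 = true)
    (hfa : a.Fine M σ) (hfb : b.Fine M σ) (ha : a.eval σ = m) (hb : b.eval σ = n)
    (hn : n ≤ M) (hmn : m * n ≤ M) (I V : ℕ → ℕ → ℕ)
    (hI : ∀ i < m, ∀ j < n, ∀ i' < m, ∀ j' < n, I i j = I i' j' → i = i' ∧ j = j')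
    (h : ∀ i < m, ∀ j < n, ∀ s : State, (∀ x < 20, s.var x = σ.var x) → s.var 20 = i →
      s.var 21 = j → (∀ β ≠ α, s.arr β = σ.arr β) →
      (∀ x, (∀ i' < m, ∀ j' < n, i' * n + j' < i * n + j → x ≠ I i' j') →
        s.arr α x = σ.arr α x) →
      idx.Fine M s ∧ val.Fine M s ∧ idx.eval s = I i j ∧ val.eval s = V i j)
    (hQ : ∀ arr : ℕ → ℕ → ℕ, (∀ β ≠ α, arr β = σ.arr β) →
      (∀ i < m, ∀ j < n, arr α (I i j) = V i j) →
      (∀ x, (∀ i < m, ∀ j < n, x ≠ I i j) → arr α x = σ.arr α x) → Q ⟨σ.var, arr⟩) :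
    Does w P 20 (fill α a b idx val) σ (1000 * (m * n + 1)) Q := by
  have h2 := hw.two_le
  refine Does.lower (d' := 25) (by norm_num) fun s hs => ?_
  have lin : ∀ i < m, ∀ j < n, i * n + j < m * n := fun i hi j hj => by nlinarith
  obtain ⟨hbe, hbf⟩ := AExp.varsLt_of_check (M := M) hcb hs.1 hs.2
  refine Does.le (B := 110 + (110 + (110 + (m * n * ((110 + (110 + 210)) + 111) + 1))))
    ?_ (by omega)
  refine .seq (.assign hw le_rfl (by norm_num) (AExp.check_of_le (by norm_num) hcb)
    (hbf.2 hfb) ?_)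
  rw [hbe, hb]
  obtain ⟨hae, haf⟩ := AExp.varsLt_of_check (M := M) hca (s := s.setVar 24 n) (s' := σ) hs.1
    (fun x hx => by simp [State.setVar_var, hs.2 x hx]; omega)
  refine .seq (.assign hw le_rfl (by norm_num) hca' ⟨haf.2 hfa, ?_⟩ ?_)
  · simpa [State.setVar_var, AExp.Fine] using hn
  rw [AExp.eval_mul, hae, ha, AExp.eval_var, State.setVar_var, if_pos rfl]
  refine .seq (.assign hw le_rfl (by norm_num) rfl (by simp) ?_)
  refine .loop hw le_rfl (by norm_num) (by norm_num) (by norm_num) (N := m * n) hmn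
    (fun q s' => s'.var 24 = n ∧ (∀ x < 20, s'.var x = σ.var x) ∧
      (∀ β ≠ α, s'.arr β = σ.arr β) ∧
      (∀ i < m, ∀ j < n, i * n + j < q → s'.arr α (I i j) = V i j) ∧
      (∀ x, (∀ i < m, ∀ j < n, i * n + j < q → x ≠ I i j) → s'.arr α x = σ.arr α x)) ?_ ?_ ?_ ?_ ?_
  · refine ⟨by simp [State.setVar_var], fun x hx => ?_, fun β _ => ?_, ?_, fun x _ => ?_⟩
    · simp only [State.setVar_var]; rw [if_neg (by omega), if_neg (by omega), if_neg (by omega)]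
      exact hs.2 x hx
    · simp [hs.1]
    · simp
    · simp [hs.1]
  · simp [State.setVar_var]
  · simp [State.setVar_var]
  · rintro q hq s₁ ⟨h24, hlow, hA, hB, hC⟩ hi hN
    -- The existence of a round excludes `n = 0`, so the divisions by `n` are genuine.
    have hn0 : 0 < n := Nat.pos_of_ne_zero fun h => by simp [h] at hq
    have hqn : q / n < m := Nat.div_lt_of_lt_mul (by rwa [mul_comm])
    have hmod : q - q / n * n = q % n := by
      have := Nat.div_add_mod q n; rw [mul_comm] at this; omega
    have hqe : q / n * n + q % n = q := by
      have := Nat.div_add_mod q n; rw [mul_comm] at this; omega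
    have hjn : q % n < n := Nat.mod_lt _ hn0
    refine .seq (B := 110) (B' := 110 + 210) (.assign (x := 20) hw le_rfl (by norm_num) rfl (by simp [hi, h24]; omega) ?_)
    rw [AExp.eval_div, AExp.eval_var, AExp.eval_var, hi, h24]
    refine .seq (B := 110) (B' := 210) (.assign hw le_rfl (by norm_num) rfl ?_ ?_)
    · simp [State.setVar_var, hi, h24, hn, (Nat.div_le_self q n).trans (hq.le.trans hmn),
        hq.le.trans hmn]
    simp only [AExp.eval_sub, AExp.eval_mul, AExp.eval_var, State.setVar_var, hi, h24, if_true,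
      if_false, Nat.reduceEqDiff, hmod]
    obtain ⟨g1, g2, g3, g4⟩ := h _ hqn _ hjn ((s₁.setVar 20 (q / n)).setVar 21 (q % n))
      (fun x hx => by
        simp only [State.setVar_var]; rw [if_neg (by omega), if_neg (by omega)]; exact hlow x hx)
      (by simp [State.setVar_var]) (by simp [State.setVar_var]) hA (by
        rw [hqe]; exact hC)
    refine .storeAt hw le_rfl (AExp.check_of_le (by norm_num) hci)
      (AExp.check_of_le (by norm_num) hcv) g1 g2 ?_
    rw [g3, g4]
    refine ⟨by simp [State.setVar_var, hi], by simp [State.setVar_var, hN], ?_, ?_, ?_, ?_, ?_⟩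
    · simp [State.setVar_var, h24]
    · intro x hx
      simp only [State.setVar_var, State.setArr_var]
      rw [if_neg (by omega), if_neg (by omega), if_neg (by omega)]; exact hlow x hx
    · intro β hβ
      funext x
      simp [State.setArr_arr, hβ, hA β hβ]
    · intro i hi' j hj hlt
      simp only [State.setVar_arr, State.setArr_arr, true_and]
      split_ifs with hx
      · obtain ⟨rfl, rfl⟩ := hI _ hi' _ hj _ hqn _ hjn hx
        rfl
      · refine hB i hi' j hj (lt_of_le_of_ne (Nat.lt_succ_iff.1 hlt) fun he => hx ?_)
        have e1 : i = q / n := by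
          rw [← he, mul_comm, Nat.mul_add_div hn0, Nat.div_eq_of_lt hj, add_zero]
        have e2 : j = q % n := by
          rw [← he, mul_comm, Nat.mul_add_mod, Nat.mod_eq_of_lt hj]
        rw [e1, e2]
    · intro x hx
      simp only [State.setVar_arr, State.setArr_arr, true_and]
      rw [if_neg (hx _ hqn _ hjn (by omega))]
      exact hC x fun i hi' j hj hlt => hx i hi' j hj (by omega)
  · rintro s₁ ⟨h24, hlow, hA, hB, hC⟩ _ _
    refine ⟨⟨σ.var, s₁.arr⟩, ⟨rfl, hlow⟩, hQ s₁.arr hA (fun i hi j hj => hB i hi j hj (lin i hi j hj))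
      fun x hx => hC x fun i hi j hj _ => hx i hi j hj⟩

theorem Does.fold (hw : Big w M) {x : ℕ} {b val : AExp} {N : ℕ} (hx : x < 20)
    (hcb : b.check 20 = true) (hcv : val.check 22 = true) (hfb : b.Fine M σ)
    (hb : b.eval σ = N) (hN : N ≤ M) (R : ℕ → ℕ) (h0 : σ.var x = R 0)
    (h : ∀ q < N, ∀ s : State, (∀ y < 20, y ≠ x → s.var y = σ.var y) → s.var x = R q →
      s.var 21 = q → s.arr = σ.arr → val.Fine M s ∧ val.eval s = R (q + 1))
    (hQ : Q (σ.setVar x (R N))) :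
    Does w P 20 (fold x b val) σ (1000 * (N + 1)) Q := by
  refine Does.lower (d' := 25) (by norm_num) fun s hs => ?_
  obtain ⟨hbe, hbf⟩ := AExp.varsLt_of_check (M := M) hcb hs.1 hs.2
  refine Does.le (B := 110 + (110 + (N * (110 + 111) + 1))) ?_ (by omega)
  refine .seq (.assign hw le_rfl (by norm_num) (AExp.check_of_le (by norm_num) hcb)
    (hbf.2 hfb) ?_)
  rw [hbe, hb]
  refine .seq (.assign hw le_rfl (by norm_num) rfl (by simp) ?_)
  refine .loop hw le_rfl (by norm_num) (by norm_num) (by norm_num) (N := N) hN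
    (fun q s' => (∀ y < 20, y ≠ x → s'.var y = σ.var y) ∧ s'.var x = R q ∧ s'.arr = σ.arr)
    ?_ ?_ ?_ ?_ ?_
  · refine ⟨fun y hy hyx => ?_, ?_, hs.1⟩
    · simp only [State.setVar_var]; rw [if_neg (by omega), if_neg (by omega)]; exact hs.2 y hy
    · simp only [State.setVar_var]; rw [if_neg (by omega), if_neg (by omega), hs.2 x hx, h0]
  · simp [State.setVar_var]
  · simp [State.setVar_var]
  · rintro q hq s₁ ⟨h1, h2, h3⟩ hi hn
    obtain ⟨g1, g2⟩ := h q hq s₁ h1 h2 hi h3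
    refine .assign hw le_rfl (by omega) (AExp.check_of_le (by norm_num) hcv) g1 ?_
    rw [g2]
    refine ⟨?_, ?_, fun y hy hyx => ?_, ?_, h3⟩
    · simp only [State.setVar_var]; rw [if_neg (by omega), hi]
    · simp only [State.setVar_var]; rw [if_neg (by omega), hn]
    · simp only [State.setVar_var]; rw [if_neg (by omega), if_neg hyx, h1 y hy hyx]
    · simp only [State.setVar_var]; rw [if_neg (by omega)]; simp
  · rintro s₁ ⟨h1, h2, h3⟩ - -
    refine ⟨σ.setVar x (R N), ⟨h3, fun y hy => ?_⟩, hQ⟩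
    rcases eq_or_ne y x with rfl | hyx
    · simp [State.setVar_var, h2]
    · simp [State.setVar_var, hyx, h1 y hy hyx]

/-- Every `q` is written to the end of the list, without branching, but the end moves on only when
the flag is `1`; an unwanted entry is overwritten or lies beyond the final end. The position of a
listed `q` is therefore `Nat.count p q`. -/
theorem Does.collect (hw : Big w M) {α x : ℕ} {b flag : AExp} {N : ℕ} (hx : x < 20)
    (hcb : b.check 20 = true) (hcv : (.var x + flag : AExp).check 22 = true) (hfb : b.Fine M σ)
    (hb : b.eval σ = N) (hN : N ≤ M) (p : ℕ → Prop) [DecidablePred p]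
    (h : ∀ q < N, ∀ s : State, (∀ y < 20, y ≠ x → s.var y = σ.var y) →
      s.var 21 = q → (∀ β ≠ α, s.arr β = σ.arr β) →
      flag.Fine M s ∧ flag.eval s = if p q then 1 else 0)
    (hQ : ∀ arr : ℕ → ℕ → ℕ, (∀ β ≠ α, arr β = σ.arr β) →
      (∀ q < N, p q → arr α (Nat.count p q) = q) →
      Q ⟨Function.update σ.var x (Nat.count p N), arr⟩) :
    Does w P 20 (collect α x b flag) σ (1000 * (N + 1)) Q := by
  refine Does.lower (d' := 25) (by norm_num) fun s hs => ?_
  obtain ⟨hbe, hbf⟩ := AExp.varsLt_of_check (M := M) hcb hs.1 hs.2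
  refine Does.le (B := 110 + (110 + (110 + (N * ((210 + 110) + 111) + 1)))) ?_ (by omega)
  refine .seq (.assign hw le_rfl (by norm_num) (AExp.check_of_le (by norm_num) hcb)
    (hbf.2 hfb) ?_)
  rw [hbe, hb]
  refine .seq (.assign hw le_rfl (by norm_num) rfl (by simp) ?_)
  refine .seq (.assign hw le_rfl (by omega) rfl (by simp) ?_)
  have hcx : (.var x : AExp).check 25 = true := by
    simp [AExp.check, AExp.varsLt, AExp.deg, AExp.cost]; omega
  refine .loop hw le_rfl (by norm_num) (by norm_num) (by norm_num) (N := N) hN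
    (fun q s' => (∀ y < 20, y ≠ x → s'.var y = σ.var y) ∧ s'.var x = Nat.count p q ∧
      (∀ β ≠ α, s'.arr β = σ.arr β) ∧ (∀ q' < q, p q' → s'.arr α (Nat.count p q') = q'))
    ?_ ?_ ?_ ?_ ?_
  · refine ⟨fun y hy hyx => ?_, ?_, fun β _ => ?_, by simp⟩
    · simp only [State.setVar_var]
      rw [if_neg (by omega), if_neg (by omega), if_neg (by omega)]; exact hs.2 y hy
    · simp [State.setVar_var]
    · simp [hs.1]
  · simp only [State.setVar_var]; rw [if_neg (by omega)]; simp
  · simp only [State.setVar_var]; rw [if_neg (by omega)]; simp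
  · rintro q hq s₁ ⟨h1, h2, h3, h4⟩ hi hn
    have hle : Nat.count p q ≤ M := (Nat.count_le p).trans (hq.le.trans hN)
    refine .seq (.storeAt hw le_rfl hcx rfl (by simpa [h2]) (by simp [hi]; omega) ?_)
    simp only [AExp.eval_var, h2, hi]
    have hA : ∀ β ≠ α, (s₁.setArr α (Nat.count p q) q).arr β = σ.arr β := fun β hβ => by
      funext y; simp [State.setArr_arr, hβ, h3 β hβ]
    obtain ⟨g1, g2⟩ := h q hq (s₁.setArr α (Nat.count p q) q) h1 hi hA
    refine .assign hw le_rfl (by omega) (AExp.check_of_le (by norm_num) hcv)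
      ⟨by simpa [AExp.Fine, h2], g1⟩ ?_
    rw [AExp.eval_add, AExp.eval_var, g2, State.setArr_var, h2, ← Nat.count_succ]
    refine ⟨?_, ?_, fun y hy hyx => ?_, ?_, hA, ?_⟩
    · simp only [State.setVar_var, State.setArr_var]; rw [if_neg (by omega), hi]
    · simp only [State.setVar_var, State.setArr_var]; rw [if_neg (by omega), hn]
    · simp only [State.setVar_var, State.setArr_var]
      rw [if_neg (by omega), if_neg hyx, h1 y hy hyx]
    · simp only [State.setVar_var]; rw [if_neg (by omega)]; simp
    · intro q' hq' hp
      simp only [State.setVar_arr, State.setArr_arr, true_and]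
      rcases Nat.lt_succ_iff_lt_or_eq.1 hq' with hlt | rfl
      · rw [if_neg, h4 q' hlt hp]
        -- Later writes go to strictly larger positions, since `q'` itself has been counted.
        exact (Nat.count_strict_mono hp hlt).ne
      · simp
  · rintro s₁ ⟨h1, h2, h3, h4⟩ - -
    refine ⟨⟨Function.update σ.var x (Nat.count p N), s₁.arr⟩, ⟨rfl, fun y hy => ?_⟩,
      hQ s₁.arr h3 h4⟩
    rcases eq_or_ne y x with rfl | hyx
    · simp [h2]
    · simp [hyx, h1 y hy hyx]

end

/-! ### Calling a given program as a subroutine -/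

/-- Renumber the procedures by `k` and the arrays by `a`. -/
def Cmd.shift (k a : ℕ) : Cmd → Cmd
  | .skip => .skip
  | .const x c => .const x c
  | .op o x y z => .op o x y z
  | .load x α y => .load x (α + a) y
  | .store α y x => .store (α + a) y x
  | .seq c d => .seq (c.shift k a) (d.shift k a)
  | .ite y z c d => .ite y z (c.shift k a) (d.shift k a)
  | .while y z c => .while y z (c.shift k a)
  | .call x p args => .call x (p + k) args

/-- The first `a` arrays of `low`, followed by the arrays of `high`. -/
def joinArr (a : ℕ) (low high : ℕ → ℕ → ℕ) : ℕ → ℕ → ℕ :=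
  fun α => if α < a then low α else high (α - a)

theorem joinArr_add (a : ℕ) (low high : ℕ → ℕ → ℕ) (α : ℕ) :
    joinArr a low high (α + a) = high α := by
  simp [joinArr]

theorem joinArr_update (a : ℕ) (low high : ℕ → ℕ → ℕ) (α : ℕ) (f : ℕ → ℕ) :
    Function.update (joinArr a low high) (α + a) f =
      joinArr a low (Function.update high α f) := by
  funext β
  rcases eq_or_ne β (α + a) with rfl | hβ
  · rw [joinArr_add]; simp
  · rw [Function.update_of_ne hβ]
    simp only [joinArr]
    split_ifs with h
    · rfl
    · rw [Function.update_of_ne]; omega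

/-- A step-by-step simulation: the renumbered code accesses only arrays from `a` on, where `joinArr`
is the original memory, so the lower arrays stay frozen and the step counts agree. -/
theorem Exec.shift {w k a : ℕ} {P P' : Program}
    (hP : ∀ p, P'.body (p + k) = (P.body p).shift k a) (low : ℕ → ℕ → ℕ)
    {c : Cmd} {s s' : State} {t : ℕ} (h : Exec w P c s t s') :
    Exec w P' (c.shift k a) ⟨s.var, joinArr a low s.arr⟩ t ⟨s'.var, joinArr a low s'.arr⟩ := by
  induction h with
  | skip s => exact .skip _
  | const s x c => exact .const _ x c
  | op s o x y z => exact .op _ o x y z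
  | load s x α y =>
    have := Exec.load (w := w) (P := P') ⟨s.var, joinArr a low s.arr⟩ x (α + a) y
    simp only [State.setVar, joinArr_add] at this
    exact this
  | store s α y x =>
    have := Exec.store (w := w) (P := P') ⟨s.var, joinArr a low s.arr⟩ (α + a) y x
    simp only [State.setArr, joinArr_add, joinArr_update] at this
    exact this
  | seq _ _ ih₁ ih₂ => exact .seq ih₁ ih₂
  | ite_true h _ ih => exact .ite_true h ih
  | ite_false h _ ih => exact .ite_false h ih
  | while_true h _ _ ih₁ ih₂ => exact .while_true h ih₁ ih₂
  | while_false h => exact .while_false h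
  | @call x p args s s' t _ ih =>
    refine .call (s := ⟨s.var, joinArr a low s.arr⟩) (s' := ⟨s'.var, joinArr a low s'.arr⟩) ?_
    rw [hP]
    exact ih

/-- The program multiplies square matrices of size `n` in at most `τ n` steps, on words with at
least `c log₂ (n + 2)` bits. -/
def Multiplies (P : Program) (c : ℕ) (τ : ℕ → ℕ) : Prop :=
  ∀ n : ℕ, 0 < n → ∀ (A B : Matrix (Fin n) (Fin n) (ZMod 2)) (w : ℕ) (s : State),
    (n + 2) ^ c ≤ 2 ^ w → IsInitial w [n] s → HoldsMatrix s 0 A → HoldsMatrix s 1 B →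
      ∃ (t : ℕ) (s' : State), P.Runs w s t s' ∧ t ≤ τ n ∧ HoldsMatrix s' 2 (A * B)

theorem val_natCast_of_le_one {x : ℕ} (hx : x ≤ 1) : ((x : ZMod 2)).val = x := by
  interval_cases x <;> rfl

/-- The guest program sees the arrays from `16` on as its whole memory, so its operands and its
result are the arrays `16`, `17` and `18`. Whatever earlier calls have left behind counts as
uninitialized memory. The two extra steps are the call and its single argument. -/
theorem Does.multiply {P P' : Program} {c w n x y : ℕ} {τ : ℕ → ℕ} {σ : State} {Q : State → Prop}
    (hP : ∀ p, P'.body (p + 3) = (P.body p).shift 3 16) (hM : Multiplies P c τ)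
    (hn : 0 < n) (hw : (n + 2) ^ c ≤ 2 ^ w) (hy : y < 20) (hyn : σ.var y = n)
    (hA : ∀ i < n, ∀ j < n, σ.arr 16 (i * n + j) ≤ 1)
    (hB : ∀ i < n, ∀ j < n, σ.arr 17 (i * n + j) ≤ 1)
    (hQ : ∀ (r : ℕ) (arr : ℕ → ℕ → ℕ), (∀ α < 16, arr α = σ.arr α) →
      (∀ i < n, ∀ j < n, arr 18 (i * n + j) ≤ 1 ∧
        (arr 18 (i * n + j) : ZMod 2) =
          ∑ p ∈ Finset.range n, (σ.arr 16 (i * n + p) : ZMod 2) * (σ.arr 17 (p * n + j) : ZMod 2)) →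
      Q ⟨Function.update σ.var x r, arr⟩) :
    Does w P' 20 (.call x 3 [y]) σ (τ n + 2) Q := fun s hs ha => by
  obtain ⟨t, s', hr, ht, hm⟩ := hM n hn
    (Matrix.of fun i j => (σ.arr 16 (i * n + j) : ZMod 2))
    (Matrix.of fun i j => (σ.arr 17 (i * n + j) : ZMod 2)) w
    ⟨frame [n], fun α => s.arr (α + 16)⟩ hw ⟨rfl, fun α i => hs.2 _ _⟩
    (fun i j => by simp [ha.1, val_natCast_of_le_one (hA i i.2 j j.2)])
    (fun i j => by simp [ha.1, val_natCast_of_le_one (hB i i.2 j j.2)])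
  have hj : joinArr 16 s.arr (fun α => s.arr (α + 16)) = s.arr := by
    funext α
    simp only [joinArr]
    split_ifs with h
    · rfl
    · rw [Nat.sub_add_cancel (by omega)]
  have he := Exec.shift hP s.arr hr
  simp only [hj] at he
  have hP0 := hP 0
  rw [zero_add] at hP0
  rw [← hP0] at he
  have hyn' : s.var y = n := (ha.2 y hy).trans hyn
  refine ⟨t + 1 + 1, _, ⟨Function.update σ.var x (s'.var 0), joinArr 16 s.arr s'.arr⟩,
    .call (args := [y]) (s := s) (by simpa [hyn'] using he), by omega,
    ⟨rfl, fun z hz => ?_⟩, hQ _ _ ?_ ?_⟩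
  · rcases eq_or_ne z x with rfl | hzx
    · simp
    · simp [hzx, ha.2 z hz]
  · intro α hα
    simp [joinArr, hα, ha.1]
  · intro i hi j hj
    have h18 : joinArr 16 s.arr s'.arr 18 = s'.arr 2 := joinArr_add 16 s.arr s'.arr 2
    have h := hm ⟨i, hi⟩ ⟨j, hj⟩
    simp only [h18]
    simp only [Matrix.mul_apply, Matrix.of_apply] at h
    rw [h]
    refine ⟨Nat.lt_succ_iff.1 (ZMod.val_lt _), ?_⟩
    rw [ZMod.natCast_val, ZMod.cast_id', id, Finset.sum_range]

/-! ### Some expressions -/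

namespace AExp

/-- The exclusive or of two bits. -/
def exor (a b : AExp) : AExp := (a - b) + (b - a)

/-- `1` if the value is positive and `0` otherwise. -/
def isPos (a : AExp) : AExp := 1 - (1 - a)

/-- `1` if the values agree and `0` otherwise. -/
def isEq (a b : AExp) : AExp := 1 - ((a - b) + (b - a))

variable (s : State) (M : ℕ) (a b : AExp)

theorem eval_exor : (exor a b).eval s = (a.eval s - b.eval s) + (b.eval s - a.eval s) := rfl

@[simp] theorem eval_isPos : (isPos a).eval s = if a.eval s = 0 then 0 else 1 := by
  simp only [isPos, eval_sub, eval_one]; split_ifs <;> omega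

@[simp] theorem eval_isEq : (isEq a b).eval s = if a.eval s = b.eval s then 1 else 0 := by
  simp only [isEq, eval_sub, eval_add, eval_one]; split_ifs <;> omega

@[simp] theorem fine_exor : (exor a b).Fine M s ↔ a.Fine M s ∧ b.Fine M s := by
  simp only [exor, fine_add, fine_sub]; tauto

@[simp] theorem fine_isPos : (isPos a).Fine M s ↔ 1 ≤ M ∧ a.Fine M s := by
  simp only [isPos, fine_sub, fine_one]; tauto

@[simp] theorem fine_isEq : (isEq a b).Fine M s ↔ 1 ≤ M ∧ a.Fine M s ∧ b.Fine M s := by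
  simp only [isEq, fine_add, fine_sub, fine_one]; tauto

end AExp

theorem exor_bits {x y : ℕ} (hx : x ≤ 1) (hy : y ≤ 1) :
    (x - y) + (y - x) ≤ 1 ∧ (((x - y) + (y - x) : ℕ) : ZMod 2) = x + y := by
  interval_cases x <;> interval_cases y <;> decide

/-! ### Applying a block of column operations -/

section
open AExp

/-- Array `6` holds a matrix with `m` rows of length `m + m`; this is its entry modulo `2`. -/
def entry (arr : ℕ → ℕ → ℕ) (m i j : ℕ) : ZMod 2 := (arr 6 (i * (m + m) + j) : ZMod 2)

/-- The entries of the matrix in array `6` are bits. -/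
def BitMatrix (arr : ℕ → ℕ → ℕ) (m : ℕ) : Prop :=
  ∀ i < m, ∀ j < m + m, arr 6 (i * (m + m) + j) ≤ 1

/-- The coordinate of the vector `x` in the row with number `r - 1`, and `0` if `r = 0`. -/
def pick (x : ℕ → ZMod 2) (r : ℕ) : ZMod 2 := if r = 0 then 0 else x (r - 1)

/-- The procedure with arguments `u, p₀, d, h, m` which, in the matrix `D` of array `6`, adds to
the columns `d, …, d + h - 1` the product of the columns `u, …, u + h - 1` with the `h × h` matrix
of the rows of `D` that are selected by the entries `p₀, …, p₀ + h - 1` of array `7`. -/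
def applyBlockCmd : Cmd :=
  .seq (fill 9 (var 3) (var 3) (var 20 * var 3 + var 21)
    (isPos (get 7 (var 1 + var 20)) *
      get 6 ((get 7 (var 1 + var 20) - 1) * (var 4 + var 4) + (var 2 + var 21)))) <|
  .seq (assign 5 0) <|
  .seq (assign 6 (var 4 / var 3)) <|
  loop 5 6 <|
  .seq (fill 16 (var 3) (var 3) (var 20 * var 3 + var 21)
    (get 6 ((var 5 * var 3 + var 20) * (var 4 + var 4) + (var 0 + var 21)))) <|
  .seq (fill 17 (var 3) (var 3) (var 20 * var 3 + var 21)
    (get 9 (var 20 * var 3 + var 21))) <|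
  .seq (.call 7 3 [3]) <|
  fill 6 (var 3) (var 3) ((var 5 * var 3 + var 20) * (var 4 + var 4) + (var 2 + var 21))
    (exor (get 6 ((var 5 * var 3 + var 20) * (var 4 + var 4) + (var 2 + var 21)))
      (get 18 (var 20 * var 3 + var 21)))

/-- Quotient and remainder recover row and column; this is what keeps different cells of a stored
matrix apart. -/
theorem pair_inj {n i j i' j' : ℕ} (hj : j < n) (hj' : j' < n) (h : i * n + j = i' * n + j') :
    i = i' ∧ j = j' := by
  have hn : 0 < n := by omega
  have e1 : (i * n + j) / n = i := by
    rw [mul_comm, Nat.mul_add_div hn, Nat.div_eq_of_lt hj, add_zero]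
  have e2 : (i' * n + j') / n = i' := by
    rw [mul_comm, Nat.mul_add_div hn, Nat.div_eq_of_lt hj', add_zero]
  have : i = i' := by rw [← e1, h, e2]
  subst this
  exact ⟨rfl, by omega⟩

variable {w M c m : ℕ} {P P' : Program} {τ : ℕ → ℕ} {σ : State}

/-- The entry `(i, j)` after `applyBlockCmd`. -/
def applied (arr : ℕ → ℕ → ℕ) (m u p₀ h i j : ℕ) : ZMod 2 :=
  entry arr m i j +
    ∑ p ∈ Finset.range h, entry arr m i (u + p) * pick (fun r => entry arr m r j) (arr 7 (p₀ + p))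

-- The selected rows are first saved in array `9`, because they may themselves be rows that the loop
-- changes. The `m` rows are then treated in `b` blocks of `h` rows, each by one `h × h` product.
-- Array `17` is refilled in every round, since the multiplication program is not required to
-- preserve its operands.
set_option maxHeartbeats 2000000 in
theorem Does.applyBlock (hw : Big w M) (hP : ∀ p, P'.body (p + 3) = (P.body p).shift 3 16)
    (hM : Multiplies P c τ) {u p₀ d h b : ℕ} (hh : 0 < h) (hhw : (h + 2) ^ c ≤ 2 ^ w)
    (hb : b * h = m) (hb0 : 0 < b) (hmM : (m + m) * (m + m) ≤ M)
    (hu : u + h ≤ m + m) (hd : d + h ≤ m + m)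
    (hp₀ : p₀ + h ≤ m)
    (hv0 : σ.var 0 = u) (hv1 : σ.var 1 = p₀) (hv2 : σ.var 2 = d) (hv3 : σ.var 3 = h)
    (hv4 : σ.var 4 = m) (hbit : BitMatrix σ.arr m)
    (hpiv : ∀ p < h, σ.arr 7 (p₀ + p) ≤ m) {Q : State → Prop}
    (hQ : ∀ s : State, (∀ β < 16, β ≠ 6 → β ≠ 9 → s.arr β = σ.arr β) → BitMatrix s.arr m →
      (∀ i < m, ∀ j < m + m, entry s.arr m i j =
        if d ≤ j ∧ j < d + h then applied σ.arr m u p₀ h i j else entry σ.arr m i j) → Q s) :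
    Does w P' 20 applyBlockCmd σ
      (b * (4000 * (h * h + 1) + τ h) + 2000 * (h * h + 1)) Q := by
  have hm : 0 < m := by rw [← hb]; positivity
  have hhm : h ≤ m := by omega
  have h2M : m + m ≤ M := by nlinarith
  have hM4 : 4 ≤ M := by nlinarith
  have hhh : h * h ≤ M := by nlinarith
  have hidx : ∀ i < m, ∀ j < m + m, i * (m + m) + j ≤ M := fun i hi j hj => by nlinarith
  refine Does.le (B := 1000 * (h * h + 1) + (110 + (110 + (b * ((1000 * (h * h + 1) +
    (1000 * (h * h + 1) + ((τ h + 2) + 1000 * (h * h + 1)))) + 111) + 1)))) ?_ ?_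
  swap
  · have : b * (3000 * (h * h + 1) + τ h + 113) ≤ b * (4000 * (h * h + 1) + τ h) :=
      Nat.mul_le_mul_left _ (by nlinarith)
    have e : 1000 * (h * h + 1) + (1000 * (h * h + 1) + (τ h + 2 + 1000 * (h * h + 1))) + 111 =
        3000 * (h * h + 1) + τ h + 113 := by ring
    rw [e]; nlinarith
  -- the selected rows
  refine .seq (.fill hw rfl rfl rfl rfl rfl (m := h) (n := h) ?_ ?_ ?_ ?_ ?_ hhh
    (fun i j => i * h + j)
    (fun i j => if σ.arr 7 (p₀ + i) = 0 then 0 else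
      σ.arr 6 ((σ.arr 7 (p₀ + i) - 1) * (m + m) + (d + j))) ?_ ?_ ?_)
  · simp [hv3]; omega
  · simp [hv3]; omega
  · simp [hv3]
  · simp [hv3]
  · omega
  · exact fun i _ j hj i' _ j' hj' he => pair_inj hj hj' he
  · intro i hi j hj s hs h20 h21 hA _
    have e7 : s.arr 7 = σ.arr 7 := hA 7 (by norm_num)
    have e6 : s.arr 6 = σ.arr 6 := hA 6 (by norm_num)
    have hpi := hpiv i hi
    have hb1 := hbit (σ.arr 7 (p₀ + i) - 1) (by omega) (d + j) (by omega)
    simp only [fine_add, fine_mul, fine_var, fine_isPos, fine_get, fine_sub, fine_one, eval_add,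
      eval_mul, eval_var, eval_isPos, eval_get, eval_sub, eval_one, hs 1, hs 2, hs 3, hs 4,
      Nat.reduceLT, hv1, hv2, hv3, hv4, h20, h21, e7, e6]
    refine ⟨?_, ?_, trivial, ?_⟩
    · omega
    · omega
    · split_ifs <;> simp
  intro arr₁ g1 g2 _
  -- the loop over the blocks of rows
  refine .seq (.assign hw (by norm_num) (by norm_num) rfl (by simp) ?_)
  refine .seq (.assign hw (by norm_num) (by norm_num) rfl (by simp [State.setVar_var, hv3, hv4]; omega) ?_)
  have hdiv : m / h = b := by rw [← hb]; exact Nat.mul_div_cancel b hh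
  have hbm : b ≤ m := by rw [← hb]; nlinarith
  refine .loop hw (by norm_num) (by norm_num) (by norm_num) (by norm_num) (N := b) (by omega)
    (fun q s => s.var 0 = u ∧ s.var 2 = d ∧ s.var 3 = h ∧ s.var 4 = m ∧
      (∀ β < 16, β ≠ 6 → β ≠ 9 → s.arr β = σ.arr β) ∧ s.arr 9 = arr₁ 9 ∧ BitMatrix s.arr m ∧
      (∀ i < m, ∀ j < m + m, entry s.arr m i j =
        if i < q * h ∧ d ≤ j ∧ j < d + h then applied σ.arr m u p₀ h i j
        else entry σ.arr m i j)) ?_ ?_ ?_ ?_ ?_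
  · simp only [State.setVar_var, State.setVar_arr, hv0, hv2, hv3, hv4, Nat.reduceEqDiff, if_false]
    refine ⟨trivial, trivial, trivial, trivial, fun β _ _ h9 => g1 β h9, trivial, fun i hi j hj => ?_,
      fun i hi j hj => ?_⟩
    · rw [g1 6 (by norm_num)]; exact hbit i hi j hj
    · simp [entry, g1 6]
  · simp [State.setVar_var]
  · simp [State.setVar_var, hv3, hv4, hdiv]
  · rintro q hq s ⟨k0, k2, k3, k4, kA, k9, kb, kE⟩ hs5 hs6
    have hqh : ∀ i < h, q * h + i < m := fun i hi => by
      have := Nat.mul_le_mul_right h (Nat.succ_le_of_lt hq)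
      rw [Nat.succ_mul, hb] at this; omega
    have h9 : ∀ i < h, ∀ j < h, s.arr 9 (i * h + j) ≤ 1 := fun i hi j hj => by
      rw [k9, g2 i hi j hj]
      split_ifs
      · simp
      · exact hbit _ (by have := hpiv i hi; omega) _ (by omega)
    refine .seq (.fill hw rfl rfl rfl rfl rfl (m := h) (n := h) ?_ ?_ ?_ ?_ ?_ hhh
      (fun i j => i * h + j)
      (fun i j => s.arr 6 ((q * h + i) * (m + m) + (u + j))) ?_ ?_ ?_)
    · simp [k3]; omega
    · simp [k3]; omega
    · simp [k3]
    · simp [k3]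
    · omega
    · exact fun i _ j hj i' _ j' hj' he => pair_inj hj hj' he
    · intro i hi j hj s' hs h20 h21 hA _
      have e6 : s'.arr 6 = s.arr 6 := hA 6 (by norm_num)
      have hb1 := kb (q * h + i) (hqh i hi) (u + j) (by omega)
      simp only [fine_add, fine_mul, fine_var, fine_get, eval_add,
        eval_mul, eval_var, eval_get, hs 0, hs 3, hs 4, hs 5,
        Nat.reduceLT, k0, k3, k4, hs5, h20, h21, e6]
      exact ⟨by omega, by omega, by trivial, by trivial⟩
    intro arr₂ f1 f2 _
    refine .seq (.fill hw rfl rfl rfl rfl rfl (m := h) (n := h) ?_ ?_ ?_ ?_ ?_ hhh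
      (fun i j => i * h + j) (fun i j => s.arr 9 (i * h + j)) ?_ ?_ ?_)
    · simp [k3]; omega
    · simp [k3]; omega
    · simp [k3]
    · simp [k3]
    · omega
    · exact fun i _ j hj i' _ j' hj' he => pair_inj hj hj' he
    · intro i hi j hj s' hs h20 h21 hA _
      have e9 : s'.arr 9 = s.arr 9 := (hA 9 (by norm_num)).trans (f1 9 (by norm_num))
      have hb1 := h9 i hi j hj
      simp only [fine_add, fine_mul, fine_var, fine_get, eval_add,
        eval_mul, eval_var, eval_get, hs 3,
        Nat.reduceLT, k3, h20, h21, e9]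
      exact ⟨by omega, by omega, by trivial, by trivial⟩
    intro arr₃ e1 e2 _
    dsimp only at e1
    have e16 : ∀ i < h, ∀ j < h, arr₃ 16 (i * h + j) =
        s.arr 6 ((q * h + i) * (m + m) + (u + j)) := fun i hi j hj => by
      rw [e1 16 (by norm_num), f2 i hi j hj]
    refine .seq (.multiply hP hM hh hhw (by norm_num) k3 ?_ ?_ ?_)
    · intro i hi j hj
      show arr₃ 16 _ ≤ 1
      rw [e16 i hi j hj]
      exact kb _ (hqh i hi) _ (by omega)
    · intro i hi j hj
      show arr₃ 17 _ ≤ 1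
      rw [e2 i hi j hj]
      exact h9 i hi j hj
    intro r arr₄ d1 d2
    dsimp only at d1 d2
    have hlow4 : ∀ β < 16, arr₄ β = s.arr β := fun β hβ => by
      rw [d1 β hβ, e1 β (by omega), f1 β (by omega)]
    have hI : ∀ i < h, ∀ j < h, ∀ i' < h, ∀ j' < h,
        (q * h + i) * (m + m) + (d + j) = (q * h + i') * (m + m) + (d + j') →
          i = i' ∧ j = j' := fun i hi j hj i' hi' j' hj' he => by
      have := pair_inj (by omega) (by omega) he
      omega
    refine .fill hw rfl rfl rfl rfl rfl (m := h) (n := h) ?_ ?_ ?_ ?_ ?_ hhh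
      (fun i j => (q * h + i) * (m + m) + (d + j))
      (fun i j => (s.arr 6 ((q * h + i) * (m + m) + (d + j)) - arr₄ 18 (i * h + j)) +
        (arr₄ 18 (i * h + j) - s.arr 6 ((q * h + i) * (m + m) + (d + j)))) hI ?_ ?_
    · simp [k3]; omega
    · simp [k3]; omega
    · simp [k3]
    · simp [k3]
    · omega
    · intro i hi j hj s' hs h20 h21 hA hB
      have e18 : s'.arr 18 = arr₄ 18 := hA 18 (by norm_num)
      have e6 : s'.arr 6 ((q * h + i) * (m + m) + (d + j)) =
          s.arr 6 ((q * h + i) * (m + m) + (d + j)) := by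
        rw [hB]
        · show arr₄ 6 _ = _
          rw [hlow4 6 (by norm_num)]
        · intro i' hi' j' hj' hlt he
          obtain ⟨rfl, rfl⟩ := hI i hi j hj i' hi' j' hj' he
          omega
      have hb1 := kb (q * h + i) (hqh i hi) (d + j) (by omega)
      have hb2 := (d2 i hi j hj).1
      simp only [fine_add, fine_mul, fine_var, fine_get, eval_add, fine_exor, eval_exor,
        eval_mul, eval_var, eval_get, hs 2, hs 3, hs 4, hs 5, h20, h21, e18,
        Nat.reduceLT, Function.update_apply, Nat.reduceEqDiff, if_false, k2, k3, k4, hs5, e6]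
      exact ⟨by omega, by omega, trivial, trivial⟩
    intro arr₅ c1 c2 c3
    have hnew : ∀ i < h, ∀ j < h, arr₅ 6 ((q * h + i) * (m + m) + (d + j)) ≤ 1 ∧
        entry arr₅ m (q * h + i) (d + j) = applied σ.arr m u p₀ h (q * h + i) (d + j) := by
      intro i hi j hj
      obtain ⟨x1, x2⟩ := exor_bits (kb (q * h + i) (hqh i hi) (d + j) (by omega))
        (d2 i hi j hj).1
      rw [← c2 i hi j hj] at x1 x2
      refine ⟨x1, x2.trans ?_⟩
      -- The rows of the current block have not been changed by the earlier rounds, so both factors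
      -- refer to the original matrix.
      have hold : ∀ r < m, ∀ j < m + m, ¬ (r < q * h ∧ d ≤ j ∧ j < d + h) →
          (s.arr 6 (r * (m + m) + j) : ZMod 2) = entry σ.arr m r j := fun r hr j hj hn => by
        have := kE r hr j hj
        rwa [if_neg hn] at this
      rw [hold _ (hqh i hi) _ (by omega) (by omega), (d2 i hi j hj).2, applied]
      congr 1
      refine Finset.sum_congr rfl fun p hp => ?_
      rw [Finset.mem_range] at hp
      show (arr₃ 16 _ : ZMod 2) * (arr₃ 17 _ : ZMod 2) = _
      rw [e16 i hi p hp, e2 p hp j hj, k9, g2 p hp j hj,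
        hold _ (hqh i hi) _ (by omega) (by omega), pick]
      split_ifs
      · simp
      · rfl
    have hkeep : ∀ i < m, ∀ j < m + m, (¬ ∃ i' < h, ∃ j' < h, i = q * h + i' ∧ j = d + j') →
        arr₅ 6 (i * (m + m) + j) = s.arr 6 (i * (m + m) + j) := by
      intro i hi j hj hn
      rw [c3, ]
      · show arr₄ 6 _ = _
        rw [hlow4 6 (by norm_num)]
      · intro i' hi' j' hj' he
        obtain ⟨a1, a2⟩ := pair_inj hj (by omega) he
        exact hn ⟨i', hi', j', hj', a1, a2⟩
    simp only [State.setVar_var, State.setVar_arr, Function.update_apply, Nat.reduceEqDiff,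
      if_false, k0, k2, k3, k4, hs5, hs6, true_and]
    refine ⟨fun β h16 h6 h9 => ?_, ?_, fun i hi j hj => ?_, fun i hi j hj => ?_⟩
    · rw [c1 β h6]; exact (hlow4 β h16).trans (kA β h16 h6 h9)
    · rw [c1 9 (by norm_num)]; exact (hlow4 9 (by norm_num)).trans k9
    · by_cases hx : ∃ i' < h, ∃ j' < h, i = q * h + i' ∧ j = d + j'
      · obtain ⟨i', hi', j', hj', rfl, rfl⟩ := hx
        exact (hnew i' hi' j' hj').1
      · rw [hkeep i hi j hj hx]; exact kb i hi j hj
    · by_cases hx : ∃ i' < h, ∃ j' < h, i = q * h + i' ∧ j = d + j'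
      · obtain ⟨i', hi', j', hj', rfl, rfl⟩ := hx
        rw [(hnew i' hi' j' hj').2, if_pos]
        rw [Nat.succ_mul]; omega
      · rw [entry, hkeep i hi j hj hx]
        refine (kE i hi j hj).trans ?_
        refine if_congr ⟨fun ⟨a1, a2⟩ => ⟨?_, a2⟩, fun ⟨a1, a2, a3⟩ => ⟨?_, a2, a3⟩⟩ rfl rfl
        · rw [Nat.succ_mul]; omega
        · rw [Nat.succ_mul] at a1
          by_contra hlt
          exact hx ⟨i - q * h, by omega, j - d, by omega, by omega, by omega⟩
  · rintro s ⟨k0, k2, k3, k4, kA, k9, kb, kE⟩ - -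
    refine hQ s kA kb fun i hi j hj => ?_
    rw [kE i hi j hj, hb]
    simp [hi]

end

/-! ### Column-recursive elimination: the algebra -/

/-- The linear map of a block of `c` elimination steps: it adds to a vector the combination of the
columns `m + lo, …` of the matrix in array `6` with the coordinates selected by array `7`. -/
def blockMap (arr : ℕ → ℕ → ℕ) (m lo c : ℕ) (x : ℕ → ZMod 2) : ℕ → ZMod 2 := fun i =>
  x i + ∑ p ∈ Finset.range c, entry arr m i (m + lo + p) * pick x (arr 7 (lo + p))

/-- The arrays `a'` arise from `a` by elimination in the columns `lo, …, lo + c - 1`. Array `7`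
lists the pivot rows (plus `1`, and `0` for columns without pivot), and array `8` marks the used
rows (shifted by `1`). -/
structure Reduced (m lo c : ℕ) (a a' : ℕ → ℕ → ℕ) : Prop where
  frame : ∀ β < 16, β ≠ 6 → β ≠ 7 → β ≠ 8 → β ≠ 9 → a' β = a β
  bits : BitMatrix a' m
  piv_frame : ∀ j, ¬ (lo ≤ j ∧ j < lo + c) → a' 7 j = a 7 j
  keep : ∀ i < m, ∀ j < m, ¬ (lo ≤ j ∧ j < lo + c) →
    entry a' m i j = entry a m i j ∧ entry a' m i (m + j) = entry a m i (m + j)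
  cols : ∀ j, lo ≤ j → j < lo + c → ∀ i < m,
    entry a' m i j = blockMap a' m lo c (fun r => entry a m r j) i
  inj : ∀ x : ℕ → ZMod 2, (∀ i < m, blockMap a' m lo c x i = 0) → ∀ i < m, x i = 0
  piv_le : ∀ j, lo ≤ j → j < lo + c → a' 7 j ≤ m
  piv_zero : ∀ j, lo ≤ j → j < lo + c → a' 7 j = 0 → ∀ i < m, a 8 (i + 1) = 0 →
    (∀ p, lo ≤ p → p < j → a' 7 p ≠ i + 1) → entry a' m i j = 0
  piv_pos : ∀ j, lo ≤ j → j < lo + c → ∀ r, a' 7 j = r + 1 →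
    a 8 (r + 1) = 0 ∧ ∀ i < m, entry a' m i j = if i = r then 1 else 0
  piv_ne : ∀ p j, lo ≤ p → p < j → j < lo + c → a' 7 p = a' 7 j → a' 7 j = 0
  used : ∀ i < m, (a' 8 (i + 1) = 0 ↔
    a 8 (i + 1) = 0 ∧ ∀ p, lo ≤ p → p < lo + c → a' 7 p ≠ i + 1)
  used_le : ∀ i < m, a' 8 (i + 1) ≤ 1

theorem pick_congr {m r : ℕ} {x y : ℕ → ZMod 2} (h : ∀ i < m, x i = y i) (hr : r ≤ m) :
    pick x r = pick y r := by
  unfold pick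
  split_ifs with h0
  · rfl
  · exact h _ (by omega)

theorem pick_add_sum {ι : Type*} (s : Finset ι) (x : ℕ → ZMod 2) (u : ι → ℕ → ZMod 2)
    (k : ι → ZMod 2) (r : ℕ) :
    pick (fun i => x i + ∑ p ∈ s, u p i * k p) r = pick x r + ∑ p ∈ s, pick (u p) r * k p := by
  unfold pick
  split_ifs <;> simp

/-- The selected rows lie below `m`, so vectors matter only in their first `m` coordinates. -/
theorem blockMap_congr {arr : ℕ → ℕ → ℕ} {m lo c : ℕ} {x y : ℕ → ZMod 2}
    (h : ∀ i < m, x i = y i) (hp : ∀ p < c, arr 7 (lo + p) ≤ m) {i : ℕ} (hi : i < m) :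
    blockMap arr m lo c x i = blockMap arr m lo c y i := by
  unfold blockMap
  rw [h i hi]
  congr 1
  refine Finset.sum_congr rfl fun p hp' => ?_
  rw [pick_congr h (hp p (Finset.mem_range.1 hp'))]

/-- With block maps `1 + U₁ S₁` and `1 + U₂ S₂`, the composition is `1 + (U₁ + U₂ S₂ U₁) S₁ + U₂
S₂`, which is again a block map with the concatenated pivots. The update of the second half of the
columns (`e₂`) applies the first map, and the update of `U₁` (`e₄`) performs the composition. The
already reduced columns of the first half need no update: the pivot rows chosen later were unused
there and are zero in these columns, so the second map fixes them. -/
theorem Reduced.merge {m lo h : ℕ} {a a₁ a₂ a₃ a₄ : ℕ → ℕ → ℕ} (hle : lo + (h + h) ≤ m)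
    (r₁ : Reduced m lo h a a₁)
    (f₂ : ∀ β < 16, β ≠ 6 → β ≠ 9 → a₂ β = a₁ β)
    (e₂ : ∀ i < m, ∀ j < m + m, entry a₂ m i j =
      if lo + h ≤ j ∧ j < lo + h + h then applied a₁ m (m + lo) lo h i j else entry a₁ m i j)
    (r₃ : Reduced m (lo + h) h a₂ a₃)
    (f₄ : ∀ β < 16, β ≠ 6 → β ≠ 9 → a₄ β = a₃ β) (b₄ : BitMatrix a₄ m)
    (e₄ : ∀ i < m, ∀ j < m + m, entry a₄ m i j =
      if m + lo ≤ j ∧ j < m + lo + h then applied a₃ m (m + (lo + h)) (lo + h) h i j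
      else entry a₃ m i j) :
    Reduced m lo (h + h) a a₄ := by
  have p2 : a₂ 7 = a₁ 7 := f₂ 7 (by norm_num) (by norm_num) (by norm_num)
  have q2 : a₂ 8 = a₁ 8 := f₂ 8 (by norm_num) (by norm_num) (by norm_num)
  have p4 : a₄ 7 = a₃ 7 := f₄ 7 (by norm_num) (by norm_num) (by norm_num)
  have q4 : a₄ 8 = a₃ 8 := f₄ 8 (by norm_num) (by norm_num) (by norm_num)
  have p31 : ∀ j < lo + h, a₃ 7 j = a₁ 7 j := fun j hj => by
    rw [r₃.piv_frame j (by omega), p2]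
  -- the matrix in the four stages
  have A4 : ∀ i < m, ∀ j < m, entry a₄ m i j = entry a₃ m i j := fun i hi j hj => by
    rw [e₄ i hi j (by omega), if_neg (by omega)]
  have A2 : ∀ i < m, ∀ j < m, ¬ (lo + h ≤ j ∧ j < lo + h + h) →
      entry a₂ m i j = entry a₁ m i j := fun i hi j hj hn => by
    rw [e₂ i hi j (by omega), if_neg hn]
  have U2 : ∀ i < m, ∀ j < m, entry a₂ m i (m + j) = entry a₁ m i (m + j) := fun i hi j hj => by
    rw [e₂ i hi _ (by omega), if_neg (by omega)]
  have U4 : ∀ i < m, ∀ j < m, ¬ (lo ≤ j ∧ j < lo + h) →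
      entry a₄ m i (m + j) = entry a₃ m i (m + j) := fun i hi j hj hn => by
    rw [e₄ i hi _ (by omega), if_neg (by omega)]
  have U31 : ∀ i < m, ∀ p < h, entry a₃ m i (m + lo + p) = entry a₁ m i (m + lo + p) :=
    fun i hi p hp => by
      rw [add_assoc, (r₃.keep i hi (lo + p) (by omega) (by omega)).2, U2 i hi _ (by omega)]
  have le1 : ∀ p < h, a₁ 7 (lo + p) ≤ m := fun p hp => r₁.piv_le _ (by omega) (by omega)
  have le3 : ∀ p < h, a₃ 7 (lo + h + p) ≤ m := fun p hp => r₃.piv_le _ (by omega) (by omega)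
  -- This is the identity `U₁ ↦ U₁ + U₂ S₂ U₁`.
  have U4' : ∀ i < m, ∀ q < h, entry a₄ m i (m + lo + q) = entry a₁ m i (m + lo + q) +
      ∑ p ∈ Finset.range h, entry a₃ m i (m + (lo + h) + p) *
        pick (fun r => entry a₁ m r (m + lo + q)) (a₃ 7 (lo + h + p)) := fun i hi q hq => by
    rw [e₄ i hi _ (by omega), if_pos (by omega), applied, U31 i hi q hq]
    congr 1
    refine Finset.sum_congr rfl fun p hp => ?_
    rw [Finset.mem_range] at hp
    rw [pick_congr (fun r hr => U31 r hr q hq) (le3 p hp)]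
  -- composition of the two maps
  have comp : ∀ x : ℕ → ZMod 2, ∀ i < m, blockMap a₄ m lo (h + h) x i =
      blockMap a₃ m (lo + h) h (blockMap a₁ m lo h x) i := by
    intro x i hi
    have hpick : ∀ r, pick (blockMap a₁ m lo h x) r = pick x r + ∑ q ∈ Finset.range h,
        pick (fun r => entry a₁ m r (m + lo + q)) r * pick x (a₁ 7 (lo + q)) := fun r =>
      pick_add_sum (Finset.range h) x (fun q r => entry a₁ m r (m + lo + q))
        (fun q => pick x (a₁ 7 (lo + q))) r
    have s1 : ∑ q ∈ Finset.range h, entry a₄ m i (m + lo + q) * pick x (a₄ 7 (lo + q)) =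
        ∑ q ∈ Finset.range h, entry a₁ m i (m + lo + q) * pick x (a₁ 7 (lo + q)) +
        ∑ p ∈ Finset.range h, ∑ q ∈ Finset.range h, entry a₃ m i (m + (lo + h) + p) *
          (pick (fun r => entry a₁ m r (m + lo + q)) (a₃ 7 (lo + h + p)) *
            pick x (a₁ 7 (lo + q))) := by
      rw [Finset.sum_comm, ← Finset.sum_add_distrib]
      refine Finset.sum_congr rfl fun q hq => ?_
      rw [Finset.mem_range] at hq
      rw [U4' i hi q hq, p4, p31 _ (by omega), add_mul, Finset.sum_mul]
      congr 1
      exact Finset.sum_congr rfl fun p _ => by ring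
    have s2 : ∑ p ∈ Finset.range h, entry a₄ m i (m + lo + (h + p)) *
          pick x (a₄ 7 (lo + (h + p))) =
        ∑ p ∈ Finset.range h, entry a₃ m i (m + (lo + h) + p) * pick x (a₃ 7 (lo + h + p)) := by
      refine Finset.sum_congr rfl fun p hp => ?_
      rw [Finset.mem_range] at hp
      rw [p4, show m + lo + (h + p) = m + (lo + h + p) by ring, U4 i hi _ (by omega) (by omega),
        show lo + (h + p) = lo + h + p by ring, show m + (lo + h + p) = m + (lo + h) + p by ring]
    have e1 : blockMap a₃ m (lo + h) h (blockMap a₁ m lo h x) i =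
        blockMap a₁ m lo h x i + ∑ p ∈ Finset.range h, entry a₃ m i (m + (lo + h) + p) *
          pick (blockMap a₁ m lo h x) (a₃ 7 (lo + h + p)) := rfl
    rw [e1, blockMap, Finset.sum_range_add, s1, s2]
    simp only [hpick, mul_add, Finset.sum_add_distrib, Finset.mul_sum, blockMap]
    ring
  have hE1 : ∀ i < m, ∀ j, lo + h ≤ j → j < lo + h + h → entry a₂ m i j =
      blockMap a₁ m lo h (fun r => entry a m r j) i := fun i hi j h1 h2 => by
    rw [e₂ i hi j (by omega), if_pos ⟨h1, h2⟩]
    exact blockMap_congr (x := fun r => entry a₁ m r j)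
      (fun r hr => (r₁.keep r hr j (by omega) (by omega)).1) le1 hi
  have E31 : ∀ i < m, ∀ j < lo + h, entry a₃ m i j = entry a₁ m i j := fun i hi j hj => by
    rw [(r₃.keep i hi j (by omega) (by omega)).1, A2 i hi j (by omega) (by omega)]
  -- the pivot rows of the second half are zero in the first half
  have hz : ∀ j, lo ≤ j → j < lo + h → ∀ p < h,
      pick (fun r => entry a₁ m r j) (a₃ 7 (lo + h + p)) = 0 := by
    intro j h1 h2 p hp
    unfold pick
    split_ifs with h0
    · rfl
    obtain ⟨r, hr⟩ := Nat.exists_eq_succ_of_ne_zero h0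
    have hrm : r < m := by have := le3 p hp; omega
    have hu := (r₃.piv_pos _ (by omega) (by omega) r hr).1
    rw [q2, r₁.used r hrm] at hu
    rw [hr, Nat.succ_sub_one]
    rcases Nat.eq_zero_or_pos (a₁ 7 j) with hj | hj
    · exact r₁.piv_zero j h1 h2 hj r hrm hu.1 fun p hp hpj => hu.2 p hp (by omega)
    · obtain ⟨r', hr'⟩ := Nat.exists_eq_succ_of_ne_zero hj.ne'
      show entry a₁ m r j = 0
      rw [(r₁.piv_pos j h1 h2 r' hr').2 r hrm, if_neg]
      rintro rfl
      exact hu.2 j h1 h2 hr'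
  refine ⟨fun β h16 h6 h7 h8 h9 => ?_, b₄, fun j hj => ?_, fun i hi j hj hn => ⟨?_, ?_⟩,
    fun j h1 h2 i hi => ?_, fun x hx => ?_, fun j h1 h2 => ?_, fun j h1 h2 h0 i hi hu hp => ?_,
    fun j h1 h2 r hr => ?_, fun p j h1 h2 h3 he => ?_, fun i hi => ?_, fun i hi => ?_⟩
  · rw [f₄ β h16 h6 h9, r₃.frame β h16 h6 h7 h8 h9, f₂ β h16 h6 h9, r₁.frame β h16 h6 h7 h8 h9]
  · rw [p4, r₃.piv_frame j (by omega), p2, r₁.piv_frame j (by omega)]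
  · rw [A4 i hi j hj, (r₃.keep i hi j hj (by omega)).1, A2 i hi j hj (by omega),
      (r₁.keep i hi j hj (by omega)).1]
  · rw [U4 i hi j hj (by omega), (r₃.keep i hi j hj (by omega)).2, U2 i hi j hj,
      (r₁.keep i hi j hj (by omega)).2]
  · rw [A4 i hi j (by omega), comp _ i hi]
    rcases lt_or_ge j (lo + h) with hj | hj
    · rw [E31 i hi j hj, ← blockMap_congr (x := fun r => entry a₁ m r j)
        (fun r hr => r₁.cols j h1 hj r hr) le3 hi, blockMap, Finset.sum_eq_zero, add_zero]
      intro p hp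
      rw [hz j h1 hj p (Finset.mem_range.1 hp), mul_zero]
    · rw [r₃.cols j hj (by omega) i hi]
      exact blockMap_congr (fun r hr => hE1 r hr j hj (by omega)) le3 hi
  · refine r₁.inj x (r₃.inj _ fun i hi => ?_)
    rw [← comp x i hi, hx i hi]
  · rw [p4]
    rcases lt_or_ge j (lo + h) with hj | hj
    · rw [p31 j hj]; exact r₁.piv_le j h1 hj
    · exact r₃.piv_le j hj (by omega)
  · rw [A4 i hi j (by omega)]
    rw [p4] at h0 hp
    rcases lt_or_ge j (lo + h) with hj | hj
    · rw [E31 i hi j hj]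
      rw [p31 j hj] at h0
      exact r₁.piv_zero j h1 hj h0 i hi hu fun p g1 g2 => by
        rw [← p31 p (by omega)]; exact hp p g1 g2
    · refine r₃.piv_zero j hj (by omega) h0 i hi ?_ fun p g1 g2 => hp p (by omega) g2
      rw [q2, r₁.used i hi]
      refine ⟨hu, fun p g1 g2 => ?_⟩
      rw [← p31 p g2]; exact hp p g1 (by omega)
  · rw [p4] at hr
    rcases lt_or_ge j (lo + h) with hj | hj
    · rw [p31 j hj] at hr
      obtain ⟨g1, g2⟩ := r₁.piv_pos j h1 hj r hr
      exact ⟨g1, fun i hi => by rw [A4 i hi j (by omega), E31 i hi j hj, g2 i hi]⟩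
    · obtain ⟨g1, g2⟩ := r₃.piv_pos j hj (by omega) r hr
      have hrm : r < m := by have := r₃.piv_le j hj (by omega); omega
      rw [q2, r₁.used r hrm] at g1
      exact ⟨g1.1, fun i hi => by rw [A4 i hi j (by omega), g2 i hi]⟩
  · rw [p4] at he ⊢
    rcases lt_or_ge j (lo + h) with hj | hj
    · rw [p31 j hj, p31 p (by omega)] at he
      rw [p31 j hj]; exact r₁.piv_ne p j h1 h2 hj he
    · rcases lt_or_ge p (lo + h) with hp | hp
      · by_contra h0
        obtain ⟨r, hr⟩ := Nat.exists_eq_succ_of_ne_zero h0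
        have hrm : r < m := by have := r₃.piv_le j hj (by omega); omega
        have g1 := (r₃.piv_pos j hj (by omega) r hr).1
        rw [q2, r₁.used r hrm] at g1
        exact g1.2 p h1 hp (by rw [← p31 p hp, he, hr])
      · exact r₃.piv_ne p j hp h2 (by omega) he
  · rw [q4, p4, r₃.used i hi, q2, r₁.used i hi]
    constructor
    · rintro ⟨⟨g1, g2⟩, g3⟩
      refine ⟨g1, fun p k1 k2 => ?_⟩
      rcases lt_or_ge p (lo + h) with hp | hp
      · rw [p31 p hp]; exact g2 p k1 hp
      · exact g3 p hp (by omega)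
    · rintro ⟨g1, g2⟩
      refine ⟨⟨g1, fun p k1 k2 => ?_⟩, fun p k1 k2 => g2 p (by omega) (by omega)⟩
      rw [← p31 p k2]; exact g2 p k1 (by omega)
  · rw [q4]; exact r₃.used_le i hi

/-- The elimination step for a single column. -/
theorem Reduced.single {m lo res : ℕ} {a a' : ℕ → ℕ → ℕ} (hlo : lo < m)
    (hbit : BitMatrix a m) (hused : ∀ i < m, a 8 (i + 1) ≤ 1)
    (hres : res ≤ m)
    (h0 : res = 0 → ∀ i < m, a 8 (i + 1) = 0 → a 6 (i * (m + m) + lo) = 0)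
    (h1 : ∀ r, res = r + 1 → a 8 (r + 1) = 0 ∧ a 6 (r * (m + m) + lo) = 1)
    (hframe : ∀ β < 16, β ≠ 6 → β ≠ 7 → β ≠ 8 → β ≠ 9 → a' β = a β)
    (h7 : a' 7 = Function.update (a 7) lo res) (h8 : a' 8 = Function.update (a 8) res 1)
    (hU : ∀ i < m, a' 6 (i * (m + m) + (m + lo)) = if res = 0 then 0 else
      (a 6 (i * (m + m) + lo) - if i + 1 = res then 1 else 0) +
        ((if i + 1 = res then 1 else 0) - a 6 (i * (m + m) + lo)))
    (hA : ∀ i < m, a' 6 (i * (m + m) + lo) = if res = 0 then a 6 (i * (m + m) + lo) else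
      if i + 1 = res then 1 else 0)
    (hk : ∀ i < m, ∀ j < m + m, j ≠ lo → j ≠ m + lo →
      a' 6 (i * (m + m) + j) = a 6 (i * (m + m) + j)) :
    Reduced m lo 1 a a' := by
  have hb : ∀ i < m, a 6 (i * (m + m) + lo) ≤ 1 := fun i hi => hbit i hi lo (by omega)
  have hite : ∀ i, (if i + 1 = res then 1 else 0 : ℕ) ≤ 1 := fun i => by split_ifs <;> simp
  have hU' : ∀ i < m, entry a' m i (m + lo) = if res = 0 then 0 else
      entry a m i lo + if i + 1 = res then 1 else 0 := fun i hi => by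
    rw [entry, hU i hi]
    split_ifs with hr
    · simp
    · rw [(exor_bits (hb i hi) (by norm_num)).2]; simp [entry]
    · rw [(exor_bits (hb i hi) (by norm_num)).2]; simp [entry]
  have hA' : ∀ i < m, entry a' m i lo = if res = 0 then entry a m i lo else
      if i + 1 = res then 1 else 0 := fun i hi => by
    rw [entry, hA i hi]
    split_ifs <;> simp [entry]
  have hp : a' 7 lo = res := by simp [h7]
  have hjlo : ∀ {j}, lo ≤ j → j < lo + 1 → j = lo := fun h1 h2 => by omega
  have hmap : ∀ x i, blockMap a' m lo 1 x i = x i + entry a' m i (m + lo) * pick x res := by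
    intro x i; simp [blockMap, hp]
  refine ⟨hframe, fun i hi j hj => ?_, fun j hj => ?_, fun i hi j hj hn => ⟨?_, ?_⟩,
    fun j g1 g2 i hi => ?_, fun x hx => ?_, fun j g1 g2 => ?_, fun j g1 g2 g0 i hi hu _ => ?_,
    fun j g1 g2 r hr => ?_, fun p j g1 g2 g3 he => by omega, fun i hi => ?_, fun i hi => ?_⟩
  · by_cases hj1 : j = lo
    · rw [hj1, hA i hi]; split_ifs
      · exact hb i hi
      · simp
      · simp
    by_cases hj2 : j = m + lo
    · rw [hj2, hU i hi]
      have := hb i hi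
      split_ifs <;> omega
    · rw [hk i hi j hj hj1 hj2]; exact hbit i hi j hj
  · rw [h7, Function.update_of_ne (by omega)]
  · rw [entry, hk i hi j (by omega) (by omega) (by omega), entry]
  · rw [entry, hk i hi _ (by omega) (by omega) (by omega), entry]
  · obtain rfl := hjlo g1 g2
    rw [hmap, hA' i hi, hU' i hi]
    rcases Nat.eq_zero_or_pos res with h | h
    · simp [h]
    · obtain ⟨r, hr⟩ := Nat.exists_eq_succ_of_ne_zero h.ne'
      -- Here `U` is the column plus the unit vector of the pivot row `r`. As the pivot entry is
      -- `1`, the column is sent to `x + (x + e_r) = e_r`.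
      have : entry a m r j = 1 := by simp [entry, (h1 r hr).2]
      rw [if_neg h.ne', if_neg h.ne', pick, if_neg h.ne', hr, Nat.succ_sub_one, this, mul_one,
        ← add_assoc, CharTwo.add_self_eq_zero, zero_add]
  · simp only [hmap] at hx
    rcases Nat.eq_zero_or_pos res with h | h
    · intro i hi; have := hx i hi; simpa [pick, h] using this
    · obtain ⟨r, hr⟩ := Nat.exists_eq_succ_of_ne_zero h.ne'
      have hrm : r < m := by omega
      have e1 : entry a m r lo = 1 := by simp [entry, (h1 r hr).2]
      have hpk : pick x res = x r := by rw [pick, if_neg h.ne', hr, Nat.succ_sub_one]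
      -- The coefficient of `U` in the pivot row is `1 + 1 = 0`, so the map keeps the coordinate `x
      -- r`; once that is zero, the correction vanishes in all rows.
      have hxr : x r = 0 := by
        have := hx r hrm
        rwa [hU' r hrm, if_neg h.ne', if_pos hr.symm, e1, CharTwo.add_self_eq_zero, zero_mul,
          add_zero] at this
      intro i hi; have := hx i hi; simpa [hpk, hxr] using this
  · obtain rfl := hjlo g1 g2; rw [hp]; exact hres
  · obtain rfl := hjlo g1 g2
    rw [hp] at g0
    rw [hA' i hi, if_pos g0, entry, h0 g0 i hi hu]; simp
  · obtain rfl := hjlo g1 g2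
    rw [hp] at hr
    refine ⟨(h1 r hr).1, fun i hi => ?_⟩
    rw [hA' i hi, if_neg (by omega), hr]
    simp
  · rw [h8]
    constructor
    · intro h
      have hne : i + 1 ≠ res := by rintro e; simp [e] at h
      rw [Function.update_of_ne hne] at h
      refine ⟨h, fun p g1 g2 => ?_⟩
      obtain rfl := hjlo g1 g2
      rw [hp]; exact hne.symm
    · rintro ⟨h, g⟩
      have := g lo le_rfl (by omega)
      rw [hp] at this
      rw [Function.update_of_ne this.symm, h]
  · rw [h8, Function.update_apply]
    split_ifs
    · simp
    · exact hused i hi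

/-! ### Column-recursive elimination: the program -/

section
open AExp

/-- The elimination of the column `lo` (variable `0`) of a matrix with `m` rows (variable `2`). -/
def eliminateColumnCmd : Cmd :=
  .seq (assign 4 0) <|
  .seq (fold 4 (var 2)
    (((1 - get 8 (var 21 + 1)) * get 6 (var 21 * (var 2 + var 2) + var 0)) * (var 21 + 1) +
      (1 - (1 - get 8 (var 21 + 1)) * get 6 (var 21 * (var 2 + var 2) + var 0)) * var 4)) <|
  .seq (storeAt 7 (var 0) (var 4)) <|
  .seq (storeAt 8 (var 4) 1) <|
  .seq (fill 6 (var 2) 1 (var 20 * (var 2 + var 2) + (var 2 + var 0))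
    (isPos (var 4) * exor (get 6 (var 20 * (var 2 + var 2) + var 0))
      (isEq (var 20 + 1) (var 4)))) <|
  fill 6 (var 2) 1 (var 20 * (var 2 + var 2) + var 0)
    (isPos (var 4) * isEq (var 20 + 1) (var 4) +
      (1 - isPos (var 4)) * get 6 (var 20 * (var 2 + var 2) + var 0))

/-- The procedure with arguments `lo, c, m` that eliminates in the columns `lo, …, lo + c - 1`,
where `c` is a power of `2`. -/
def eliminateCmd : Cmd :=
  .seq (assign 3 2) <|
  .ite 1 3 eliminateColumnCmd <|
  .seq (assign 4 (var 1 / 2)) <|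
  .seq (.call 5 1 [0, 4, 2]) <|
  .seq (assign 6 (var 2 + var 0)) <|
  .seq (assign 7 (var 0 + var 4)) <|
  .seq (.call 5 2 [6, 0, 7, 4, 2]) <|
  .seq (.call 5 1 [7, 4, 2]) <|
  .seq (assign 8 (var 2 + var 7)) <|
  .call 5 2 [8, 7, 6, 4, 2]

/-- The last `i < q` with the property, plus `1`; and `0` if there is none. -/
def lastSucc (p : ℕ → Prop) [DecidablePred p] : ℕ → ℕ
  | 0 => 0
  | q + 1 => if p q then q + 1 else lastSucc p q

theorem lastSucc_le (p : ℕ → Prop) [DecidablePred p] (q : ℕ) : lastSucc p q ≤ q := by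
  induction q with
  | zero => exact le_rfl
  | succ q ih => simp only [lastSucc]; split_ifs <;> omega

theorem lastSucc_eq_zero {p : ℕ → Prop} [DecidablePred p] {q : ℕ} (h : lastSucc p q = 0) :
    ∀ i < q, ¬ p i := by
  induction q with
  | zero => simp
  | succ q ih =>
    simp only [lastSucc] at h
    split_ifs at h with hp
    intro i hi
    rcases Nat.lt_succ_iff_lt_or_eq.1 hi with hlt | rfl
    · exact ih h i hlt
    · exact hp

theorem lastSucc_eq_succ {p : ℕ → Prop} [DecidablePred p] {q r : ℕ} (h : lastSucc p q = r + 1) :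
    p r := by
  induction q with
  | zero => simp [lastSucc] at h
  | succ q ih =>
    simp only [lastSucc] at h
    split_ifs at h with hp
    · obtain rfl : q = r := by omega
      exact hp
    · exact ih h

variable {w M c m : ℕ} {P P' : Program} {τ : ℕ → ℕ} {σ : State}

/-- The pivot is the last unused row with entry `1`, increased by one so that `0` can mean that
there is none. In that case the mark goes to cell `0` of array `8`, which belongs to no row because
of the shift. Column `m + lo` is computed from the old column `lo` and is therefore written first.
-/
theorem Does.eliminateColumn (hw : Big w M) {lo : ℕ} (hlo : lo < m)
    (hmM : (m + m) * (m + m) ≤ M) (hv0 : σ.var 0 = lo) (hv2 : σ.var 2 = m)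
    (hbit : BitMatrix σ.arr m) (hused : ∀ i < m, σ.arr 8 (i + 1) ≤ 1) :
    Does w P' 20 eliminateColumnCmd σ (9000 * (m + 1)) fun s => Reduced m lo 1 σ.arr s.arr := by
  have h2M : m + m ≤ M := by nlinarith
  have hM4 : 4 ≤ M := by nlinarith
  have hidx : ∀ i < m, ∀ j < m + m, i * (m + m) + j ≤ M := fun i hi j hj => by nlinarith
  set p : ℕ → Prop := fun i => σ.arr 8 (i + 1) = 0 ∧ σ.arr 6 (i * (m + m) + lo) = 1 with hp
  refine Does.le (B := 110 + (1000 * (m + 1) + (210 + (210 + (1000 * (m * 1 + 1) +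
    1000 * (m * 1 + 1)))))) ?_ (by omega)
  refine .seq (.assign hw (by norm_num) (by norm_num) rfl (by simp) ?_)
  refine .seq (.fold hw (by norm_num) rfl rfl (N := m) ?_ ?_ (by omega) (lastSucc p) ?_ ?_ ?_)
  · simp [State.setVar_var, hv2]; omega
  · simp [State.setVar_var, hv2]
  · simp [State.setVar_var, lastSucc]
  · intro q hq s hs h4 h21 harr
    have hb := hbit q hq lo (by omega)
    have hu := hused q hq
    have hl := lastSucc_le p q
    simp only [State.setVar_arr] at harr
    have hs0 : s.var 0 = lo := by rw [hs 0 (by norm_num) (by norm_num)]; simp [State.setVar_var, hv0]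
    have hs2 : s.var 2 = m := by rw [hs 2 (by norm_num) (by norm_num)]; simp [State.setVar_var, hv2]
    simp only [fine_add, fine_mul, fine_var, fine_get, fine_sub, fine_one, eval_add,
      eval_mul, eval_var, eval_get, eval_sub, eval_one, hs0, hs2, h4, h21, harr]
    refine ⟨by omega, ?_⟩
    -- The expression is a branch-free selection by the product of the two bits, so checking the
    -- four cases suffices.
    simp only [lastSucc, hp]
    interval_cases hx : σ.arr 8 (q + 1) <;> interval_cases hy : σ.arr 6 (q * (m + m) + lo) <;>
      simp
  set res := lastSucc p m with hres
  have hresm : res ≤ m := lastSucc_le p m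
  set s₁ := (σ.setVar 4 0).setVar 4 res with hs₁
  have k0 : s₁.var 0 = lo := by simp [hs₁, State.setVar_var, hv0]
  have k2 : s₁.var 2 = m := by simp [hs₁, State.setVar_var, hv2]
  have k4 : s₁.var 4 = res := by simp [hs₁, State.setVar_var]
  change Does w P' 20 _ s₁ _ _
  refine .seq (.storeAt hw (by norm_num) rfl rfl (by simp [k0]; omega) (by simp [k4]; omega) ?_)
  rw [eval_var, eval_var, k0, k4]
  refine .seq (.storeAt hw (by norm_num) rfl rfl (by simp [k4]; omega) (by simp; omega) ?_)
  rw [eval_var, eval_one, State.setArr_var, k4]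
  set s₂ := (s₁.setArr 7 lo res).setArr 8 res 1 with hs₂
  have n0 : s₂.var 0 = lo := k0
  have n2 : s₂.var 2 = m := k2
  have n4 : s₂.var 4 = res := k4
  have n7 : s₂.arr 7 = Function.update (σ.arr 7) lo res := by
    funext x
    simp [hs₂, hs₁, State.setArr_arr, Function.update_apply]
  have n8 : s₂.arr 8 = Function.update (σ.arr 8) res 1 := by
    funext x
    simp [hs₂, hs₁, State.setArr_arr, Function.update_apply]
  have nβ : ∀ β, β ≠ 7 → β ≠ 8 → s₂.arr β = σ.arr β := by
    intro β h7 h8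
    funext x
    simp [hs₂, hs₁, State.setArr_arr, h7, h8]
  have n6 := nβ 6 (by norm_num) (by norm_num)
  refine .seq (.fill hw rfl rfl rfl rfl rfl (m := m) (n := 1) ?_ ?_ ?_ ?_ ?_ ?_
    (fun i _ => i * (m + m) + (m + lo)) (fun i _ => if res = 0 then 0 else
      (σ.arr 6 (i * (m + m) + lo) - if i + 1 = res then 1 else 0) +
        ((if i + 1 = res then 1 else 0) - σ.arr 6 (i * (m + m) + lo))) ?_ ?_ ?_)
  · simp [n2]; omega
  · simp; omega
  · simp [n2]
  · simp
  · omega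
  · omega
  · intro i _ j hj i' _ j' hj' he
    have := pair_inj (by omega) (by omega) he
    omega
  · intro i hi j hj s hs h20 h21 hA hB
    have e6 : s.arr 6 (i * (m + m) + lo) = σ.arr 6 (i * (m + m) + lo) := by
      rw [hB, n6]
      intro i' hi' j' hj' _ he
      have := pair_inj (by omega) (by omega) he
      omega
    have hb := hbit i hi lo (by omega)
    have hx := hidx i hi (m + lo) (by omega)
    simp only [fine_add, fine_mul, fine_var, fine_get, fine_isPos, fine_exor, fine_isEq, fine_one,
      eval_add, eval_mul, eval_var, eval_get, eval_isPos, eval_exor, eval_isEq, eval_one,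
      hs 0, hs 2, hs 4, Nat.reduceLT, Nat.ofNat_pos, h20, n0, n2, n4, e6]
    refine ⟨by omega, by omega, trivial, ?_⟩
    by_cases h0 : res = 0 <;> simp [h0]
  intro arr₁ g1 g2 g3
  refine .fill hw rfl rfl rfl rfl rfl (m := m) (n := 1) ?_ ?_ ?_ ?_ ?_ ?_
    (fun i _ => i * (m + m) + lo) (fun i _ => if res = 0 then σ.arr 6 (i * (m + m) + lo) else
      if i + 1 = res then 1 else 0) ?_ ?_ ?_
  · simp [n2]; omega
  · simp; omega
  · simp [n2]
  · simp
  · omega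
  · omega
  · intro i _ j hj i' _ j' hj' he
    have := pair_inj (by omega) (by omega) he
    omega
  · intro i hi j hj s hs h20 h21 hA hB
    dsimp only at hs hA hB
    have e6 : s.arr 6 (i * (m + m) + lo) = σ.arr 6 (i * (m + m) + lo) := by
      rw [hB, g3, n6]
      · intro i' hi' j' hj' he
        have := pair_inj (by omega) (by omega) he
        omega
      · intro i' hi' j' hj' hlt he
        have := pair_inj (by omega) (by omega) he
        omega
    have hb := hbit i hi lo (by omega)
    have hx := hidx i hi lo (by omega)
    simp only [fine_add, fine_mul, fine_var, fine_get, fine_isPos, fine_isEq, fine_one, fine_sub,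
      eval_add, eval_mul, eval_var, eval_get, eval_isPos, eval_isEq, eval_one, eval_sub,
      hs 0, hs 2, hs 4, Nat.reduceLT, Nat.ofNat_pos, h20, n0, n2, n4, e6]
    refine ⟨by omega, by omega, trivial, ?_⟩
    by_cases h0 : res = 0 <;> simp [h0]
  intro arr₂ f1 f2 f3
  dsimp only at f1 f2 f3 ⊢
  have hcol : ∀ i < m, ∀ j < m + m, ∀ d < m + m, j ≠ d → ∀ i' < m, ∀ j' < 1,
      i * (m + m) + j ≠ i' * (m + m) + d := fun i hi j hj d hd hne i' hi' j' hj' he =>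
    hne (pair_inj hj hd he).2
  refine Reduced.single (res := res) hlo hbit hused hresm ?_ ?_ ?_ ?_ ?_ ?_ ?_ ?_
  · intro h0 i hi hu
    have := lastSucc_eq_zero h0 i hi
    have hb := hbit i hi lo (by omega)
    have : ¬ σ.arr 6 (i * (m + m) + lo) = 1 := fun h => this ⟨hu, h⟩
    omega
  · intro r hr
    exact lastSucc_eq_succ hr
  · intro β _ h6 h7 h8 _
    rw [f1 β h6, g1 β h6, nβ β h7 h8]
  · rw [f1 7 (by norm_num), g1 7 (by norm_num), n7]
  · rw [f1 8 (by norm_num), g1 8 (by norm_num), n8]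
  · intro i hi
    rw [f3 _ (hcol i hi _ (by omega) _ (by omega) (by omega)), g2 i hi 0 (by norm_num)]
  · intro i hi
    rw [f2 i hi 0 (by norm_num)]
  · intro i hi j hj h1 h2
    rw [f3 _ (hcol i hi _ (by omega) _ (by omega) (by omega)),
      g3 _ (hcol i hi _ (by omega) _ (by omega) (by omega)), n6]

/-- The time of one application of a block of `h` column operations. -/
def applyTime (τ : ℕ → ℕ) (b h : ℕ) : ℕ :=
  b * (4000 * (h * h + 1) + τ h) + 2000 * (h * h + 1)

/-- The time of the elimination in `2 ^ l` columns of a matrix with `2 ^ L` rows. -/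
def eliminateTime (τ : ℕ → ℕ) (L : ℕ) : ℕ → ℕ
  | 0 => 9000 * (2 ^ L + 1) + 200
  | l + 1 => 2 * eliminateTime τ L l + 2 * applyTime τ (2 ^ (L - l)) (2 ^ l) + 1000

/-- Induction on `l`: the two recursive calls and the two block updates are exactly the four stages
of `Reduced.merge`. Since `m` and the block length are powers of two, the rows split evenly into `2
^ (L - l)` blocks. -/
theorem Does.eliminate (hw : Big w M) (hP : ∀ p, P'.body (p + 3) = (P.body p).shift 3 16)
    (hP1 : P'.body 1 = eliminateCmd) (hP2 : P'.body 2 = applyBlockCmd)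
    (hM : Multiplies P c τ) {L : ℕ} (hm : m = 2 ^ L) (hmw : (m + 2) ^ c ≤ 2 ^ w)
    (hmM : (m + m) * (m + m) ≤ M) (l : ℕ) :
    l ≤ L → ∀ (lo : ℕ) (σ : State), lo + 2 ^ l ≤ m → σ.var 0 = lo → σ.var 1 = 2 ^ l →
      σ.var 2 = m → BitMatrix σ.arr m → (∀ i < m, σ.arr 8 (i + 1) ≤ 1) →
      Does w P' 20 eliminateCmd σ (eliminateTime τ L l)
        fun s => Reduced m lo (2 ^ l) σ.arr s.arr := by
  have hm0 : 0 < m := by rw [hm]; positivity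
  have h2M : m + m ≤ M := by nlinarith
  have hM4 : 4 ≤ M := by nlinarith
  induction l with
  | zero =>
    intro _ lo σ hlo hv0 hv1 hv2 hbit hused
    rw [pow_zero] at *
    refine Does.le (B := 110 + (9000 * (m + 1) + 1)) ?_ (by rw [eliminateTime, hm]; omega)
    refine .seq (.assign hw (by norm_num) (by norm_num) rfl (by simp; omega) ?_)
    refine .ite (by norm_num) (by norm_num) (fun _ => ?_) fun h => absurd ?_ h
    · exact .eliminateColumn hw (by omega) hmM (by simp [State.setVar_var, hv0])
        (by simp [State.setVar_var, hv2]) hbit hused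
    · simp [State.setVar_var, hv1]
  | succ l ih =>
    intro hl lo σ hlo hv0 hv1 hv2 hbit hused
    set h := 2 ^ l with hh
    have hh0 : 0 < h := by rw [hh]; positivity
    have hhh : 2 ^ (l + 1) = h + h := by rw [pow_succ]; omega
    rw [hhh] at hlo hv1 ⊢
    have hbh : 2 ^ (L - l) * h = m := by
      rw [hh, ← pow_add, hm]; congr 1; omega
    have hhw : (h + 2) ^ c ≤ 2 ^ w := (Nat.pow_le_pow_left (by omega) c).trans hmw
    set T := eliminateTime τ L l with hT
    set A := applyTime τ (2 ^ (L - l)) h with hA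
    refine Does.le (B := 110 + ((110 + ((T + 3 + 1) + (110 + (110 + ((A + 5 + 1) + ((T + 3 + 1) +
      (110 + (A + 5 + 1)))))))) + 1)) ?_ (by rw [eliminateTime, ← hh, ← hT, ← hA]; omega)
    refine .seq (.assign hw (by norm_num) (by norm_num) rfl (by simp; omega) ?_)
    refine .ite (by norm_num) (by norm_num) (fun hlt => absurd hlt ?_) fun _ => ?_
    · simp [State.setVar_var, hv1]; omega
    refine .seq (.assign (d := 20) (x := 4) hw (by norm_num) (by norm_num) rfl
      (by simp [State.setVar_var, hv1]; omega) ?_)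
    have hdiv : (h + h) / 2 = h := by omega
    set s₁ := (σ.setVar 3 2).setVar 4 h with hs₁
    have e₁ : (σ.setVar 3 (eval σ 2)).setVar 4 (eval (σ.setVar 3 (eval σ 2)) (var 1 / 2)) = s₁ := by
      simp [hs₁, State.setVar_var, hv1, hdiv]
    rw [e₁]
    have k0 : s₁.var 0 = lo := by simp [hs₁, State.setVar_var, hv0]
    have k2 : s₁.var 2 = m := by simp [hs₁, State.setVar_var, hv2]
    have k4 : s₁.var 4 = h := by simp [hs₁, State.setVar_var]
    refine .seq (.call (args := [0, 4, 2]) (by norm_num) (by simp) ?_)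
    rw [DoesProc, hP1]
    refine Does.mono (ih (by omega) lo _ (by omega) ?_ ?_ ?_ ?_ ?_) le_rfl fun s r₁ => ?_
    · simp [frame, k0]
    · simp [frame, k4]
    · simp [frame, k2]
    · exact hbit
    · exact hused
    refine .seq (.assign (d := 20) (x := 6) hw (by norm_num) (by norm_num) rfl
      (by simp [k0, k2]; omega) ?_)
    refine .seq (.assign (d := 20) (x := 7) hw (by norm_num) (by norm_num) rfl
      (by simp [State.setVar_var, k0, k4]; omega) ?_)
    simp only [eval_add, eval_var, State.setVar_var, Function.update_apply, k0, k2, k4,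
      Nat.reduceEqDiff, if_false, OfNat.zero_ne_ofNat]
    refine .seq (.call (args := [6, 0, 7, 4, 2]) (by norm_num) (by simp) ?_)
    rw [DoesProc, hP2]
    refine .applyBlock (m := m) (c := c) (u := m + lo) (p₀ := lo) (d := lo + h) (h := h)
      (b := 2 ^ (L - l)) hw hP hM hh0 hhw hbh (by positivity) hmM (by omega) (by omega)
      (by omega) ?_ ?_ ?_ ?_ ?_ ?_ ?_ ?_
    · simp [frame, State.setVar_var]
    · simp [frame, State.setVar_var, k0]
    · simp [frame, State.setVar_var]
    · simp [frame, State.setVar_var, k4]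
    · simp [frame, State.setVar_var, k2]
    · exact r₁.bits
    · exact fun p hp => r₁.piv_le _ (by omega) (by omega)
    intro s₂ f₂ b₂ e₂
    refine .seq (.call (args := [7, 4, 2]) (by norm_num) (by simp) ?_)
    rw [DoesProc, hP1]
    refine Does.mono (ih (by omega) (lo + h) _ (by omega) ?_ ?_ ?_ ?_ ?_) le_rfl fun s₃ r₃ => ?_
    · simp [frame, State.setVar_var]
    · simp [frame, State.setVar_var, k4]
    · simp [frame, State.setVar_var, k2]
    · exact b₂
    · intro i hi
      have : s₂.arr 8 = s.arr 8 := f₂ 8 (by norm_num) (by norm_num) (by norm_num)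
      show s₂.arr 8 (i + 1) ≤ 1
      rw [this]
      exact r₁.used_le i hi
    refine .seq (.assign (d := 20) (x := 8) hw (by norm_num) (by norm_num) rfl
      (by simp [State.setVar_var, k2]; omega) ?_)
    refine .call (args := [8, 7, 6, 4, 2]) (by norm_num) (by simp) ?_
    rw [DoesProc, hP2]
    refine .applyBlock (m := m) (c := c) (u := m + (lo + h)) (p₀ := lo + h) (d := m + lo) (h := h)
      (b := 2 ^ (L - l)) hw hP hM hh0 hhw hbh (by positivity) hmM (by omega) (by omega)
      (by omega) ?_ ?_ ?_ ?_ ?_ ?_ ?_ ?_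
    · simp [frame, State.setVar_var, k2]
    · simp [frame, State.setVar_var]
    · simp [frame, State.setVar_var]
    · simp [frame, State.setVar_var, k4]
    · simp [frame, State.setVar_var, k2]
    · exact r₃.bits
    · exact fun p hp => r₃.piv_le _ (by omega) (by omega)
    intro s₄ f₄ b₄ e₄
    exact Reduced.merge hlo r₁ f₂ e₂ r₃ f₄ b₄ e₄

end

/-! ### Earliest bases -/

/-- The columns `ι` are independent, and every column is a combination of those among them which do
not come after it. -/
structure IsGreedyBasis {m : Type*} {n r : ℕ} (A : Matrix m (Fin n) (ZMod 2))
    (ι : Fin r → Fin n) : Prop where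
  strictMono : StrictMono ι
  indep : LinearIndependent (ZMod 2) fun j => A.col (ι j)
  mem_span : ∀ j, A.col j ∈ Submodule.span (ZMod 2) ((fun i => A.col (ι i)) '' {i | ι i ≤ j})

/-- In a nontrivial relation, the term with the largest index is a combination of the preceding
ones. -/
theorem linearIndependent_of_notMem_span {K E : Type*} [Field K] [AddCommGroup E] [Module K E]
    {r : ℕ} {v : Fin r → E} (h : ∀ i, v i ∉ Submodule.span K (v '' {l | l < i})) :
    LinearIndependent K v := by
  classical
  rw [Fintype.linearIndependent_iff]
  intro g hg
  by_contra! hne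
  obtain ⟨i₀, hi₀⟩ := hne
  obtain ⟨i, hi, hmax⟩ := (Finset.univ.filter fun i => g i ≠ 0).exists_max_image id
    ⟨i₀, by simpa using hi₀⟩
  simp only [Finset.mem_filter, Finset.mem_univ, true_and, id] at hi hmax
  apply h i
  have hs : g i • v i = -∑ l ∈ Finset.univ.erase i, g l • v l := by
    rw [eq_neg_iff_add_eq_zero, ← hg]
    exact Finset.add_sum_erase _ (fun l => g l • v l) (Finset.mem_univ i)
  have : g i • v i ∈ Submodule.span K (v '' {l | l < i}) := by
    rw [hs]
    refine Submodule.neg_mem _ (Submodule.sum_mem _ fun l hl => ?_)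
    by_cases h0 : g l = 0
    · simp [h0]
    · exact Submodule.smul_mem _ _ (Submodule.subset_span
        ⟨l, lt_of_le_of_ne (hmax l h0) (Finset.ne_of_mem_erase hl), rfl⟩)
  exact (Submodule.smul_mem_iff _ hi).1 this

section
variable {m : Type*} {n r : ℕ} {A : Matrix m (Fin n) (ZMod 2)} {ι : Fin r → Fin n}

theorem IsGreedyBasis.span_eq (h : IsGreedyBasis A ι) :
    Submodule.span (ZMod 2) (Set.range fun j => A.col (ι j)) =
      Submodule.span (ZMod 2) (Set.range A.col) := by
  refine le_antisymm (Submodule.span_mono ?_) (Submodule.span_le.2 ?_)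
  · rintro _ ⟨j, rfl⟩; exact ⟨ι j, rfl⟩
  · rintro _ ⟨j, rfl⟩
    exact Submodule.span_mono (Set.image_subset_range _ _) (h.mem_span j)

theorem IsGreedyBasis.rank_eq (h : IsGreedyBasis A ι) : r = A.rank := by
  rw [Matrix.rank_eq_finrank_span_cols, ← h.span_eq, finrank_span_eq_card h.indep,
    Fintype.card_fin]

/-- Suppose an independent list is smaller and first differs at `i`. Its column there is spanned by
greedy columns with index at most `ι' i < ι i`, hence by those at positions before `i`, where both
lists agree. This contradicts independence. -/
theorem IsGreedyBasis.isEarliestBasis (h : IsGreedyBasis A ι) : IsEarliestBasis A ι := by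
  refine ⟨h.rank_eq, h.strictMono, h.indep, fun ι' hm hi => ?_⟩
  by_contra hlt
  rw [not_le] at hlt
  obtain ⟨i, h1, h2⟩ := hlt
  have h1' : ∀ j < i, ι' j = ι j := h1
  have h2' : ι' i < ι i := h2
  have hmem := h.mem_span (ι' i)
  refine hi.notMem_span_image (s := {l | l < i}) (x := i) (by simp) ?_
  refine Submodule.span_mono ?_ hmem
  rintro _ ⟨l, hl, rfl⟩
  have hli : l < i := h.strictMono.lt_iff_lt.1 (lt_of_le_of_lt hl h2')
  exact ⟨l, hli, by simp only [h1' l hli]⟩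

/-- Keep exactly the columns outside the span of their predecessors; induction on the index shows
that each discarded column is spanned by kept ones before it. -/
theorem exists_isGreedyBasis (A : Matrix m (Fin n) (ZMod 2)) :
    ∃ (r : ℕ) (ι : Fin r → Fin n), IsGreedyBasis A ι := by
  classical
  set S : Finset (Fin n) := Finset.univ.filter fun j =>
    A.col j ∉ Submodule.span (ZMod 2) (A.col '' {i | i < j}) with hS
  have hspan : ∀ j, A.col j ∈ Submodule.span (ZMod 2) (A.col '' {i | i ∈ S ∧ i ≤ j}) := by
    intro j
    induction j using WellFoundedLT.induction with
    | ind j ih =>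
      by_cases hj : j ∈ S
      · exact Submodule.subset_span ⟨j, ⟨hj, le_rfl⟩, rfl⟩
      · have hj' : A.col j ∈ Submodule.span (ZMod 2) (A.col '' {i | i < j}) := by
          simpa [hS] using hj
        refine Submodule.span_le.2 ?_ hj'
        rintro _ ⟨i, hi, rfl⟩
        refine Submodule.span_mono (Set.image_mono ?_) (ih i hi)
        exact fun l hl => ⟨hl.1, hl.2.trans (le_of_lt hi)⟩
  refine ⟨S.card, S.orderEmbOfFin rfl, (S.orderEmbOfFin rfl).strictMono,
    linearIndependent_of_notMem_span fun i hi => ?_, fun j => ?_⟩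
  · have := S.orderEmbOfFin_mem rfl i
    refine (Finset.mem_filter.1 this).2 (Submodule.span_mono ?_ hi)
    rintro _ ⟨l, hl, rfl⟩
    exact ⟨_, (S.orderEmbOfFin rfl).strictMono hl, rfl⟩
  · refine Submodule.span_mono ?_ (hspan j)
    rintro _ ⟨i, ⟨hi, hij⟩, rfl⟩
    have : i ∈ Set.range (S.orderEmbOfFin rfl) := by rw [Finset.range_orderEmbOfFin]; exact hi
    obtain ⟨l, rfl⟩ := this
    exact ⟨l, hij, rfl⟩

/-- The lexicographic minimum is unique, and some greedy basis attains it. -/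
theorem IsEarliestBasis.isGreedyBasis (h : IsEarliestBasis A ι) : IsGreedyBasis A ι := by
  obtain ⟨r', ι', h'⟩ := exists_isGreedyBasis A
  obtain rfl : r = r' := h.1.trans h'.rank_eq.symm
  obtain ⟨_, hm, hi, hle⟩ := h
  have e := h'.isEarliestBasis
  have : ι = ι' :=
    toLex.injective (le_antisymm (hle ι' h'.strictMono h'.indep) (e.2.2.2 ι hm hi))
  rw [this]; exact h'

end

/-! ### Greedy bases of a matrix with two blocks of columns -/

section
variable {m : Type*} {n₂ k r : ℕ} {A : Matrix m (Fin (n₂ + k)) (ZMod 2)} {ι : Fin r → Fin (n₂ + k)}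

/-- A column of the left block needs only basis columns that do not come after it, and those lie in
the left block too. -/
theorem IsGreedyBasis.span_left (h : IsGreedyBasis A ι) :
    Submodule.span (ZMod 2) ((fun i => A.col (ι i)) '' {i | (ι i : ℕ) < n₂}) =
      Submodule.span (ZMod 2) (Set.range (A.submatrix id (Fin.castAdd k)).col) := by
  refine le_antisymm (Submodule.span_mono ?_) (Submodule.span_le.2 ?_)
  · rintro _ ⟨i, hi, rfl⟩
    exact ⟨⟨ι i, hi⟩, rfl⟩
  · rintro _ ⟨j, rfl⟩
    refine Submodule.span_mono (Set.image_mono fun i hi => ?_) (h.mem_span (Fin.castAdd k j))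
    exact lt_of_le_of_lt (Fin.le_def.1 hi) (by simp)

theorem IsGreedyBasis.rank_left (h : IsGreedyBasis A ι) {b : ℕ} (hb : b ≤ r)
    (hι : ∀ i, (ι i : ℕ) < n₂ ↔ (i : ℕ) < b) :
    b = (A.submatrix id (Fin.castAdd k)).rank := by
  rw [Matrix.rank_eq_finrank_span_cols, ← h.span_left]
  have hset : (fun i => A.col (ι i)) '' {i | (ι i : ℕ) < n₂} =
      Set.range fun i : Fin b => A.col (ι (Fin.castLE hb i)) := by
    ext x
    constructor
    · rintro ⟨i, hi, rfl⟩
      exact ⟨⟨i, (hι i).1 hi⟩, rfl⟩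
    · rintro ⟨i, rfl⟩
      exact ⟨Fin.castLE hb i, (hι _).2 (by simp), rfl⟩
  have hi : LinearIndependent (ZMod 2) fun i : Fin b => A.col (ι (Fin.castLE hb i)) :=
    h.indep.comp _ (Fin.castLE_injective hb)
  rw [hset, finrank_span_eq_card hi, Fintype.card_fin]

/-- By monotonicity the positions that belong to the left block form an initial segment, and its
length is the dimension of the span of that block. -/
theorem IsGreedyBasis.lt_iff (h : IsGreedyBasis A ι) (i : Fin r) :
    (ι i : ℕ) < n₂ ↔ (i : ℕ) < (A.submatrix id (Fin.castAdd k)).rank := by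
  classical
  set S : Finset (Fin r) := Finset.univ.filter fun i => (ι i : ℕ) < n₂ with hS
  have hiff : ∀ i, (ι i : ℕ) < n₂ ↔ (i : ℕ) < S.card := by
    intro i
    constructor
    · intro hi
      have : Finset.Iic i ⊆ S := fun l hl => by
        rw [Finset.mem_Iic] at hl
        have := Fin.le_def.1 (h.strictMono.monotone hl)
        simp only [hS, Finset.mem_filter, Finset.mem_univ, true_and]; omega
      have := Finset.card_le_card this
      rw [Fin.card_Iic] at this; omega
    · intro hi
      by_contra hn
      have : S ⊆ Finset.Iio i := fun l hl => by
        simp only [hS, Finset.mem_filter, Finset.mem_univ, true_and] at hl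
        rw [Finset.mem_Iio]
        by_contra hle
        have := Fin.le_def.1 (h.strictMono.monotone (not_lt.1 hle))
        omega
      have := Finset.card_le_card this
      rw [Fin.card_Iio] at this; omega
  have hle : S.card ≤ r := (Finset.card_le_univ S).trans (by simp)
  rw [hiff, ← h.rank_left hle hiff]

end

/-! ### Cycles and spanning trees -/

section
variable {V : Type*} [DecidableEq V] {K : AbstractSimplicialComplex V}

theorem Simplex.exists_pair {V : Type*} [DecidableEq V] {K : AbstractSimplicialComplex V}
    (e : Simplex K 1) : ∃ u v, u ≠ v ∧ e.1 = {u, v} :=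
  Finset.card_eq_two.1 e.2.2

/-- The vertex `w` as a simplex. -/
def vertexSimplex (K : AbstractSimplicialComplex V) (w : V) : Simplex K 0 :=
  ⟨{w}, K.singleton_mem w, by simp⟩

theorem boundaryMatrix_apply {p : ℕ} (τ : Simplex K p) (σ : Simplex K (p + 1)) :
    boundaryMatrix K p τ σ = if τ.1 ⊆ σ.1 then 1 else 0 := by
  simp only [boundaryMatrix, Matrix.of_apply]
  congr

theorem mem_cycles_iff [Finite V] {z : Chain K 1} :
    z ∈ cycles K ↔ ∀ w : V, ∑ e : Simplex K 1, (if w ∈ e.1 then 1 else 0) * z e = 0 := by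
  have key : ∀ w, (boundaryMatrix K 0).mulVec z (vertexSimplex K w) =
      ∑ e : Simplex K 1, (if w ∈ e.1 then 1 else 0) * z e := fun w => by
    refine Finset.sum_congr rfl fun e _ => ?_
    show boundaryMatrix K 0 (vertexSimplex K w) e * z e = _
    rw [boundaryMatrix_apply]
    congr 1
    exact if_congr (by simp [vertexSimplex]) rfl rfl
  rw [cycles, LinearMap.mem_ker, Matrix.mulVecLin_apply, funext_iff]
  constructor
  · intro h w
    rw [← key]; exact h _
  · rintro h ⟨τ, hτ, hc⟩
    obtain ⟨w, rfl⟩ := Finset.card_eq_one.1 hc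
    exact (key w).trans (h w)

/-- Exchanging the sums moves the coboundary of `φ` to the boundary of `z`, which is zero. -/
theorem sum_coboundary_mul [Finite V] {z : Chain K 1} (hz : z ∈ cycles K) (φ : V → ZMod 2) :
    ∑ e : Simplex K 1, (∑ w ∈ e.1, φ w) * z e = 0 := by
  have := Fintype.ofFinite V
  rw [mem_cycles_iff] at hz
  calc ∑ e : Simplex K 1, (∑ w ∈ e.1, φ w) * z e
      = ∑ e : Simplex K 1, ∑ w : V, φ w * ((if w ∈ e.1 then 1 else 0) * z e) := by
        refine Finset.sum_congr rfl fun e _ => ?_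
        rw [Finset.sum_mul, ← Finset.sum_subset (Finset.subset_univ e.1)]
        · exact Finset.sum_congr rfl fun w hw => by simp [hw]
        · intro w _ hw; simp [hw]
    _ = ∑ w : V, φ w * ∑ e : Simplex K 1, (if w ∈ e.1 then 1 else 0) * z e := by
        rw [Finset.sum_comm]
        exact Finset.sum_congr rfl fun w _ => by rw [Finset.mul_sum]
    _ = 0 := by simp only [hz, mul_zero, Finset.sum_const_zero]

/-! ### Walks modulo 2 and potentials -/

/-- The number of passages of a walk through the edge `f`, modulo `2`. -/
def walkChain {T : SimpleGraph V} {u v : V} (p : T.Walk u v) : Chain K 1 :=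
  fun f => (p.edges.map fun d => if f.1 = d.toFinset then (1 : ZMod 2) else 0).sum

/-- A function on the vertices whose coboundary, restricted to `T`, is the indicator of `f`. -/
def IsPotential (T : SimpleGraph V) (f : Simplex K 1) (φ : V → ZMod 2) : Prop :=
  ∀ u v, T.Adj u v → φ u + φ v = if f.1 = {u, v} then 1 else 0

/-- The sum of the coboundary of `φ` along a walk telescopes; in particular the parity of the
passages depends only on the endpoints. -/
theorem IsPotential.walkChain_eq {T : SimpleGraph V} {f : Simplex K 1} {φ : V → ZMod 2}
    (h : IsPotential T f φ) {u v : V} (p : T.Walk u v) :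
    walkChain (K := K) p f = φ u + φ v := by
  induction p with
  | nil => simp [walkChain, CharTwo.add_self_eq_zero]
  | cons hadj p ih =>
    rename_i a b c
    have e : walkChain (K := K) (SimpleGraph.Walk.cons hadj p) f =
        (if f.1 = {a, b} then 1 else 0) + walkChain (K := K) p f := by
      simp [walkChain, Sym2.toFinset_mk_eq]
    rw [e, ih, ← h a b hadj]
    have : φ b + φ b = 0 := CharTwo.add_self_eq_zero _
    linear_combination this

theorem walkChain_boundary [Finite V] {T : SimpleGraph V} (hT : T ≤ oneSkeleton K) {u v : V}
    (p : T.Walk u v) (w : V) :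
    ∑ f : Simplex K 1, (if w ∈ f.1 then 1 else 0) * walkChain (K := K) p f =
      (if w = u then 1 else 0) + if w = v then 1 else 0 := by
  classical
  induction p with
  | nil => simp [walkChain, CharTwo.add_self_eq_zero]
  | cons hadj p ih =>
    rename_i a b c
    have e : ∀ f, walkChain (K := K) (SimpleGraph.Walk.cons hadj p) f =
        (if f.1 = {a, b} then 1 else 0) + walkChain (K := K) p f := fun f => by
      simp [walkChain, Sym2.toFinset_mk_eq]
    have hab := hT hadj
    let f₀ : Simplex K 1 := ⟨{a, b}, hab.2, Finset.card_pair hab.1⟩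
    have h0 : ∀ f : Simplex K 1, (if w ∈ f.1 then 1 else 0) * (if f.1 = {a, b} then 1 else 0) =
        if f = f₀ then (if w ∈ f₀.1 then (1 : ZMod 2) else 0) else 0 := fun f => by
      by_cases hf : f = f₀
      · have : f.1 = {a, b} := congrArg Subtype.val hf
        rw [if_pos this, if_pos hf, mul_one, hf]
      · have : f.1 ≠ {a, b} := fun h => hf (Subtype.ext h)
        simp [hf, this]
    simp only [e, mul_add, Finset.sum_add_distrib, ih, h0, Finset.sum_ite_eq', Finset.mem_univ,
      if_true]
    have h2 : (if w ∈ f₀.1 then (1 : ZMod 2) else 0) =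
        (if w = a then 1 else 0) + if w = b then 1 else 0 := by
      have hne : a ≠ b := hab.1
      by_cases h1 : w = a
      · subst h1; simp [f₀, hne]
      · simp [f₀, h1]
    rw [h2]
    have : (if w = b then (1 : ZMod 2) else 0) + (if w = b then (1 : ZMod 2) else 0) = 0 :=
      CharTwo.add_self_eq_zero _
    linear_combination this

-- A path repeats no edge, so counting modulo `2` loses nothing.
open Classical in
theorem walkChain_of_isPath {T : SimpleGraph V} {u v : V} {p : T.Walk u v} (hp : p.IsPath)
    (f : Simplex K 1) :
    walkChain (K := K) p f = if ∃ x y, s(x, y) ∈ p.edges ∧ f.1 = {x, y} then 1 else 0 := by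
  obtain ⟨x, y, hne, hf⟩ := f.exists_pair
  have hnd := hp.isTrail.edges_nodup
  have hiff : ∀ d : Sym2 V, f.1 = d.toFinset ↔ s(x, y) = d := by
    intro d
    induction d using Sym2.ind with
    | _ a b =>
      rw [hf, Sym2.toFinset_mk_eq]
      constructor
      · intro h
        have h1 := h; have h2 := h
        have hx : x ∈ ({a, b} : Finset V) := by rw [← h]; simp
        have hy : y ∈ ({a, b} : Finset V) := by rw [← h]; simp
        simp only [Finset.mem_insert, Finset.mem_singleton] at hx hy
        rw [Sym2.eq_iff]
        rcases hx with rfl | rfl <;> rcases hy with rfl | rfl <;> simp_all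
      · intro h
        rw [Sym2.eq_iff] at h
        rcases h with ⟨rfl, rfl⟩ | ⟨rfl, rfl⟩
        · rfl
        · exact Finset.pair_comm _ _
  have hex : (∃ x y, s(x, y) ∈ p.edges ∧ f.1 = {x, y}) ↔ s(x, y) ∈ p.edges := by
    constructor
    · rintro ⟨a, b, hm, he⟩
      rw [← Sym2.toFinset_mk_eq, hiff] at he
      rwa [he]
    · exact fun h => ⟨x, y, h, hf⟩
  simp only [hex, walkChain, hiff]
  generalize p.edges = l at hnd
  induction l with
  | nil => simp
  | cons d l ih =>
    rw [List.nodup_cons] at hnd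
    rw [List.map_cons, List.sum_cons, ih hnd.2]
    by_cases hd : s(x, y) = d
    · subst hd; simp [hnd.1]
    · simp [hd]

theorem pair_eq_pair {a b c d : V} (h : ({a, b} : Finset V) = {c, d}) :
    (a = c ∧ b = d) ∨ (a = d ∧ b = c) := by
  rw [← Sym2.toFinset_mk_eq, ← Sym2.toFinset_mk_eq] at h
  have ha : a ∈ s(c, d).toFinset := by rw [← h]; simp
  have hb : b ∈ s(c, d).toFinset := by rw [← h]; simp
  have hc : c ∈ s(a, b).toFinset := by rw [h]; simp
  have hd : d ∈ s(a, b).toFinset := by rw [h]; simp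
  simp only [Sym2.mem_toFinset, Sym2.mem_iff] at ha hb hc hd
  rcases ha with rfl | rfl <;> rcases hb with rfl | rfl <;> simp_all

theorem add_eq_of_pair_eq {a b c d : V} (φ : V → ZMod 2) (h : ({a, b} : Finset V) = {c, d}) :
    φ a + φ b = φ c + φ d := by
  rcases pair_eq_pair h with ⟨rfl, rfl⟩ | ⟨rfl, rfl⟩
  · rfl
  · exact add_comm _ _

/-- An edge of a forest is a bridge; take the indicator of the component of one endpoint after its
removal. If `f` is not an edge of `T`, take zero. -/
theorem exists_isPotential {T : SimpleGraph V} (hT : T.IsAcyclic) (f : Simplex K 1) :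
    ∃ φ : V → ZMod 2, IsPotential T f φ := by
  classical
  obtain ⟨x, y, -, hf⟩ := f.exists_pair
  by_cases hxy : T.Adj x y
  · have hb := SimpleGraph.isAcyclic_iff_forall_adj_isBridge.1 hT hxy
    rw [SimpleGraph.isBridge_iff] at hb
    have hx : (T.deleteEdges {s(x, y)}).Reachable x x := .refl x
    refine ⟨fun v => if (T.deleteEdges {s(x, y)}).Reachable x v then 1 else 0, fun u v huv => ?_⟩
    rw [hf]
    by_cases he : ({x, y} : Finset V) = {u, v}
    · rw [if_pos he]
      rcases pair_eq_pair he with ⟨rfl, rfl⟩ | ⟨rfl, rfl⟩ <;> simp [hb]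
    · have hadj : (T.deleteEdges {s(x, y)}).Adj u v := by
        rw [SimpleGraph.deleteEdges_adj]
        refine ⟨huv, fun h => he ?_⟩
        rw [← Sym2.toFinset_mk_eq, ← Sym2.toFinset_mk_eq, Set.mem_singleton_iff.1 h]
      have hiff : (T.deleteEdges {s(x, y)}).Reachable x u ↔
          (T.deleteEdges {s(x, y)}).Reachable x v :=
        ⟨fun h => h.trans hadj.reachable, fun h => h.trans hadj.symm.reachable⟩
      simp only [hiff, if_neg he, CharTwo.add_self_eq_zero]
  · refine ⟨0, fun u v huv => ?_⟩
    rw [if_neg]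
    · simp
    · rw [hf]; intro h
      rcases pair_eq_pair h with ⟨rfl, rfl⟩ | ⟨rfl, rfl⟩
      · exact hxy huv
      · exact hxy huv.symm

/-- A graph with a potential for each of its edges is acyclic. -/
theorem isAcyclic_of_isPotential {T : SimpleGraph V} (hT : T ≤ oneSkeleton K)
    (h : ∀ f : Simplex K 1, ∃ φ : V → ZMod 2, IsPotential T f φ) : T.IsAcyclic := by
  rw [SimpleGraph.isAcyclic_iff_forall_adj_isBridge]
  intro x y hxy
  rw [SimpleGraph.isBridge_iff]
  rintro ⟨p⟩
  obtain ⟨φ, hφ⟩ := h ⟨{x, y}, (hT hxy).2, Finset.card_pair (hT hxy).1⟩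
  -- A potential of the edge is constant along walks that avoid it but takes different values at its
  -- endpoints, so no such walk can join them.
  have hconst : ∀ {u v : V} (p : (T.deleteEdges {s(x, y)}).Walk u v), φ u = φ v := by
    intro u v p
    induction p with
    | nil => rfl
    | cons hadj p ih =>
      rename_i a b c
      rw [SimpleGraph.deleteEdges_adj] at hadj
      have := hφ a b hadj.1
      rw [if_neg] at this
      · rw [← ih]; exact CharTwo.add_eq_zero.1 this
      · intro he
        refine hadj.2 (Set.mem_singleton_iff.2 ?_)
        rcases pair_eq_pair he with ⟨rfl, rfl⟩ | ⟨rfl, rfl⟩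
        · rfl
        · exact Sym2.eq_swap
  have h1 := hφ x y hxy
  rw [hconst p, CharTwo.add_self_eq_zero] at h1
  simp at h1

open Classical in
/-- The sentinel cycle in terms of potentials. -/
theorem sentinelCycle_eq {T : SimpleGraph V} (hT : T.IsTree) {e f : Simplex K 1} {u v : V}
    (he : e.1 = {u, v}) {φ : V → ZMod 2} (hφ : IsPotential T f φ) :
    sentinelCycle T e f = (φ u + φ v) + if f = e then 1 else 0 := by
  unfold sentinelCycle
  congr 1
  by_cases h : OnTreePath T e f
  · rw [if_pos h]
    obtain ⟨u', v', p, he', hp, hxy⟩ := h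
    rw [add_eq_of_pair_eq φ (he.symm.trans he'), ← hφ.walkChain_eq p, walkChain_of_isPath hp,
      if_pos hxy]
  · rw [if_neg h]
    obtain ⟨p, hp, -⟩ := hT.existsUnique_path u v
    rw [← hφ.walkChain_eq p, walkChain_of_isPath hp, if_neg]
    exact fun hxy => h ⟨u, v, p, he, hp, hxy⟩

-- By the telescoping property any walk in the tree may replace the simple path, which makes the
-- boundary of a sentinel cycle easy to compute.
open Classical in
theorem sentinelCycle_eq_walkChain {T : SimpleGraph V} (hT : T.IsTree) {e : Simplex K 1} {u v : V}
    (he : e.1 = {u, v}) (p : T.Walk u v) :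
    sentinelCycle T e = fun f => walkChain p f + if f = e then 1 else 0 := by
  funext f
  obtain ⟨φ, hφ⟩ := exists_isPotential hT.isAcyclic f
  rw [sentinelCycle_eq hT he hφ, hφ.walkChain_eq p]

theorem sentinelCycle_mem_cycles [Finite V] {T : SimpleGraph V} (hT : IsSpanningTree K T)
    (e : Simplex K 1) : sentinelCycle T e ∈ cycles K := by
  classical
  obtain ⟨u, v, huv, he⟩ := e.exists_pair
  obtain ⟨p⟩ := hT.2.connected.preconnected u v
  rw [mem_cycles_iff]
  intro w
  rw [sentinelCycle_eq_walkChain hT.2 he p]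
  simp only [mul_add, Finset.sum_add_distrib, walkChain_boundary hT.1]
  have h1 : ∑ f : Simplex K 1, (if w ∈ f.1 then (1 : ZMod 2) else 0) * (if f = e then 1 else 0) =
      if w ∈ e.1 then 1 else 0 := by
    rw [Finset.sum_eq_single e]
    · simp
    · intro f _ hf; simp [hf]
    · simp
  rw [h1, he]
  by_cases h1 : w = u
  · subst h1; simp [huv, CharTwo.add_self_eq_zero]
  · by_cases h2 : w = v
    · subst h2; simp [h1, CharTwo.add_self_eq_zero]
    · simp [h1, h2]

open Classical in
/-- Off the tree, a sentinel cycle is the indicator of its sentinel edge. -/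
theorem sentinelCycle_apply_of_not_inTree {T : SimpleGraph V} (hT : T.IsTree) {e f : Simplex K 1}
    (hf : ¬ InTree T f) : sentinelCycle T e f = if f = e then 1 else 0 := by
  obtain ⟨u, v, -, he⟩ := e.exists_pair
  have hφ : IsPotential T f 0 := fun a b hab => by
    rw [if_neg]
    · simp
    · exact fun h => hf ⟨a, b, hab, h⟩
  rw [sentinelCycle_eq hT he hφ]; simp

/-- Pair `z` with the coboundary of a potential of `f`. On tree edges this coboundary is the
indicator of `f`, and off the tree `z` is zero, so only `z f` remains. -/
theorem eq_zero_of_mem_cycles [Finite V] {T : SimpleGraph V} (hT : IsSpanningTree K T)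
    {z : Chain K 1} (hz : z ∈ cycles K) (h0 : ∀ e, ¬ InTree T e → z e = 0) : z = 0 := by
  classical
  funext f
  obtain ⟨φ, hφ⟩ := exists_isPotential hT.2.isAcyclic f
  have h := sum_coboundary_mul hz φ
  rw [Finset.sum_eq_single f] at h
  · by_cases hf : InTree T f
    · obtain ⟨u, v, huv, he⟩ := hf
      rw [he, Finset.sum_pair huv.ne, hφ u v huv, if_pos he, one_mul] at h
      exact h
    · exact h0 f hf
  · intro e _ hef
    by_cases he : InTree T e
    · obtain ⟨u, v, huv, he⟩ := he
      rw [he, Finset.sum_pair huv.ne, hφ u v huv, if_neg, zero_mul]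
      rw [← he]; exact fun h => hef (Subtype.ext h.symm)
    · rw [h0 e he, mul_zero]
  · simp

/-- The sentinel cycles span the cycle space, with the values on the sentinel edges as
coefficients. -/
theorem eq_sum_sentinelCycle [Finite V] {T : SimpleGraph V} (hT : IsSpanningTree K T) {k : ℕ}
    {s : Fin k → Simplex K 1} (hs : Function.Injective s) (hr : Set.range s = {e | ¬ InTree T e})
    {z : Chain K 1} (hz : z ∈ cycles K) : z = ∑ i, z (s i) • sentinelCycle T (s i) := by
  classical
  rw [← sub_eq_zero]
  refine eq_zero_of_mem_cycles hT (Submodule.sub_mem _ hz (Submodule.sum_mem _ fun i _ =>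
    Submodule.smul_mem _ _ (sentinelCycle_mem_cycles hT _))) fun e he => ?_
  have : e ∈ Set.range s := by rw [hr]; exact he
  obtain ⟨j, rfl⟩ := this
  rw [Pi.sub_apply, Finset.sum_apply, Finset.sum_eq_single j]
  · simp [sentinelCycle_apply_of_not_inTree hT.2 he]
  · intro i _ hij
    have : s j ≠ s i := fun h => hij (hs h).symm
    simp [sentinelCycle_apply_of_not_inTree hT.2 he, this]
  · simp

/-- Each vertex of a triangle lies on exactly two of its edges, and all other vertices lie on none.
-/
theorem boundary_mem_cycles [Finite V] (t : Simplex K 2) :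
    (boundaryMatrix K 1).col t ∈ cycles K := by
  classical
  rw [mem_cycles_iff]
  intro w
  by_cases hw : w ∈ t.1
  · obtain ⟨x, y, hxy, hx⟩ := Finset.card_eq_two.1
      (show (t.1.erase w).card = 2 by rw [Finset.card_erase_of_mem hw, t.2.2])
    have hxt : x ∈ t.1.erase w := by rw [hx]; simp
    have hyt : y ∈ t.1.erase w := by rw [hx]; simp
    rw [Finset.mem_erase] at hxt hyt
    have ht : ∀ a, a ∈ t.1 ↔ a = w ∨ a = x ∨ a = y := fun a => by
      rw [← Finset.insert_erase hw, hx]; simp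
    have hface : ∀ a ∈ t.1, ({w, a} : Finset V) ∈ K.faces := fun a ha =>
      (K.isRelLowerSet_faces t.2.1).2 (Finset.insert_subset hw (by simpa using ha)) (by simp)
    let e₁ : Simplex K 1 := ⟨{w, x}, hface x hxt.2, Finset.card_pair hxt.1.symm⟩
    let e₂ : Simplex K 1 := ⟨{w, y}, hface y hyt.2, Finset.card_pair hyt.1.symm⟩
    have hne : e₁ ≠ e₂ := fun h => by
      have h' : ({w, x} : Finset V) = {w, y} := congrArg Subtype.val h
      rcases pair_eq_pair h' with ⟨-, h⟩ | ⟨h, h'⟩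
      · exact hxy h
      · exact hyt.1 h.symm
    have hiff : ∀ e : Simplex K 1, (w ∈ e.1 ∧ e.1 ⊆ t.1) ↔ e = e₁ ∨ e = e₂ := by
      intro e
      constructor
      · rintro ⟨h1, h2⟩
        obtain ⟨a, ha⟩ := Finset.card_eq_one.1
          (show (e.1.erase w).card = 1 by rw [Finset.card_erase_of_mem h1, e.2.2])
        have hea : e.1 = {w, a} := by rw [← Finset.insert_erase h1, ha]
        have hae : a ∈ e.1.erase w := by rw [ha]; simp
        rw [Finset.mem_erase] at hae
        rcases (ht a).1 (h2 hae.2) with rfl | rfl | rfl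
        · exact absurd rfl hae.1
        · exact Or.inl (Subtype.ext hea)
        · exact Or.inr (Subtype.ext hea)
      · rintro (rfl | rfl)
        · exact ⟨by simp [e₁], by simp [e₁, Finset.insert_subset_iff, hw, hxt.2]⟩
        · exact ⟨by simp [e₂], by simp [e₂, Finset.insert_subset_iff, hw, hyt.2]⟩
    have : ∀ e : Simplex K 1, (if w ∈ e.1 then (1 : ZMod 2) else 0) *
        (boundaryMatrix K 1).col t e = (if e = e₁ then 1 else 0) + if e = e₂ then 1 else 0 := by
      intro e
      rw [Matrix.col_apply, boundaryMatrix_apply]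
      by_cases h1 : e = e₁
      · obtain ⟨g1, g2⟩ := (hiff e).2 (Or.inl h1)
        rw [if_pos g1, if_pos g2, if_pos h1, if_neg (h1 ▸ hne)]; simp
      · by_cases h2 : e = e₂
        · obtain ⟨g1, g2⟩ := (hiff e).2 (Or.inr h2)
          rw [if_pos g1, if_pos g2, if_neg h1, if_pos h2]; simp
        · have := mt (hiff e).1 (by tauto)
          rw [if_neg h1, if_neg h2]
          by_cases g1 : w ∈ e.1
          · rw [if_neg fun h => this ⟨g1, h⟩]; simp
          · rw [if_neg g1]; simp
    rw [Finset.sum_congr rfl fun e _ => this e, Finset.sum_add_distrib]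
    simp [CharTwo.add_self_eq_zero]
  · refine Finset.sum_eq_zero fun e _ => ?_
    rw [Matrix.col_apply, boundaryMatrix_apply]
    by_cases h1 : w ∈ e.1
    · rw [if_neg (c := e.1 ⊆ t.1) fun h => hw (h h1), mul_zero]
    · rw [if_neg h1, zero_mul]

end

/-! ### Correctness of the three steps -/

theorem annotationSum_eq {V : Type*} [Finite V] {K : AbstractSimplicialComplex V} {g : ℕ}
    (a : Simplex K 1 → Fin g → ZMod 2) (z : Chain K 1) :
    annotationSum a z = ∑ e, z e • a e := by
  rw [annotationSum, Finset.sum_filter]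
  refine Finset.sum_congr rfl fun e _ => ?_
  have : ∀ c : ZMod 2, c = 0 ∨ c = 1 := by decide
  rcases this (z e) with h | h <;> simp [h]

section
variable {V : Type*} [DecidableEq V] {K : AbstractSimplicialComplex V}
  {n₂ k b g : ℕ} {tri : Fin n₂ ≃ Simplex K 2} {T : SimpleGraph V} {s : Fin k → Simplex K 1}

theorem cycleMatrix_col_castAdd (i : Fin n₂) :
    (cycleMatrix tri T s).col (Fin.castAdd k i) = (boundaryMatrix K 1).col (tri i) := by
  funext e; simp [cycleMatrix]

theorem cycleMatrix_col_natAdd (i : Fin k) :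
    (cycleMatrix tri T s).col (Fin.natAdd n₂ i) = sentinelCycle T (s i) := by
  funext e; simp [cycleMatrix]

theorem cycleMatrix_left :
    (cycleMatrix tri T s).submatrix id (Fin.castAdd k) =
      (boundaryMatrix K 1).submatrix (Equiv.refl _) tri := by
  ext e i; simp [cycleMatrix]

variable [Finite V]

theorem cycleMatrix_col_mem_cycles (hT : IsSpanningTree K T) (j : Fin (n₂ + k)) :
    (cycleMatrix tri T s).col j ∈ cycles K := by
  induction j using Fin.addCases with
  | left i => rw [cycleMatrix_col_castAdd]; exact boundary_mem_cycles _
  | right i => rw [cycleMatrix_col_natAdd]; exact sentinelCycle_mem_cycles hT _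

theorem span_cycleMatrix (hT : IsSpanningTree K T) (hs : Function.Injective s)
    (hr : Set.range s = {e | ¬ InTree T e}) :
    Submodule.span (ZMod 2) (Set.range (cycleMatrix tri T s).col) = cycles K := by
  refine le_antisymm (Submodule.span_le.2 ?_) fun z hz => ?_
  · rintro _ ⟨j, rfl⟩
    exact cycleMatrix_col_mem_cycles hT j
  · rw [eq_sum_sentinelCycle hT hs hr hz]
    refine Submodule.sum_mem _ fun i _ => Submodule.smul_mem _ _ (Submodule.subset_span ?_)
    exact ⟨_, cycleMatrix_col_natAdd i⟩

theorem rank_cycleMatrix_left :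
    ((cycleMatrix tri T s).submatrix id (Fin.castAdd k)).rank = (boundaryMatrix K 1).rank := by
  rw [cycleMatrix_left, Matrix.rank_submatrix]

theorem span_cycleMatrix_left :
    Submodule.span (ZMod 2) (Set.range ((cycleMatrix tri T s).submatrix id (Fin.castAdd k)).col) =
      boundaries K := by
  rw [boundaries, Matrix.range_mulVecLin]
  congr 1
  ext x
  constructor
  · rintro ⟨i, rfl⟩
    exact ⟨tri i, (cycleMatrix_col_castAdd i).symm⟩
  · rintro ⟨t, rfl⟩
    refine ⟨tri.symm t, (cycleMatrix_col_castAdd (tri.symm t)).trans ?_⟩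
    rw [Equiv.apply_symm_apply]

/-- The linear systems are solvable because a greedy basis spans all columns of `[∂₂ | Z]`, hence
all cycles. The number `g` is what remains of the total rank after `rank ∂₂`. -/
theorem exists_isThreeStepResult (hT : IsSpanningTree K T) (hs : Function.Injective s)
    (hr : Set.range s = {e | ¬ InTree T e}) :
    ∃ (b g : ℕ) (ι : Fin (b + g) → Fin (n₂ + k)) (a : Simplex K 1 → Fin g → ZMod 2),
      IsThreeStepResult K tri T s ι a := by
  classical
  obtain ⟨r, ι, hι⟩ := exists_isGreedyBasis (cycleMatrix tri T s)
  have hle : (boundaryMatrix K 1).rank ≤ r := by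
    rw [hι.rank_eq, ← rank_cycleMatrix_left (T := T) (s := s) (tri := tri)]
    rw [Matrix.rank_eq_finrank_span_cols, Matrix.rank_eq_finrank_span_cols]
    refine Submodule.finrank_mono (Submodule.span_mono ?_)
    rintro _ ⟨i, rfl⟩
    exact ⟨_, rfl⟩
  obtain ⟨g, rfl⟩ := Nat.exists_eq_add_of_le hle
  have hx : ∀ i, ∃ x : Fin ((boundaryMatrix K 1).rank + g) → ZMod 2,
      ((cycleMatrix tri T s).submatrix id ι).mulVec x = sentinelCycle T (s i) := by
    intro i
    have : sentinelCycle T (s i) ∈ Submodule.span (ZMod 2)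
        (Set.range fun j => (cycleMatrix tri T s).col (ι j)) := by
      rw [hι.span_eq, span_cycleMatrix hT hs hr]
      exact sentinelCycle_mem_cycles hT _
    obtain ⟨x, hx⟩ := (Submodule.mem_span_range_iff_exists_fun _).1 this
    refine ⟨x, ?_⟩
    rw [← hx]
    funext e
    simp [Matrix.mulVec, dotProduct, mul_comm]
  choose x hx using hx
  refine ⟨_, g, ι, fun e => if h : ∃ i, s i = e then fun j => x h.choose (Fin.natAdd _ j) else 0,
    hT, hs, hr, rfl, hι.isEarliestBasis, fun i => ⟨x i, hx i, ?_⟩, fun e he => ?_⟩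
  · have h : ∃ i', s i' = s i := ⟨i, rfl⟩
    rw [dif_pos h, hs h.choose_spec]
  · rw [dif_neg]
    rintro ⟨i, rfl⟩
    have : s i ∈ Set.range s := ⟨i, rfl⟩
    rw [hr] at this
    exact this he

/-- The columns `[B | H]` form a basis of the cycle space whose first `b` members span the
boundaries. Reading the other coordinates therefore identifies the quotient with vectors of length
`g`, the classes of `H` becoming the unit vectors. -/
theorem IsThreeStepResult.isAnnotation {ι : Fin (b + g) → Fin (n₂ + k)}
    {a : Simplex K 1 → Fin g → ZMod 2} (h : IsThreeStepResult K tri T s ι a) :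
    IsAnnotation K a ∧ ∃ (hH : ∀ j, basisCycle tri T s ι j ∈ cycles K)
      (H : Module.Basis (Fin g) (ZMod 2) (H1 K)),
      (∀ j, H j = homologyClass K ⟨basisCycle tri T s ι j, hH j⟩) ∧
      ∀ z : cycles K, annotationSum a z.1 = H.equivFun (homologyClass K z) := by
  classical
  have hgr := h.earliest.isGreedyBasis
  have hT := h.tree
  have hr := h.sentinel_range
  have hs := h.sentinel_injective
  set A := cycleMatrix tri T s with hA
  let v : Fin (b + g) → cycles K := fun i => ⟨A.col (ι i), cycleMatrix_col_mem_cycles hT _⟩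
  have hv : LinearIndependent (ZMod 2) v := by
    rw [← LinearMap.linearIndependent_iff (cycles K).subtype (Submodule.ker_subtype _)]
    exact hgr.indep
  have hsp : ⊤ ≤ Submodule.span (ZMod 2) (Set.range v) := by
    rintro z -
    have hz : z.1 ∈ Submodule.span (ZMod 2) (Set.range fun j => A.col (ι j)) := by
      rw [hgr.span_eq, hA, span_cycleMatrix hT hs hr]; exact z.2
    obtain ⟨x, hx⟩ := (Submodule.mem_span_range_iff_exists_fun _).1 hz
    refine (Submodule.mem_span_range_iff_exists_fun _).2 ⟨x, Subtype.ext ?_⟩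
    rw [← hx]; simp [v]
  let bas : Module.Basis (Fin (b + g)) (ZMod 2) (cycles K) := Module.Basis.mk hv hsp
  have hbas : ∀ i, bas i = v i := fun i => Module.Basis.mk_apply hv hsp i
  let Φ : cycles K →ₗ[ZMod 2] (Fin g → ZMod 2) :=
    LinearMap.pi fun j => bas.coord (Fin.natAdd b j)
  have hΦ : ∀ z j, Φ z j = bas.repr z (Fin.natAdd b j) := fun z j => rfl
  have hΦr : ∀ j, Φ (v (Fin.natAdd b j)) = Pi.single j 1 := fun j => by
    funext j'
    rw [hΦ, ← hbas, Module.Basis.repr_self, Finsupp.single_apply, Pi.single_apply]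
    exact if_congr ⟨fun h => (Fin.natAdd_injective _ _ h).symm, fun h => by rw [h]⟩ rfl rfl
  have hΦl : ∀ i, Φ (v (Fin.castAdd g i)) = 0 := fun i => by
    funext j'
    rw [hΦ, ← hbas, Module.Basis.repr_self, Finsupp.single_apply, if_neg]
    · rfl
    · intro h; have := congrArg Fin.val h; simp at this; omega
  -- The split of the basis by position, into `B` and `H`, coincides with the split by origin, into
  -- triangles and sentinel cycles.
  have hlt : ∀ i, (ι i : ℕ) < n₂ ↔ (i : ℕ) < b := fun i => by
    rw [hgr.lt_iff, rank_cycleMatrix_left, ← h.rank_boundary]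
  have hB : Submodule.span (ZMod 2) (Set.range fun i : Fin b => A.col (ι (Fin.castAdd g i))) =
      boundaries K := by
    rw [← span_cycleMatrix_left (tri := tri) (T := T) (s := s), ← hA, ← hgr.span_left]
    congr 1
    ext x
    constructor
    · rintro ⟨i, rfl⟩
      exact ⟨_, (hlt _).2 (by simp), rfl⟩
    · rintro ⟨i, hi, rfl⟩
      exact ⟨⟨i, (hlt i).1 hi⟩, rfl⟩
  have hker : (boundaries K).submoduleOf (cycles K) = LinearMap.ker Φ := by
    ext z
    rw [LinearMap.mem_ker]
    change z.1 ∈ boundaries K ↔ _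
    rw [← hB]
    constructor
    · intro hz
      obtain ⟨x, hx⟩ := (Submodule.mem_span_range_iff_exists_fun _).1 hz
      have : z = ∑ i, x i • v (Fin.castAdd g i) := Subtype.ext (by rw [← hx]; simp [v])
      rw [this, map_sum]
      exact Finset.sum_eq_zero fun i _ => by rw [map_smul, hΦl, smul_zero]
    · intro hz
      have h1 := bas.sum_repr z
      rw [Fin.sum_univ_add] at h1
      have h2 : ∑ j : Fin g, bas.repr z (Fin.natAdd b j) • bas (Fin.natAdd b j) = 0 :=
        Finset.sum_eq_zero fun j _ => by rw [← hΦ, hz]; simp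
      rw [h2, add_zero] at h1
      refine (Submodule.mem_span_range_iff_exists_fun _).2
        ⟨fun i => bas.repr z (Fin.castAdd g i), ?_⟩
      conv_rhs => rw [← h1]
      simp [hbas, v]
  have hsurj : Function.Surjective Φ := by
    intro y
    refine ⟨∑ j, y j • v (Fin.natAdd b j), ?_⟩
    rw [map_sum]
    simp only [map_smul, hΦr]
    funext j; simp [Finset.sum_apply, Pi.single_apply]
  let E : H1 K ≃ₗ[ZMod 2] (Fin g → ZMod 2) :=
    (Submodule.quotEquivOfEq _ _ hker).trans (LinearMap.quotKerEquivOfSurjective Φ hsurj)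
  have hE : ∀ z, E (homologyClass K z) = Φ z := fun z => rfl
  let H : Module.Basis (Fin g) (ZMod 2) (H1 K) := Module.Basis.ofEquivFun E
  have hHE : ∀ x, H.equivFun x = E x := fun x => by
    rw [Module.Basis.equivFun_ofEquivFun]
  have hγ : ∀ i, Φ ⟨sentinelCycle T (s i), sentinelCycle_mem_cycles hT _⟩ = a (s i) := by
    intro i
    obtain ⟨x, hx, ha⟩ := h.solve i
    have : (⟨sentinelCycle T (s i), sentinelCycle_mem_cycles hT _⟩ : cycles K) =
        ∑ j, x j • bas j := Subtype.ext (by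
      refine hx.symm.trans ?_
      funext e
      simp [hbas, v, Matrix.mulVec, dotProduct, mul_comm, hA])
    rw [ha]
    funext j
    rw [hΦ, this, Module.Basis.repr_sum_self]
  have hann : ∀ z : cycles K, annotationSum a z.1 = Φ z := by
    intro z
    have hz := eq_sum_sentinelCycle hT hs hr z.2
    have hz' : z = ∑ i, z.1 (s i) •
        (⟨sentinelCycle T (s i), sentinelCycle_mem_cycles hT _⟩ : cycles K) :=
      Subtype.ext (by conv_lhs => rw [hz]
                      simp)
    conv_rhs => rw [hz', map_sum]
    simp only [map_smul, hγ]
    rw [annotationSum_eq]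
    symm
    -- The sum over all edges reduces to the sentinel edges because tree edges are annotated by
    -- zero.
    refine Finset.sum_of_injOn s hs.injOn (fun _ _ => Finset.mem_coe.2 (Finset.mem_univ _))
      (fun e _ he => ?_) fun _ _ => rfl
    have : InTree T e := by
      by_contra hn
      have : e ∈ Set.range s := by rw [hr]; exact hn
      obtain ⟨i, rfl⟩ := this
      exact he ⟨i, by simp, rfl⟩
    rw [h.tree_zero e this, smul_zero]
  refine ⟨⟨by rw [Module.finrank_eq_card_basis H, Fintype.card_fin], fun z z' => ?_⟩,
    fun j => cycleMatrix_col_mem_cycles hT _, H, fun j => ?_, fun z => ?_⟩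
  · rw [hann, hann, ← hE, ← hE]
    exact E.injective.eq_iff.symm
  · apply E.injective
    rw [hE]
    refine Eq.trans ?_ (hΦr j).symm
    funext j'
    rw [← hHE, Module.Basis.equivFun_self, Pi.single_apply]
    exact if_congr eq_comm rfl rfl
  · rw [hHE, hE, hann]

end

/-! ### Growing a spanning tree -/

section
variable {V : Type*} [DecidableEq V] {K : AbstractSimplicialComplex V}

/-- `ν` is the numbering of the vertices, and `E` lists the endpoints of the edges. -/
structure EdgeList (N : Numbering K) (ν : ℕ → V) (E : ℕ → ℕ) : Prop where
  vert : ∀ i : Fin N.n₀, ν i = N.vert i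
  left_lt : ∀ e < N.n₁, E (2 * e) < N.n₀
  right_lt : ∀ e < N.n₁, E (2 * e + 1) < N.n₀
  edge : ∀ e : Fin N.n₁, (N.edge e).1 = {ν (E (2 * e)), ν (E (2 * e + 1))}

/-- The graph of the edges that are marked in `B`. -/
def markedGraph (N : Numbering K) (B : ℕ → ℕ) : SimpleGraph V where
  Adj u v := ∃ e : Fin N.n₁, B e = 1 ∧ (N.edge e).1 = {u, v}
  symm := ⟨fun u v ⟨e, h, h'⟩ => ⟨e, h, by rw [Finset.pair_comm]; exact h'⟩⟩
  loopless := ⟨fun u ⟨e, _, h⟩ => by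
    have := (N.edge e).2.2
    rw [h] at this
    simp at this⟩

theorem markedGraph_le (N : Numbering K) (B : ℕ → ℕ) : markedGraph N B ≤ oneSkeleton K := by
  intro u v h
  refine ⟨h.ne, ?_⟩
  obtain ⟨e, -, he⟩ := h
  rw [← he]
  exact (N.edge e).2.1

theorem markedGraph_mono {N : Numbering K} {B B' : ℕ → ℕ} (h : ∀ e, B e = 1 → B' e = 1) :
    markedGraph N B ≤ markedGraph N B' :=
  fun _ _ ⟨e, he, he'⟩ => ⟨e, h _ he, he'⟩

theorem inTree_markedGraph {N : Numbering K} {B : ℕ → ℕ} (e : Fin N.n₁) :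
    InTree (markedGraph N B) (N.edge e) ↔ B e = 1 := by
  constructor
  · rintro ⟨u, v, ⟨e', h, he'⟩, he⟩
    have : e' = e := N.edge.injective (Subtype.ext (he'.trans he.symm))
    rwa [← this]
  · intro h
    obtain ⟨u, v, -, he⟩ := (N.edge e).exists_pair
    exact ⟨u, v, ⟨e, h, he⟩, he⟩

/-- A stage in the growth of a tree with `q` edges: `R` marks the vertices that have been reached,
`B` marks the edges of the tree, and row `i` of `D` marks the edges on the path from the root to
the vertex `i`. -/
structure PartialTree (N : Numbering K) (ν : ℕ → V) (E R D B : ℕ → ℕ) (q : ℕ) : Prop where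
  reach_le : ∀ i < N.n₀, R i ≤ 1
  root : R 0 = 1
  card : ((Finset.range N.n₀).filter fun i => R i = 1).card = q + 1
  mark_le : ∀ e < N.n₁, B e ≤ 1
  path_le : ∀ i < N.n₀, R i = 1 → ∀ f < N.n₁, D (i * N.n₁ + f) ≤ 1
  ends : ∀ e < N.n₁, B e = 1 → R (E (2 * e)) = 1 ∧ R (E (2 * e + 1)) = 1
  path : ∀ e < N.n₁, B e = 1 → ∀ f < N.n₁, (D (E (2 * e) * N.n₁ + f) : ZMod 2) +
    D (E (2 * e + 1) * N.n₁ + f) = if f = e then 1 else 0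
  reachable : ∀ i < N.n₀, R i = 1 → (markedGraph N B).Reachable (ν 0) (ν i)

variable {N : Numbering K} {ν : ℕ → V} {E R D B : ℕ → ℕ} {q : ℕ}

theorem EdgeList.inj (hE : EdgeList N ν E) {i j : ℕ} (hi : i < N.n₀) (hj : j < N.n₀)
    (h : ν i = ν j) : i = j := by
  have h1 := hE.vert ⟨i, hi⟩
  have h2 := hE.vert ⟨j, hj⟩
  simp only at h1 h2
  rw [h1, h2] at h
  simpa using N.vert.injective h

theorem EdgeList.surj (hE : EdgeList N ν E) (v : V) : ∃ i < N.n₀, ν i = v :=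
  ⟨N.vert.symm v, (N.vert.symm v).2, by rw [hE.vert, Equiv.apply_symm_apply]⟩

theorem EdgeList.symm_vert (hE : EdgeList N ν E) {i : ℕ} (hi : i < N.n₀) :
    (N.vert.symm (ν i) : ℕ) = i := by
  have h1 := hE.vert ⟨i, hi⟩
  simp only at h1
  rw [h1, Equiv.symm_apply_apply]

theorem PartialTree.init (hn : 0 < N.n₀) (hR : ∀ i < N.n₀, R i = if i = 0 then 1 else 0)
    (hB : ∀ e < N.n₁, B e = 0) (hD : ∀ f < N.n₁, D f = 0) : PartialTree N ν E R D B 0 := by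
  have h1 : ∀ i < N.n₀, R i = 1 → i = 0 := fun i hi h => by
    rw [hR i hi] at h
    by_contra hne
    simp [hne] at h
  refine ⟨fun i hi => ?_, by simp [hR 0 hn], ?_, fun e he => by simp [hB e he], ?_, ?_, ?_, ?_⟩
  · rw [hR i hi]; split_ifs <;> simp
  · rw [Finset.card_eq_one]
    refine ⟨0, Finset.ext fun i => ?_⟩
    rw [Finset.mem_filter, Finset.mem_range, Finset.mem_singleton]
    exact ⟨fun h => h1 i h.1 h.2, fun h => by rw [h]; exact ⟨hn, by simp [hR 0 hn]⟩⟩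
  · intro i hi h f hf
    rw [h1 i hi h, zero_mul, zero_add, hD f hf]; simp
  · intro e he h; simp [hB e he] at h
  · intro e he h; simp [hB e he] at h
  · intro i hi h; rw [h1 i hi h]

/-- The path to the new vertex `y` is the path to `x` plus the new edge, so the two rows differ
exactly there. The rows of reached vertices do not change, hence the relations at the old tree edges
persist; rows of unreached vertices are unconstrained, as their memory may be uninitialized. -/
theorem PartialTree.step (hE : EdgeList N ν E) (h : PartialTree N ν E R D B q) {D' : ℕ → ℕ}
    {e₀ x y : ℕ} (he₀ : e₀ < N.n₁)
    (hxy : (x = E (2 * e₀) ∧ y = E (2 * e₀ + 1)) ∨ (x = E (2 * e₀ + 1) ∧ y = E (2 * e₀)))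
    (hx : R x = 1) (hy : R y = 0)
    (hy_le : ∀ f < N.n₁, D' (y * N.n₁ + f) ≤ 1)
    (hyD : ∀ f < N.n₁,
      (D' (y * N.n₁ + f) : ZMod 2) = D (x * N.n₁ + f) + if f = e₀ then 1 else 0)
    (hD : ∀ i < N.n₀, i ≠ y → ∀ f < N.n₁, D' (i * N.n₁ + f) = D (i * N.n₁ + f)) :
    PartialTree N ν E (Function.update R y 1) D' (Function.update B e₀ 1) (q + 1) := by
  have hl := hE.left_lt e₀ he₀
  have hr := hE.right_lt e₀ he₀
  have hx0 : x < N.n₀ := by rcases hxy with h | h <;> omega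
  have hy0 : y < N.n₀ := by rcases hxy with h | h <;> omega
  have hne : x ≠ y := by rintro rfl; omega
  have hR : ∀ i, R i = 1 → i ≠ y ∧ Function.update R y 1 i = 1 := fun i hi => by
    have : i ≠ y := by rintro rfl; omega
    exact ⟨this, by rw [Function.update_of_ne this, hi]⟩
  have hR' : ∀ i, Function.update R y 1 i = 1 → i = y ∨ R i = 1 := fun i hi => by
    by_cases hiy : i = y
    · exact .inl hiy
    · rw [Function.update_of_ne hiy] at hi; exact .inr hi
  have hB' : ∀ e, Function.update B e₀ 1 e = 1 → e = e₀ ∨ B e = 1 := fun e he => by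
    by_cases hee : e = e₀
    · exact .inl hee
    · rw [Function.update_of_ne hee] at he; exact .inr he
  have hmono : markedGraph N B ≤ markedGraph N (Function.update B e₀ 1) :=
    markedGraph_mono fun e he => by
      by_cases hee : e = e₀
      · rw [hee, Function.update_self]
      · rw [Function.update_of_ne hee, he]
  refine ⟨fun i hi => ?_, (hR 0 h.root).2, ?_, fun e he => ?_, fun i hi hRi f hf => ?_,
    fun e he hBe => ?_, fun e he hBe f hf => ?_, fun i hi hRi => ?_⟩
  · rw [Function.update_apply]; split_ifs
    · exact le_rfl
    · exact h.reach_le i hi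
  · rw [← h.card, ← Finset.card_insert_of_notMem (a := y)]
    · congr 1
      ext i
      rw [Finset.mem_filter, Finset.mem_range, Finset.mem_insert, Finset.mem_filter,
        Finset.mem_range]
      constructor
      · rintro ⟨h1, h2⟩
        exact (hR' i h2).imp id fun h => ⟨h1, h⟩
      · rintro (rfl | ⟨h1, h2⟩)
        · exact ⟨hy0, by simp⟩
        · exact ⟨h1, (hR i h2).2⟩
    · simp [hy]
  · rw [Function.update_apply]; split_ifs
    · exact le_rfl
    · exact h.mark_le e he
  · rcases hR' i hRi with rfl | hi1
    · exact hy_le f hf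
    · rw [hD i hi (hR i hi1).1 f hf]; exact h.path_le i hi hi1 f hf
  · rcases hB' e hBe with rfl | hBe
    · have hxx := (hR x hx).2
      rcases hxy with ⟨h1, h2⟩ | ⟨h1, h2⟩
      · rw [← h1, ← h2]; exact ⟨hxx, by simp⟩
      · rw [← h1, ← h2]; exact ⟨by simp, hxx⟩
    · obtain ⟨h1, h2⟩ := h.ends e he hBe
      exact ⟨(hR _ h1).2, (hR _ h2).2⟩
  · rcases hB' e hBe with rfl | hBe
    · have : (D' (x * N.n₁ + f) : ZMod 2) + D' (y * N.n₁ + f) = if f = e then 1 else 0 := by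
        rw [hD x hx0 hne f hf, hyD f hf, ← add_assoc, CharTwo.add_self_eq_zero, zero_add]
      rcases hxy with ⟨h1, h2⟩ | ⟨h1, h2⟩
      · rw [← h1, ← h2]; exact this
      · rw [← h1, ← h2, add_comm]; exact this
    · obtain ⟨h1, h2⟩ := h.ends e he hBe
      rw [hD _ (hE.left_lt e he) (hR _ h1).1 f hf, hD _ (hE.right_lt e he) (hR _ h2).1 f hf]
      exact h.path e he hBe f hf
  · rcases hR' i hRi with rfl | hi1
    · refine ((h.reachable x hx0 hx).mono hmono).trans (SimpleGraph.Adj.reachable ?_)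
      refine ⟨⟨e₀, he₀⟩, by simp, ?_⟩
      rw [hE.edge]
      rcases hxy with ⟨h1, h2⟩ | ⟨h1, h2⟩
      · rw [h1, h2]
      · rw [h1, h2, Finset.pair_comm]
    · exact (h.reachable i hi hi1).mono hmono

/-- A walk from the root to an unreached vertex must leave the reached set along some edge. -/
theorem PartialTree.exists_crossing (hE : EdgeList N ν E) (h : PartialTree N ν E R D B q)
    (hK : (oneSkeleton K).Connected) (hq : q + 1 < N.n₀) :
    ∃ e < N.n₁, R (E (2 * e)) ≠ R (E (2 * e + 1)) := by
  obtain ⟨i, hi, hRi⟩ : ∃ i < N.n₀, R i ≠ 1 := by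
    by_contra! hn
    have := h.card
    rw [Finset.filter_true_of_mem fun i hi => hn i (Finset.mem_range.1 hi),
      Finset.card_range] at this
    omega
  obtain ⟨p⟩ := hK.preconnected (ν 0) (ν i)
  obtain ⟨d, -, ⟨a, ha, hda, hRa⟩, hd⟩ := p.exists_boundary_dart {v | ∃ j < N.n₀, ν j = v ∧ R j = 1}
    ⟨0, by omega, rfl, h.root⟩ (by
      rintro ⟨j, hj, hji, hRj⟩
      exact hRi (hE.inj hj hi hji ▸ hRj))
  obtain ⟨b, hb, hdb⟩ := hE.surj d.snd
  have hRb : R b ≠ 1 := fun hRb => hd ⟨b, hb, hdb, hRb⟩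
  obtain ⟨hne, hf⟩ := d.adj
  rw [← hda, ← hdb] at hne hf
  obtain ⟨e, he⟩ := N.edge.surjective ⟨_, hf, Finset.card_pair hne⟩
  have hee : (N.edge e).1 = {ν a, ν b} := by rw [he]
  rw [hE.edge] at hee
  have hl := hE.left_lt e e.2
  have hr := hE.right_lt e e.2
  refine ⟨e, e.2, ?_⟩
  rcases pair_eq_pair hee with ⟨h1, h2⟩ | ⟨h1, h2⟩
  · rw [hE.inj hl ha h1, hE.inj hr hb h2, hRa]; exact hRb.symm
  · rw [hE.inj hl hb h1, hE.inj hr ha h2, hRa]; exact hRb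

/-- The results of Step 1: `B` marks the edges of the spanning tree `T`, and row `i` of `D` marks
the edges on the path from the root to the vertex `i`. -/
structure TreeData (N : Numbering K) (T : SimpleGraph V) (D B : ℕ → ℕ) : Prop where
  tree : IsSpanningTree K T
  mark_le : ∀ e < N.n₁, B e ≤ 1
  mark : ∀ e : Fin N.n₁, InTree T (N.edge e) ↔ B e = 1
  path_le : ∀ i < N.n₀, ∀ f < N.n₁, D (i * N.n₁ + f) ≤ 1
  potential : ∀ f : Fin N.n₁,
    IsPotential T (N.edge f) fun v => (D (N.vert.symm v * N.n₁ + f) : ZMod 2)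

/-- By the count all vertices have been reached, which gives connectedness. Column `f` of the path
matrix is a potential of the edge `f`, and having a potential for every edge forces the graph to be
acyclic. -/
theorem PartialTree.treeData (hE : EdgeList N ν E) (h : PartialTree N ν E R D B q)
    (hq : q + 1 = N.n₀) : TreeData N (markedGraph N B) D B := by
  have hR : ∀ i < N.n₀, R i = 1 := by
    have hc := h.card
    rw [hq] at hc
    have := Finset.eq_of_subset_of_card_le
      (Finset.filter_subset (fun i => R i = 1) (Finset.range N.n₀)) (by rw [hc, Finset.card_range])
    intro i hi
    have hi' := Finset.mem_range.2 hi
    rw [← this] at hi'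
    exact (Finset.mem_filter.1 hi').2
  have hpot : ∀ f : Fin N.n₁,
      IsPotential (markedGraph N B) (N.edge f)
        fun v => (D (N.vert.symm v * N.n₁ + f) : ZMod 2) := by
    rintro f u v ⟨e, he, heuv⟩
    have hp := h.path e e.2 he f f.2
    have hl := hE.symm_vert (hE.left_lt e e.2)
    have hr := hE.symm_vert (hE.right_lt e e.2)
    have e1 := add_eq_of_pair_eq (fun v => (D (N.vert.symm v * N.n₁ + f) : ZMod 2))
      (heuv.symm.trans (hE.edge e))
    simp only [hl, hr, hp] at e1
    refine e1.trans (if_congr ?_ rfl rfl)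
    rw [← heuv, ← Fin.ext_iff]
    exact ⟨fun h => by rw [h], fun h => N.edge.injective (Subtype.ext h)⟩
  refine ⟨⟨markedGraph_le N B, ⟨?_, ?_⟩⟩, h.mark_le, inTree_markedGraph, fun i hi => h.path_le i hi (hR i hi), hpot⟩
  · have : ∀ v, (markedGraph N B).Reachable (ν 0) v := fun v => by
      obtain ⟨i, hi, rfl⟩ := hE.surj v
      exact h.reachable i hi (hR i hi)
    exact { preconnected := fun u v => (this u).symm.trans (this v), nonempty := ⟨ν 0⟩ }
  · refine isAcyclic_of_isPotential (markedGraph_le N B) fun f => ?_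
    have := hpot (N.edge.symm f)
    rw [Equiv.apply_symm_apply] at this
    exact ⟨_, this⟩

end

/-! ### The program for the spanning tree -/

section
open AExp

/-- Add the last edge between a reached and an unreached vertex to the tree. -/
def growStepCmd : Cmd :=
  .seq (assign 7 0) <|
  .seq (fold 7 (var 1)
    (exor (get 10 (get 0 (2 * var 21))) (get 10 (get 0 (2 * var 21 + 1))) * (var 21 + 1) +
      (1 - exor (get 10 (get 0 (2 * var 21))) (get 10 (get 0 (2 * var 21 + 1)))) * var 7)) <|
  .seq (assign 7 (var 7 - 1)) <|
  .seq (assign 8 (get 0 (2 * var 7))) <|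
  .seq (assign 9 (get 0 (2 * var 7 + 1))) <|
  .seq (assign 10 (get 10 (var 8) * var 8 + (1 - get 10 (var 8)) * var 9)) <|
  .seq (assign 11 ((var 8 + var 9) - var 10)) <|
  .seq (fill 11 1 (var 1) (var 11 * var 1 + var 21)
    (exor (get 11 (var 10 * var 1 + var 21)) (isEq (var 21) (var 7)))) <|
  .seq (storeAt 12 (var 7) 1) <|
  storeAt 10 (var 11) 1

/-- Step 1: array `12` marks the edges of a spanning tree, and the rows of array `11` are the paths
from the root. -/
def growTreeCmd : Cmd :=
  .seq (fill 10 1 (var 0) (var 21) (1 - var 21)) <|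
  .seq (fill 12 1 (var 1) (var 21) 0) <|
  .seq (fill 11 1 (var 1) (var 21) 0) <|
  .seq (assign 5 0) <|
  .seq (assign 6 (var 0 - 1)) <|
  loop 5 6 growStepCmd

variable {V : Type*} [DecidableEq V] {K : AbstractSimplicialComplex V} {N : Numbering K}
  {ν : ℕ → V} {w M q : ℕ} {P : Program} {σ : State}

theorem Does.growStep (hw : Big w M) (hE : EdgeList N ν (σ.arr 0)) (hK : (oneSkeleton K).Connected)
    (h0 : N.n₀ + 2 ≤ M) (h1 : 2 * N.n₁ + 2 ≤ M) (h01 : N.n₀ * N.n₁ ≤ M)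
    (hv0 : σ.var 0 = N.n₀) (hv1 : σ.var 1 = N.n₁)
    (hT : PartialTree N ν (σ.arr 0) (σ.arr 10) (σ.arr 11) (σ.arr 12) q) (hq : q + 1 < N.n₀) :
    Does w P 20 growStepCmd σ (4000 * (N.n₁ + 1)) fun s =>
      (∀ x < 7, s.var x = σ.var x) ∧ (∀ β, β ≠ 10 → β ≠ 11 → β ≠ 12 → s.arr β = σ.arr β) ∧
      PartialTree N ν (s.arr 0) (s.arr 10) (s.arr 11) (s.arr 12) (q + 1) := by
  set E := σ.arr 0 with hEdef
  set R := σ.arr 10 with hRdef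
  have hRb : ∀ i < N.n₀, R i ≤ 1 := hT.reach_le
  have hl := hE.left_lt
  have hr := hE.right_lt
  set p : ℕ → Prop := fun e => R (E (2 * e)) ≠ R (E (2 * e + 1)) with hp
  refine Does.le (B := 110 + (1000 * (N.n₁ + 1) + (110 + (110 + (110 + (110 + (110 +
    (1000 * (1 * N.n₁ + 1) + (210 + 210))))))))) ?_ (by omega)
  refine .seq (.assign hw (by norm_num) (by norm_num) rfl (by simp) ?_)
  refine .seq (.fold hw (by norm_num) rfl rfl (N := N.n₁) ?_ ?_ (by omega) (lastSucc p) ?_ ?_ ?_)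
  · simp [State.setVar_var, hv1]; omega
  · simp [State.setVar_var, hv1]
  · simp [State.setVar_var, lastSucc]
  · intro e he s hs h7 h21 harr
    simp only [State.setVar_arr] at harr
    have e0 : s.arr 0 = E := by rw [harr]
    have e10 : s.arr 10 = R := by rw [harr]
    have a1 := hl e he
    have a2 := hr e he
    have b1 := hRb _ a1
    have b2 := hRb _ a2
    have b3 := lastSucc_le p e
    simp only [fine_add, fine_mul, fine_var, fine_get, fine_sub, fine_one, fine_exor, fine_ofNat,
      eval_add, eval_mul, eval_var, eval_get, eval_sub, eval_one, eval_exor, eval_ofNat, h7, h21,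
      e0, e10]
    refine ⟨by omega, ?_⟩
    simp only [lastSucc, hp]
    generalize R (E (2 * e)) = x at *
    generalize R (E (2 * e + 1)) = y at *
    interval_cases x <;> interval_cases y <;> simp
  -- A crossing edge exists, so the search does not end with the value `0` for failure and
  -- subtracting one is safe.
  have hex : lastSucc p N.n₁ ≠ 0 := fun h => by
    obtain ⟨e, he, hne⟩ := hT.exists_crossing hE hK hq
    exact lastSucc_eq_zero h e he hne
  obtain ⟨e, he⟩ := Nat.exists_eq_succ_of_ne_zero hex
  have hen : e < N.n₁ := by have := lastSucc_le p N.n₁; omega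
  have hpe : p e := lastSucc_eq_succ he
  have a1 := hl e hen
  have a2 := hr e hen
  have b1 := hRb _ a1
  have b2 := hRb _ a2
  rw [he]
  refine .seq (.assign hw (by norm_num) (by norm_num) rfl ?_ ?_)
  · simp [State.setVar_var]; omega
  rw [eval_sub, eval_var, eval_one, State.setVar_var, if_pos rfl, Nat.succ_sub_one]
  set s₁ := ((σ.setVar 7 (eval σ 0)).setVar 7 (e + 1)).setVar 7 e with hs₁
  have k7 : s₁.var 7 = e := by simp [hs₁, State.setVar_var]
  have kx : ∀ x, x ≠ 7 → s₁.var x = σ.var x := fun x hx => by simp [hs₁, State.setVar_var, hx]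
  have kA : s₁.arr = σ.arr := rfl
  refine .seq (.assign hw (by norm_num) (by norm_num) rfl ?_ ?_)
  · simp [k7, kA, ← hEdef]; omega
  refine .seq (.assign hw (by norm_num) (by norm_num) rfl ?_ ?_)
  · simp [k7, kA, ← hEdef, State.setVar_var]; omega
  set s₂ := (s₁.setVar 8 (E (2 * e))).setVar 9 (E (2 * e + 1)) with hs₂
  have e₂ : (s₁.setVar 8 (eval s₁ (get 0 (2 * var 7)))).setVar 9
      (eval (s₁.setVar 8 (eval s₁ (get 0 (2 * var 7)))) (get 0 (2 * var 7 + 1))) = s₂ := by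
    simp [hs₂, State.setVar_var, k7, kA, ← hEdef]
  rw [e₂]
  have l8 : s₂.var 8 = E (2 * e) := by simp [hs₂, State.setVar_var]
  have l9 : s₂.var 9 = E (2 * e + 1) := by simp [hs₂, State.setVar_var]
  have lA : s₂.arr = σ.arr := rfl
  -- The mark of the first endpoint selects the reached end arithmetically; the new vertex is then
  -- the sum of both ends minus this one.
  obtain ⟨x, y, hxy, hx, hy, hev⟩ : ∃ x y,
      ((x = E (2 * e) ∧ y = E (2 * e + 1)) ∨ (x = E (2 * e + 1) ∧ y = E (2 * e))) ∧
      R x = 1 ∧ R y = 0 ∧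
      (get 10 (var 8) * var 8 + (1 - get 10 (var 8)) * var 9 : AExp).eval s₂ = x := by
    simp only [eval_add, eval_mul, eval_sub, eval_get, eval_var, eval_one, l8, l9, lA, ← hRdef]
    simp only [hp] at hpe
    rcases Nat.le_one_iff_eq_zero_or_eq_one.1 b1 with h | h
    · exact ⟨_, _, .inr ⟨rfl, rfl⟩, by omega, h, by simp [h]⟩
    · exact ⟨_, _, .inl ⟨rfl, rfl⟩, h, by omega, by simp [h]⟩
  have hx0 : x < N.n₀ := by omega
  have hy0 : y < N.n₀ := by omega
  refine .seq (.assign hw (by norm_num) (by norm_num) rfl ?_ ?_)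
  · simp [l8, l9, lA, ← hRdef]; omega
  rw [hev]
  refine .seq (.assign hw (by norm_num) (by norm_num) rfl ?_ ?_)
  · simp [l8, l9, State.setVar_var]; omega
  simp only [eval_sub, eval_add, eval_var, State.setVar_var, l8, l9, Nat.reduceEqDiff, if_false,
    if_true]
  have hxy' : E (2 * e) + E (2 * e + 1) - x = y := by omega
  rw [hxy']
  set s₃ := (s₂.setVar 10 x).setVar 11 y with hs₃
  have m1 : s₃.var 1 = N.n₁ := by simp [hs₃, hs₂, State.setVar_var, kx, hv1]
  have m7 : s₃.var 7 = e := by simp [hs₃, hs₂, State.setVar_var, k7]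
  have m10 : s₃.var 10 = x := by simp [hs₃, State.setVar_var]
  have m11 : s₃.var 11 = y := by simp [hs₃, State.setVar_var]
  have mx : ∀ x < 7, s₃.var x = σ.var x := fun x hx => by
    simp only [hs₃, hs₂, State.setVar_var]
    rw [if_neg (by omega), if_neg (by omega), if_neg (by omega), if_neg (by omega),
      kx x (by omega)]
  have mA : s₃.arr = σ.arr := rfl
  have hD : ∀ i < N.n₀, R i = 1 → ∀ f < N.n₁, σ.arr 11 (i * N.n₁ + f) ≤ 1 := hT.path_le
  have hne : x ≠ y := by rintro rfl; omega
  have hidx : ∀ i < N.n₀, ∀ f < N.n₁, i * N.n₁ + f ≤ M := fun i hi f hf => by nlinarith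
  refine .seq (.fill hw rfl rfl rfl rfl rfl (m := 1) (n := N.n₁) ?_ ?_ ?_ ?_ ?_ ?_
    (fun _ j => y * N.n₁ + j) (fun _ j =>
      (σ.arr 11 (x * N.n₁ + j) - if j = e then 1 else 0) +
        ((if j = e then 1 else 0) - σ.arr 11 (x * N.n₁ + j))) ?_ ?_ ?_)
  · simp; omega
  · simp [m1]; omega
  · simp
  · simp [m1]
  · omega
  · omega
  · intro i hi j hj i' hi' j' hj' h
    omega
  · intro i hi j hj s hs h20 h21 hA hB
    have e11 : s.arr 11 (x * N.n₁ + j) = σ.arr 11 (x * N.n₁ + j) := by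
      rw [hB, mA]
      intro i' hi' j' hj' _ h
      exact hne (pair_inj hj hj' h).1
    have c1 := hD x hx0 hx j hj
    have c2 := hidx y hy0 j hj
    have c3 := hidx x hx0 j hj
    simp only [fine_add, fine_mul, fine_var, fine_get, fine_exor, fine_isEq,
      eval_add, eval_mul, eval_var, eval_get, eval_exor, eval_isEq,
      hs 1, hs 7, hs 10, hs 11, Nat.reduceLT, Nat.one_lt_ofNat, h21, m1, m7, m10,
      m11, e11]
    exact ⟨by omega, by omega, by trivial, by trivial⟩
  intro arr g1 g2 g3
  refine .seq (.storeAt hw (by norm_num) rfl rfl ?_ ?_ ?_)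
  · simp [m7]; omega
  · simp; omega
  refine .storeAt hw (by norm_num) rfl rfl ?_ ?_ ?_
  · simp [m11]; omega
  · simp; omega
  simp only [eval_var, eval_one, State.setArr_var, m7, m11]
  set s₄ := (State.setArr ⟨s₃.var, arr⟩ 12 e 1).setArr 10 y 1 with hs₄
  have n0 : ∀ β, β ≠ 10 → β ≠ 11 → β ≠ 12 → s₄.arr β = σ.arr β := fun β h10 h11 h12 => by
    funext z
    simp [hs₄, State.setArr_arr, h10, h12, g1 β h11, mA]
  have n10 : s₄.arr 10 = Function.update R y 1 := by
    funext z
    simp [hs₄, State.setArr_arr, Function.update_apply, g1 10, mA, hRdef]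
  have n12 : s₄.arr 12 = Function.update (σ.arr 12) e 1 := by
    funext z
    simp [hs₄, State.setArr_arr, Function.update_apply, g1 12, mA]
  have n11 : s₄.arr 11 = arr 11 := by
    funext z
    simp [hs₄, State.setArr_arr]
  refine ⟨mx, n0, ?_⟩
  rw [n0 0 (by norm_num) (by norm_num) (by norm_num), n10, n12, n11]
  refine hT.step hE hen hxy hx hy (fun f hf => ?_) (fun f hf => ?_) fun i hi hiy f hf => ?_
  · rw [g2 0 (by norm_num) f hf]
    exact (exor_bits (hD x hx0 hx f hf) (by split_ifs <;> simp)).1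
  · rw [g2 0 (by norm_num) f hf, (exor_bits (hD x hx0 hx f hf) (by split_ifs <;> simp)).2]
    split_ifs <;> simp
  · rw [g3, mA]
    intro i' hi' j' hj' h
    exact hiy (pair_inj hf hj' h).1

/-- Each of the `n₀ - 1` rounds scans all edges, which is affordable because quadratic time is
within the bound. Only the root's row of the path matrix has to be cleared in advance. -/
theorem Does.growTree (hw : Big w M) (hE : EdgeList N ν (σ.arr 0)) (hK : (oneSkeleton K).Connected)
    (hn : 0 < N.n₀) (h0 : N.n₀ + 2 ≤ M) (h1 : 2 * N.n₁ + 2 ≤ M) (h01 : N.n₀ * N.n₁ ≤ M)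
    (hv0 : σ.var 0 = N.n₀) (hv1 : σ.var 1 = N.n₁) :
    Does w P 20 growTreeCmd σ (8000 * ((N.n₀ + 1) * (N.n₁ + 1))) fun s =>
      (∀ x < 5, s.var x = σ.var x) ∧ (∀ β < 10, s.arr β = σ.arr β) ∧
      ∃ T, TreeData N T (s.arr 11) (s.arr 12) := by
  refine Does.le (B := 1000 * (1 * N.n₀ + 1) + (1000 * (1 * N.n₁ + 1) + (1000 * (1 * N.n₁ + 1) +
    (110 + (110 + ((N.n₀ - 1) * (4000 * (N.n₁ + 1) + 111) + 1)))))) ?_ ?_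
  swap
  · obtain ⟨a, ha⟩ := Nat.exists_eq_succ_of_ne_zero hn.ne'
    rw [ha, Nat.succ_sub_one]
    nlinarith [Nat.zero_le (a * N.n₁)]
  have hinj : ∀ n : ℕ, ∀ i < 1, ∀ j < n, ∀ i' < 1, ∀ j' < n, j = j' → i = i' ∧ j = j' := by
    omega
  refine .seq (.fill hw rfl rfl rfl rfl rfl (m := 1) (n := N.n₀) ?_ ?_ ?_ ?_ ?_ ?_
    (fun _ j => j) (fun _ j => 1 - j) (hinj _) ?_ ?_)
  · simp; omega
  · simp [hv0]; omega
  · simp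
  · simp [hv0]
  · omega
  · omega
  · intro i hi j hj s hs h20 h21 hA hB
    simp only [fine_var, fine_sub, fine_one, eval_var, eval_sub, eval_one, h21]
    exact ⟨by omega, by omega, by trivial, by trivial⟩
  intro arr₁ f1 f2 _
  refine .seq (.fill hw rfl rfl rfl rfl rfl (m := 1) (n := N.n₁) ?_ ?_ ?_ ?_ ?_ ?_
    (fun _ j => j) (fun _ j => 0) (hinj _) ?_ ?_)
  · simp; omega
  · simp [hv1]; omega
  · simp
  · simp [hv1]
  · omega
  · omega
  · intro i hi j hj s hs h20 h21 hA hB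
    simp only [fine_var, fine_zero, eval_var, eval_zero, h21]
    exact ⟨by omega, by trivial, by trivial, by trivial⟩
  intro arr₂ g1 g2 _
  refine .seq (.fill hw rfl rfl rfl rfl rfl (m := 1) (n := N.n₁) ?_ ?_ ?_ ?_ ?_ ?_
    (fun _ j => j) (fun _ j => 0) (hinj _) ?_ ?_)
  · simp; omega
  · simp [hv1]; omega
  · simp
  · simp [hv1]
  · omega
  · omega
  · intro i hi j hj s hs h20 h21 hA hB
    simp only [fine_var, fine_zero, eval_var, eval_zero, h21]
    exact ⟨by omega, by trivial, by trivial, by trivial⟩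
  intro arr₃ k1 k2 _
  dsimp only at g1 k1
  refine .seq (.assign hw (by norm_num) (by norm_num) rfl (by simp) ?_)
  refine .seq (.assign hw (by norm_num) (by norm_num) rfl
    (by simp [State.setVar_var, hv0]; omega) ?_)
  have e0 : arr₃ 0 = σ.arr 0 := by
    rw [k1 0 (by norm_num), g1 0 (by norm_num), f1 0 (by norm_num)]
  refine .loop hw (by norm_num) (by norm_num) (by norm_num) (by norm_num) (N := N.n₀ - 1) (by omega)
    (fun q s => (∀ x < 5, s.var x = σ.var x) ∧ (∀ β < 10, s.arr β = σ.arr β) ∧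
      PartialTree N ν (s.arr 0) (s.arr 10) (s.arr 11) (s.arr 12) q) ?_ ?_ ?_ ?_ ?_
  · refine ⟨fun x hx => ?_, fun β hβ => ?_, ?_⟩
    · simp only [State.setVar_var]
      rw [if_neg (by omega), if_neg (by omega)]
    · simp only [State.setVar_arr]
      rw [k1 β (by omega), g1 β (by omega), f1 β (by omega)]
    · refine PartialTree.init hn (fun i hi => ?_) (fun e he => ?_) fun f hf => ?_
      · simp only [State.setVar_arr]
        rw [k1 10 (by norm_num), g1 10 (by norm_num), f2 0 (by norm_num) i hi]
        split_ifs <;> omega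
      · simp only [State.setVar_arr]
        rw [k1 12 (by norm_num), g2 0 (by norm_num) e he]
      · exact k2 0 (by norm_num) f hf
  · simp [State.setVar_var]
  · simp [State.setVar_var, hv0]
  · rintro q hq s ⟨i1, i2, i3⟩ hs5 hs6
    refine Does.mono (.growStep (N := N) (ν := ν) (q := q) hw ?_ hK h0 h1 h01 ?_ ?_ i3 (by omega))
      le_rfl ?_
    · rw [i2 0 (by norm_num)]; exact hE
    · rw [i1 0 (by norm_num), hv0]
    · rw [i1 1 (by norm_num), hv1]
    rintro s' ⟨j1, j2, j3⟩
    refine ⟨by rw [j1 5 (by norm_num), hs5], by rw [j1 6 (by norm_num), hs6], fun x hx => ?_,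
      fun β hβ => ?_, j3⟩
    · rw [State.setVar_var, if_neg (by omega), j1 x (by omega), i1 x hx]
    · rw [State.setVar_arr, j2 β (by omega) (by omega) (by omega), i2 β hβ]
  · rintro s ⟨i1, i2, i3⟩ - -
    refine ⟨i1, i2, _, i3.treeData ?_ (by omega)⟩
    rw [i2 0 (by norm_num)]; exact hE

end

/-! ### The program for the sentinel cycles -/

/-- The increasing enumeration of the numbers below `n` with a given property. -/
theorem exists_enumeration (p : ℕ → Prop) [DecidablePred p] (n : ℕ) :
    ∃ f : Fin (Nat.count p n) → Fin n, StrictMono f ∧ (∀ i, p (f i) ∧ Nat.count p (f i) = i) ∧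
      ∀ q : Fin n, p q → ∃ i, f i = q := by
  have h : ∀ i : Fin (Nat.count p n), ∃ q : Fin n, p q ∧ Nat.count p q = i := by
    rintro ⟨i, hi⟩
    induction n with
    | zero => simp at hi
    | succ n ih =>
      rw [Nat.count_succ] at hi
      by_cases hlt : i < Nat.count p n
      · obtain ⟨q, hq⟩ := ih hlt
        exact ⟨q.castSucc, hq⟩
      · split_ifs at hi with hp
        · exact ⟨Fin.last n, hp, by simp; omega⟩
        · omega
  choose f hf using h
  have hm : StrictMono f := fun i j hij => by
    by_contra hle
    have := Nat.count_monotone p (Fin.le_def.1 (not_lt.1 hle))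
    rw [(hf i).2, (hf j).2] at this
    omega
  refine ⟨f, hm, hf, fun q hq => ?_⟩
  refine ⟨⟨Nat.count p q, Nat.count_strict_mono hq q.2⟩, Fin.ext ?_⟩
  exact Nat.count_injective (hf _).1 hq (hf _).2

/-- The value modulo `2`. -/
def AExp.parity (a : AExp) : AExp := a - a / 2 * 2

@[simp] theorem AExp.eval_parity (s : State) (a : AExp) : (parity a).eval s = a.eval s % 2 := by
  simp only [parity, eval_sub, eval_mul, eval_div, eval_ofNat]; omega

@[simp] theorem AExp.fine_parity (s : State) (M : ℕ) (a : AExp) :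
    (parity a).Fine M s ↔ a.Fine M s ∧ 2 ≤ M := by
  simp only [parity, fine_sub, fine_mul, fine_div, fine_ofNat]; tauto

section
open AExp

/-- The sentinel edges (array `2`) and the matrix of the sentinel cycles (array `3`). -/
def sentinelCmd : Cmd :=
  .seq (collect 2 5 (var 1) (1 - get 12 (var 21))) <|
  fill 3 (var 1) (var 5) (var 20 * var 5 + var 21)
    (parity ((get 11 (get 0 (2 * get 2 (var 21)) * var 1 + var 20) +
      get 11 (get 0 (2 * get 2 (var 21) + 1) * var 1 + var 20)) +
      isEq (var 20) (get 2 (var 21))))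

variable {V : Type*} [DecidableEq V] {K : AbstractSimplicialComplex V} {N : Numbering K}
  {T : SimpleGraph V} {ν : ℕ → V} {w M k : ℕ} {P : Program} {σ : State}

/-- The sentinel edges `s` and their cycles are stored in the arrays `2` and `3`. -/
structure SentinelData (N : Numbering K) (T : SimpleGraph V) (s : Fin k → Simplex K 1)
    (arr : ℕ → ℕ → ℕ) : Prop where
  injective : Function.Injective s
  range : Set.range s = {e | ¬ InTree T e}
  list : ∀ i : Fin k, arr 2 i = (N.edge.symm (s i) : ℕ)
  matrix : ∀ (i : Fin N.n₁) (j : Fin k),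
    arr 3 (i * k + j) = (sentinelCycle T (s j) (N.edge i)).val

/-- By `sentinelCycle_eq`, the sentinel cycle of `{x, y}` is modulo `2` the sum of the root paths of
`x` and `y` and the edge itself: the common part of the two paths cancels. -/
theorem Does.sentinel (hw : Big w M) (hE : EdgeList N ν (σ.arr 0))
    (hT : TreeData N T (σ.arr 11) (σ.arr 12)) (h1 : 2 * N.n₁ + 2 ≤ M) (h01 : N.n₀ * N.n₁ ≤ M)
    (h0 : N.n₀ ≤ M) (h11 : N.n₁ * N.n₁ ≤ M) (hv1 : σ.var 1 = N.n₁) :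
    Does w P 20 sentinelCmd σ (2000 * ((N.n₁ + 1) * (N.n₁ + 1))) fun st =>
      (∀ x < 5, st.var x = σ.var x) ∧ (∀ β < 2, st.arr β = σ.arr β) ∧
      ∃ (k : ℕ) (s : Fin k → Simplex K 1), k ≤ N.n₁ ∧ st.var 5 = k ∧
        SentinelData N T s st.arr := by
  set p : ℕ → Prop := fun e => σ.arr 12 e = 0 with hp
  set k := Nat.count p N.n₁ with hk
  obtain ⟨f, hf, hfp, hfs⟩ : ∃ f : Fin k → Fin N.n₁, _ := exists_enumeration p N.n₁
  have hkn : k ≤ N.n₁ := Nat.count_le _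
  have hkn' : N.n₁ * k ≤ N.n₁ * N.n₁ := Nat.mul_le_mul_left _ hkn
  refine Does.le (B := 1000 * (N.n₁ + 1) + 1000 * (N.n₁ * k + 1)) ?_ (by nlinarith)
  refine .seq (.collect hw (by norm_num) rfl rfl (N := N.n₁) ?_ ?_ (by omega) p ?_ ?_)
  · simp [hv1]; omega
  · simp [hv1]
  · intro q hq s hs h21 hA
    have e12 : s.arr 12 = σ.arr 12 := hA 12 (by norm_num)
    have hB := hT.mark_le q hq
    simp only [fine_sub, fine_one, fine_get, fine_var, eval_sub, eval_one, eval_get, eval_var, h21,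
      e12, hp]
    refine ⟨by omega, ?_⟩
    split_ifs <;> omega
  intro arr₁ f1 f2
  have l2 : ∀ j : Fin k, arr₁ 2 j = f j := fun j => by
    have := f2 (f j) (f j).2 (hfp j).1
    rwa [(hfp j).2] at this
  set σ₁ : State := ⟨Function.update σ.var 5 k, arr₁⟩ with hσ₁
  have k1 : σ₁.var 1 = N.n₁ := by simp [hσ₁, hv1]
  have k5 : σ₁.var 5 = k := by simp [hσ₁]
  have hl := hE.left_lt
  have hr := hE.right_lt
  have hidx : ∀ i < N.n₀, ∀ f < N.n₁, i * N.n₁ + f ≤ M := fun i hi f hf => by nlinarith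
  have hDle := hT.path_le
  set E := σ.arr 0 with hE0
  set D := σ.arr 11 with hD11
  refine .fill hw rfl rfl rfl rfl rfl (m := N.n₁) (n := k) ?_ ?_ ?_ ?_ ?_ ?_
    (fun i j => i * k + j) (fun i j =>
      ((D (E (2 * arr₁ 2 j) * N.n₁ + i) + D (E (2 * arr₁ 2 j + 1) * N.n₁ + i)) +
        if i = arr₁ 2 j then 1 else 0) % 2)
      (fun i _ j hj i' _ j' hj' he => pair_inj hj hj' he) ?_ ?_
  · simp [k1]; omega
  · simp [k5]; omega
  · simp [k1]
  · simp [k5]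
  · omega
  · omega
  · intro i hi j hj s hs h20 h21 hA hB
    have e2 : s.arr 2 = arr₁ 2 := hA 2 (by norm_num)
    have e0 : s.arr 0 = E := (hA 0 (by norm_num)).trans (f1 0 (by norm_num))
    have e11 : s.arr 11 = D := (hA 11 (by norm_num)).trans (f1 11 (by norm_num))
    have a2 : arr₁ 2 j < N.n₁ := by rw [l2 ⟨j, hj⟩]; exact (f ⟨j, hj⟩).2
    have b1 := hl _ a2
    have b2 := hr _ a2
    have c1 := hDle _ b1 i hi
    have c2 := hDle _ b2 i hi
    simp only [fine_add, fine_mul, fine_var, fine_get, fine_parity, fine_isEq, fine_ofNat, fine_one,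
      eval_add, eval_mul, eval_var, eval_get, eval_parity, eval_isEq, eval_ofNat, eval_one,
      hs 1, hs 5, Nat.reduceLT, Nat.one_lt_ofNat, h20, h21, e0, e2, e11, k1, k5]
    exact ⟨by omega, by omega, by trivial, by trivial⟩
  intro arr₂ g1 g2 _
  refine ⟨fun x hx => ?_, fun β hβ => ?_, k, fun i => N.edge (f i), hkn, k5, ?_⟩
  · show Function.update σ.var 5 k x = _
    rw [Function.update_of_ne (by omega)]
  · show arr₂ β = _
    rw [g1 β (by omega)]; exact f1 β (by omega)
  refine ⟨fun i j h => hf.injective (N.edge.injective h), Set.ext fun e => ?_, fun i => ?_,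
    fun i j => ?_⟩
  · obtain ⟨i, rfl⟩ := N.edge.surjective e
    have hB := hT.mark_le i i.2
    rw [Set.mem_ofPred_eq, hT.mark]
    constructor
    · rintro ⟨j, hj⟩
      have := N.edge.injective hj
      rw [← this]
      have : σ.arr 12 (f j) = 0 := (hfp j).1
      omega
    · intro h
      obtain ⟨j, hj⟩ := hfs i (show σ.arr 12 i = 0 by omega)
      exact ⟨j, by rw [← hj]⟩
  · show arr₂ 2 i = _
    rw [g1 2 (by norm_num), Equiv.symm_apply_apply]
    exact l2 i
  · show arr₂ 3 _ = _
    rw [g2 i i.2 j j.2, l2 j]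
    have b1 := hl _ (f j).2
    have b2 := hr _ (f j).2
    rw [← ZMod.val_natCast, sentinelCycle_eq hT.tree.2 (hE.edge (f j)) (hT.potential i)]
    simp only [hE.symm_vert b1, hE.symm_vert b2]
    congr 1
    push_cast
    simp only [N.edge.injective.eq_iff, Fin.ext_iff]

end

/-! ### Reading off the earliest basis and the coordinates after elimination -/

theorem blockMap_sub_sum {α : Type*} (s : Finset α) (arr : ℕ → ℕ → ℕ) (m lo c : ℕ)
    (x : ℕ → ZMod 2) (k : α → ZMod 2) (y : α → ℕ → ZMod 2) (t : ℕ) :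
    blockMap arr m lo c (fun r => x r - ∑ i ∈ s, k i * y i r) t =
      blockMap arr m lo c x t - ∑ i ∈ s, k i * blockMap arr m lo c (y i) t := by
  have hp : ∀ r, pick (fun r => x r - ∑ i ∈ s, k i * y i r) r =
      pick x r - ∑ i ∈ s, k i * pick (y i) r := fun r => by
    unfold pick; split_ifs <;> simp
  simp only [blockMap, hp, mul_sub, mul_add, Finset.sum_sub_distrib, Finset.sum_add_distrib,
    Finset.mul_sum]
  rw [Finset.sum_comm]
  simp only [mul_left_comm]
  ring

theorem blockMap_zero (arr : ℕ → ℕ → ℕ) (m lo c t : ℕ) : blockMap arr m lo c 0 t = 0 := by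
  simp [blockMap, pick]

/-- The elimination map is linear and injective, so the columns before and after it satisfy the same
linear relations. Afterwards the pivot columns are distinct unit vectors, and column `j` is
supported in the pivot rows of pivot columns not after `j`. Hence the entries in the pivot rows are
the coordinates with respect to the pivot columns. -/
theorem Reduced.isGreedyBasis {R : Type*} {n₁ n m r : ℕ} {a a' : ℕ → ℕ → ℕ}
    (h : Reduced m 0 m a a') (row : Fin n₁ ≃ R) (A : Matrix R (Fin n) (ZMod 2))
    (hn : n ≤ m) (hn₁ : n₁ ≤ m) (hA : ∀ i j, entry a m (i : Fin n₁) (j : Fin n) = A (row i) j)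
    (hA0 : ∀ i < m, n₁ ≤ i → ∀ j < n, entry a m i j = 0) (hu : ∀ i < m, a 8 (i + 1) = 0)
    {ι : Fin r → Fin n} (hι : StrictMono ι) (hp : ∀ i, a' 7 (ι i) ≠ 0)
    (hs : ∀ q : Fin n, a' 7 q ≠ 0 → ∃ i, ι i = q) :
    IsGreedyBasis A ι ∧
      ∀ j, A.col j = ∑ i, entry a' m (a' 7 (ι i) - 1) j • A.col (ι i) := by
  have hlt : ∀ j : Fin n, (j : ℕ) < 0 + m := fun j => by have := j.2; omega
  have hle : ∀ p < m, a' 7 (0 + p) ≤ m := fun p hp => h.piv_le _ (by omega) (by omega)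
  have hρ : ∀ i, a' 7 (ι i) = a' 7 (ι i) - 1 + 1 := fun i => by have := hp i; omega
  have hρm : ∀ i, a' 7 (ι i) - 1 < m := fun i => by
    have := h.piv_le (ι i) (by omega) (hlt _); have := hp i; omega
  have hinj : ∀ i i', a' 7 (ι i) = a' 7 (ι i') → i = i' := fun i i' he => by
    rcases lt_trichotomy i i' with hi | hi | hi
    · exact absurd (h.piv_ne _ _ (by omega) (hι hi) (hlt _) he) (hp i')
    · exact hi
    · exact absurd (h.piv_ne _ _ (by omega) (hι hi) (hlt _) he.symm) (hp i)
  have hpiv : ∀ i, ∀ t < m, entry a' m t (ι i) = if t = a' 7 (ι i) - 1 then 1 else 0 :=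
    fun i => (h.piv_pos _ (by omega) (hlt _) _ (hρ i)).2
  have hcols : ∀ j : Fin n, ∀ t < m,
      entry a' m t j = blockMap a' m 0 m (fun r => entry a m r j) t :=
    fun j t ht => h.cols j (by omega) (hlt j) t ht
  -- A column without pivot vanishes in every row unused so far, and a pivot column is the unit
  -- vector of its own row.
  have hzero : ∀ j : Fin n, ∀ t < m, (∀ i, ι i ≤ j → t ≠ a' 7 (ι i) - 1) →
      entry a' m t j = 0 := by
    intro j t ht hne
    by_cases hj : a' 7 j = 0
    · refine h.piv_zero j (by omega) (hlt j) hj t ht (hu t ht) fun p _ hpj he => ?_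
      obtain ⟨i, hi⟩ := hs ⟨p, hpj.trans j.2⟩ (by simp only; omega)
      have hi' : (ι i : ℕ) = p := by rw [hi]
      exact hne i (by rw [hi]; exact hpj.le) (by rw [hi', he]; simp)
    · obtain ⟨i, rfl⟩ := hs j hj
      rw [hpiv i t ht, if_neg (hne i le_rfl)]
  have hcoef : ∀ j i, ¬ ι i ≤ j → entry a' m (a' 7 (ι i) - 1) j = 0 := fun j i hij => by
    refine hzero j _ (hρm i) fun i' hi' he => hij ?_
    rwa [hinj i i' (by rw [hρ i, hρ i', he])]
  have hsum : ∀ j, A.col j = ∑ i, entry a' m (a' 7 (ι i) - 1) j • A.col (ι i) := by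
    intro j
    -- The image of this difference vanishes by the shape of the reduced matrix, so the difference
    -- itself is zero.
    have hx := h.inj (fun t => entry a m t j -
      ∑ i, entry a' m (a' 7 (ι i) - 1) j * entry a m t (ι i)) fun t ht => by
        rw [blockMap_sub_sum Finset.univ a' m 0 m (fun t => entry a m t j)
          (fun i => entry a' m (a' 7 (ι i) - 1) j) (fun i t => entry a m t (ι i)), ← hcols j t ht]
        simp only [← hcols _ t ht, hpiv _ t ht, mul_ite, mul_one, mul_zero]
        rw [sub_eq_zero]
        by_cases hex : ∃ i, t = a' 7 (ι i) - 1
        · obtain ⟨i, hi⟩ := hex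
          rw [Finset.sum_eq_single i, if_pos hi, hi]
          · intro i' _ hne
            rw [if_neg]
            intro hi'
            exact hne (hinj _ _ (by rw [hρ i, hρ i', ← hi, ← hi']))
          · simp
        · rw [hzero j t ht fun i _ hi => hex ⟨i, hi⟩, Finset.sum_eq_zero]
          intro i _
          rw [if_neg fun hi => hex ⟨i, hi⟩]
    funext x
    obtain ⟨t, rfl⟩ := row.surjective x
    have := hx t (by omega)
    simp only [hA] at this
    rw [sub_eq_zero] at this
    rw [Matrix.col_apply, this, Finset.sum_apply]
    rfl
  refine ⟨⟨hι, ?_, fun j => ?_⟩, hsum⟩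
  · rw [Fintype.linearIndependent_iff]
    intro g hg i₀
    have hz : ∀ t < m, (0 : ZMod 2) - ∑ i, g i * entry a m t (ι i) = 0 := by
      intro t ht
      rw [zero_sub, neg_eq_zero]
      rcases lt_or_ge t n₁ with h1 | h1
      · have := congrFun hg (row ⟨t, h1⟩)
        rw [Finset.sum_apply] at this
        refine Eq.trans (Finset.sum_congr rfl fun i _ => ?_) this
        rw [show entry a m t (ι i) = _ from hA ⟨t, h1⟩ (ι i)]
        rfl
      · exact Finset.sum_eq_zero fun i _ => by rw [hA0 t ht h1 _ (ι i).2, mul_zero]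
    -- Transport the relation through the map and read it in the pivot row of column `i₀`, where
    -- only `g i₀` survives.
    have h1 := blockMap_congr (arr := a') (lo := 0) (c := m) (y := 0) hz hle (hρm i₀)
    rw [blockMap_zero] at h1
    have h2 := blockMap_sub_sum Finset.univ a' m 0 m 0 g (fun i t => entry a m t (ι i))
      (a' 7 (ι i₀) - 1)
    simp only [Pi.zero_apply] at h2
    rw [h1, blockMap_zero] at h2
    simp only [← hcols _ _ (hρm i₀), hpiv _ _ (hρm i₀)] at h2
    rw [Finset.sum_eq_single i₀, if_pos rfl] at h2
    · simpa using h2.symm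
    · intro i _ hne
      rw [if_neg, mul_zero]
      intro he
      exact hne (hinj _ _ (by rw [hρ i, hρ i₀, he]))
    · simp
  · rw [hsum j]
    refine Submodule.sum_mem _ fun i _ => ?_
    by_cases hij : ι i ≤ j
    · exact Submodule.smul_mem _ _ (Submodule.subset_span ⟨i, hij, rfl⟩)
    · rw [hcoef j i hij, zero_smul]; exact Submodule.zero_mem _

/-! ### The program for the matrix of the elimination -/

section
open AExp

/-- Add to the entries of the matrix in array `6` the number of endpoints of the edge that agree
with the vertex `c` of the triangle. -/
def addIncidenceCmd (c : ℕ) : Cmd :=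
  fill 6 (var 1) (var 2) (var 20 * (var 4 + var 4) + var 21)
    (get 6 (var 20 * (var 4 + var 4) + var 21) +
      (isEq (get 0 (2 * var 20)) (get 1 (3 * var 21 + const c)) +
        isEq (get 0 (2 * var 20 + 1)) (get 1 (3 * var 21 + const c))))

/-- Put the matrix `[∂₂ | Z]`, padded with zeros, into array `6`, and clear array `8`. -/
def prepareCmd : Cmd :=
  .seq (fill 6 (var 4) (var 4 + var 4) (var 20 * (var 4 + var 4) + var 21) 0) <|
  .seq (addIncidenceCmd 0) <|
  .seq (addIncidenceCmd 1) <|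
  .seq (addIncidenceCmd 2) <|
  .seq (fill 6 (var 1) (var 2) (var 20 * (var 4 + var 4) + var 21)
    (get 6 (var 20 * (var 4 + var 4) + var 21) / 2)) <|
  .seq (fill 6 (var 1) (var 5) (var 20 * (var 4 + var 4) + (var 2 + var 21))
    (get 3 (var 20 * var 5 + var 21))) <|
  fill 8 1 (var 4 + 1) (var 21) 0

variable {V : Type*} [DecidableEq V] {K : AbstractSimplicialComplex V} {N : Numbering K}
  {T : SimpleGraph V} {ν : ℕ → V} {w M k m : ℕ} {P : Program} {σ : State}

/-- `F` lists the vertices of the triangles. -/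
structure TriangleList (N : Numbering K) (ν : ℕ → V) (F : ℕ → ℕ) : Prop where
  lt : ∀ t < N.n₂, ∀ c < 3, F (3 * t + c) < N.n₀
  tri : ∀ t : Fin N.n₂, (N.tri t).1 = {ν (F (3 * t)), ν (F (3 * t + 1)), ν (F (3 * t + 2))}

/-- The endpoints are distinct, and so are the vertices of the triangle. The number of coincidences
is thus the number of endpoints in the triangle, at most `2`, and halving it detects the value `2`.
-/
theorem boundaryMatrix_edge_tri {E F : ℕ → ℕ} (hE : EdgeList N ν E) (hF : TriangleList N ν F)
    (i : Fin N.n₁) (j : Fin N.n₂) :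
    (boundaryMatrix K 1 (N.edge i) (N.tri j)).val =
      ((((if E (2 * i) = F (3 * j + 0) then 1 else 0) +
        if E (2 * i + 1) = F (3 * j + 0) then 1 else 0) +
      ((if E (2 * i) = F (3 * j + 1) then 1 else 0) +
        if E (2 * i + 1) = F (3 * j + 1) then 1 else 0)) +
      ((if E (2 * i) = F (3 * j + 2) then 1 else 0) +
        if E (2 * i + 1) = F (3 * j + 2) then 1 else 0)) / 2 := by
  have hx := hE.left_lt i i.2
  have hy := hE.right_lt i i.2
  have ha := hF.lt j j.2 0 (by norm_num)
  have hb := hF.lt j j.2 1 (by norm_num)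
  have hc := hF.lt j j.2 2 (by norm_num)
  have he := hE.edge i
  have ht := hF.tri j
  have hcard := (N.edge i).2.2
  have hcard' := (N.tri j).2.2
  rw [boundaryMatrix_apply]
  rw [he] at hcard ⊢
  rw [ht] at hcard' ⊢
  rw [add_zero] at ha ⊢
  generalize E (2 * i) = x at *
  generalize E (2 * i + 1) = y at *
  generalize F (3 * j) = a at *
  generalize F (3 * j + 1) = b at *
  generalize F (3 * j + 2) = c at *
  have heq : ∀ {p q}, p < N.n₀ → q < N.n₀ → (ν p = ν q ↔ p = q) := fun hp hq =>
    ⟨hE.inj hp hq, fun h => by rw [h]⟩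
  have hxy : x ≠ y := by rintro rfl; simp at hcard
  have hab : a ≠ b := by
    rintro rfl
    rw [Finset.insert_eq_of_mem (by simp)] at hcard'
    have := Finset.card_le_two (a := ν a) (b := ν c)
    omega
  have hac : a ≠ c := by
    rintro rfl
    rw [Finset.insert_eq_of_mem (by simp)] at hcard'
    have := Finset.card_le_two (a := ν b) (b := ν a)
    omega
  have hbc : b ≠ c := by
    rintro rfl
    rw [Finset.pair_eq_singleton] at hcard'
    have := Finset.card_le_two (a := ν a) (b := ν b)
    omega
  have hiff : (({ν x, ν y} : Finset V) ⊆ {ν a, ν b, ν c}) ↔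
      (x = a ∨ x = b ∨ x = c) ∧ (y = a ∨ y = b ∨ y = c) := by
    simp only [Finset.insert_subset_iff, Finset.singleton_subset_iff, Finset.mem_insert,
      Finset.mem_singleton, heq hx ha, heq hx hb, heq hx hc, heq hy ha, heq hy hb, heq hy hc]
  by_cases h : (x = a ∨ x = b ∨ x = c) ∧ (y = a ∨ y = b ∨ y = c)
  · rw [if_pos (hiff.2 h)]
    change 1 = _
    split_ifs <;> omega
  · rw [if_neg (mt hiff.1 h)]
    change 0 = _
    split_ifs <;> omega

theorem Does.addIncidence {c : ℕ} (hc : c < 3) (hw : Big w M) {E F : ℕ → ℕ}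
    (hE : EdgeList N ν E) (hF : TriangleList N ν F) (h0 : N.n₀ + 4 ≤ M) (h1 : N.n₁ ≤ m)
    (h2 : N.n₂ ≤ m) (hm : (m + m) * (m + m) ≤ M)
    (hv1 : σ.var 1 = N.n₁) (hv2 : σ.var 2 = N.n₂) (hv4 : σ.var 4 = m)
    (hσE : σ.arr 0 = E) (hσF : σ.arr 1 = F) (W : ℕ → ℕ → ℕ)
    (hW : ∀ i < N.n₁, ∀ j < N.n₂, σ.arr 6 (i * (m + m) + j) = W i j ∧ W i j ≤ 4) {Q : State → Prop}
    (hQ : ∀ arr : ℕ → ℕ → ℕ, (∀ β ≠ 6, arr β = σ.arr β) →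
      (∀ i < N.n₁, ∀ j < N.n₂, arr 6 (i * (m + m) + j) = W i j +
        ((if E (2 * i) = F (3 * j + c) then 1 else 0) +
          if E (2 * i + 1) = F (3 * j + c) then 1 else 0)) →
      (∀ x, (∀ i < N.n₁, ∀ j < N.n₂, x ≠ i * (m + m) + j) → arr 6 x = σ.arr 6 x) →
      Q ⟨σ.var, arr⟩) :
    Does w P 20 (addIncidenceCmd c) σ (1000 * (m * m + 1)) Q := by
  have h2M : m + m ≤ M := by nlinarith
  have h3M : 3 * N.n₂ ≤ M := by nlinarith
  have hle : N.n₁ * N.n₂ ≤ m * m := Nat.mul_le_mul h1 h2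
  have hinj : ∀ i < N.n₁, ∀ j < N.n₂, ∀ i' < N.n₁, ∀ j' < N.n₂,
      i * (m + m) + j = i' * (m + m) + j' → i = i' ∧ j = j' :=
    fun i _ j hj i' _ j' hj' he => pair_inj (by omega) (by omega) he
  refine Does.le (B := 1000 * (N.n₁ * N.n₂ + 1)) ?_ (by omega)
  refine .fill hw rfl rfl rfl rfl rfl (m := N.n₁) (n := N.n₂) ?_ ?_ ?_ ?_ ?_ ?_
    (fun i j => i * (m + m) + j) (fun i j => W i j +
        ((if E (2 * i) = F (3 * j + c) then 1 else 0) +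
          if E (2 * i + 1) = F (3 * j + c) then 1 else 0)) hinj ?_ hQ
  · simp [hv1]; omega
  · simp [hv2]; omega
  · simp [hv1]
  · simp [hv2]
  · omega
  · nlinarith
  · intro i hi j hj s hs h20 h21 hA hB
    have e0 : s.arr 0 = E := by rw [hA 0 (by norm_num), hσE]
    have e1 : s.arr 1 = F := by rw [hA 1 (by norm_num), hσF]
    have e6 : s.arr 6 (i * (m + m) + j) = W i j := by
      rw [hB, (hW i hi j hj).1]
      intro i' hi' j' hj' hlt he
      obtain ⟨rfl, rfl⟩ := hinj _ hi _ hj _ hi' _ hj' he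
      omega
    have a1 := hE.left_lt i hi
    have a2 := hE.right_lt i hi
    have a3 := hF.lt j hj c hc
    have a4 := (hW i hi j hj).2
    have ec : ∀ s, (const c : AExp).eval s = c := fun _ => rfl
    have fc : ∀ s, (const c : AExp).Fine M s ↔ c ≤ M := fun _ => Iff.rfl
    simp only [fine_add, fine_mul, fine_var, fine_get, fine_isEq, fine_ofNat, fine_one,
      eval_add, eval_mul, eval_var, eval_get, eval_isEq, eval_ofNat, eval_one, ec, fc,
      hs 4, Nat.reduceLT, h20, h21, e0, e1, e6, hv4]
    exact ⟨by omega, by omega, by trivial, by trivial⟩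

/-- The complete array of `m` rows of length `2 m` is cleared first, because the memory is
uninitialized; this produces the zero padding and makes the half reserved for `U` consist of bits.
-/
theorem Does.prepare (hw : Big w M) (hE : EdgeList N ν (σ.arr 0)) (hF : TriangleList N ν (σ.arr 1))
    {s : Fin k → Simplex K 1} (hS : SentinelData N T s σ.arr) (h0 : N.n₀ + 4 ≤ M) (h1 : N.n₁ ≤ m)
    (h2 : N.n₂ + k ≤ m) (hm0 : 0 < m) (hm : (m + m) * (m + m) ≤ M)
    (hv1 : σ.var 1 = N.n₁) (hv2 : σ.var 2 = N.n₂) (hv4 : σ.var 4 = m) (hv5 : σ.var 5 = k)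
    {Q : State → Prop}
    (hQ : ∀ arr : ℕ → ℕ → ℕ, (∀ β, β ≠ 6 → β ≠ 8 → arr β = σ.arr β) → BitMatrix arr m →
      (∀ (i : Fin N.n₁) (j : Fin (N.n₂ + k)),
        entry arr m i j = cycleMatrix N.tri T s (N.edge i) j) →
      (∀ i < m, N.n₁ ≤ i → ∀ j < N.n₂ + k, entry arr m i j = 0) →
      (∀ i < m, arr 8 (i + 1) = 0) → Q ⟨σ.var, arr⟩) :
    Does w P 20 prepareCmd σ (9000 * (m * m + 1)) Q := by
  have h2M : m + m ≤ M := by nlinarith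
  have h3M : 4 * m ≤ M := by nlinarith
  have hM4 : 4 ≤ M := by nlinarith
  have hmm : m * m ≤ M := by nlinarith
  have hmm' : m * (m + m) ≤ M := by nlinarith
  have h2m : m * (m + m) = 2 * (m * m) := by ring
  have hm1 : m ≤ m * m := by nlinarith
  have hle : N.n₁ * N.n₂ ≤ m * m := Nat.mul_le_mul h1 (by omega)
  have hle' : N.n₁ * k ≤ m * m := Nat.mul_le_mul h1 (by omega)
  have hinj : ∀ i < N.n₁, ∀ j < N.n₂, ∀ i' < N.n₁, ∀ j' < N.n₂,
      i * (m + m) + j = i' * (m + m) + j' → i = i' ∧ j = j' :=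
    fun i _ j hj i' _ j' hj' he => pair_inj (by omega) (by omega) he
  refine Does.le (B := 1000 * (m * (m + m) + 1) + (1000 * (m * m + 1) + (1000 * (m * m + 1) +
    (1000 * (m * m + 1) + (1000 * (N.n₁ * N.n₂ + 1) + (1000 * (N.n₁ * k + 1) +
      1000 * (1 * (m + 1) + 1))))))) ?_ (by omega)
  -- clear the matrix
  refine .seq (.fill hw rfl rfl rfl rfl rfl (m := m) (n := m + m) ?_ ?_ ?_ ?_ h2M hmm'
    (fun i j => i * (m + m) + j) (fun i j => 0)
    (fun i _ j hj i' _ j' hj' he => pair_inj hj hj' he) ?_ ?_)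
  · simp [hv4]; omega
  · simp [hv4]; omega
  · simp [hv4]
  · simp [hv4]
  · intro i hi j hj s hs h20 h21 hA hB
    have : i ≤ M := by omega
    simp only [fine_add, fine_mul, fine_var, fine_zero, eval_add, eval_mul, eval_var, eval_zero,
      hs 4, Nat.reduceLT, h20, h21, hv4]
    exact ⟨by omega, by trivial, by trivial, by trivial⟩
  intro a₁ f1 z1 _
  -- the boundary matrix
  refine .seq (.addIncidence (σ := ⟨σ.var, a₁⟩) (c := 0) (by norm_num) hw hE hF h0 h1 (by omega) hm hv1 hv2 hv4
    (f1 0 (by norm_num)) (f1 1 (by norm_num)) (fun _ _ => 0)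
    (fun i hi j hj => ⟨z1 i (by omega) j (by omega), by norm_num⟩) ?_)
  intro a₂ f2 z2 y2
  refine .seq (.addIncidence (σ := ⟨σ.var, a₂⟩) (c := 1) (by norm_num) hw hE hF h0 h1 (by omega) hm hv1 hv2 hv4
    ((f2 0 (by norm_num)).trans (f1 0 (by norm_num)))
    ((f2 1 (by norm_num)).trans (f1 1 (by norm_num))) _
    (fun i hi j hj => ⟨z2 i hi j hj, by split_ifs <;> norm_num⟩) ?_)
  intro a₃ f3 z3 y3
  refine .seq (.addIncidence (σ := ⟨σ.var, a₃⟩) (c := 2) (by norm_num) hw hE hF h0 h1 (by omega) hm hv1 hv2 hv4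
    ((f3 0 (by norm_num)).trans ((f2 0 (by norm_num)).trans (f1 0 (by norm_num))))
    ((f3 1 (by norm_num)).trans ((f2 1 (by norm_num)).trans (f1 1 (by norm_num)))) _
    (fun i hi j hj => ⟨z3 i hi j hj, by split_ifs <;> norm_num⟩) ?_)
  intro a₄ f4 z4 y4
  dsimp only at f2 y2 f3 y3 f4 y4
  have hb : ∀ i (hi : i < N.n₁) j (hj : j < N.n₂), a₄ 6 (i * (m + m) + j) / 2 =
      (boundaryMatrix K 1 (N.edge ⟨i, hi⟩) (N.tri ⟨j, hj⟩)).val := fun i hi j hj => by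
    rw [z4 i hi j hj, boundaryMatrix_edge_tri hE hF, zero_add]
  refine .seq (.fill hw rfl rfl rfl rfl rfl (m := N.n₁) (n := N.n₂) ?_ ?_ ?_ ?_ (by omega) (by omega)
    (fun i j => i * (m + m) + j) (fun i j => a₄ 6 (i * (m + m) + j) / 2) hinj ?_ ?_)
  · simp [hv1]; omega
  · simp [hv2]; omega
  · simp [hv1]
  · simp [hv2]
  · intro i hi j hj s hs h20 h21 hA hB
    have e6 : s.arr 6 (i * (m + m) + j) = a₄ 6 (i * (m + m) + j) := by
      rw [hB]
      intro i' hi' j' hj' hlt he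
      obtain ⟨rfl, rfl⟩ := hinj _ hi _ hj _ hi' _ hj' he
      omega
    have hl : a₄ 6 (i * (m + m) + j) < 4 := by
      have h1 := hb i hi j hj
      have h2 := ZMod.val_lt (boundaryMatrix K 1 (N.edge ⟨i, hi⟩) (N.tri ⟨j, hj⟩))
      omega
    simp only [fine_add, fine_mul, fine_var, fine_get, fine_div, fine_ofNat, eval_add, eval_mul,
      eval_var, eval_get, eval_div, eval_ofNat,
      hs 4, Nat.reduceLT, h20, h21, hv4, e6]
    exact ⟨by omega, by omega, by trivial, by trivial⟩
  intro a₅ f5 z5 y5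
  -- the sentinel cycles
  have e3 : a₅ 3 = σ.arr 3 := by
    rw [f5 3 (by norm_num)]
    exact (f4 3 (by norm_num)).trans ((f3 3 (by norm_num)).trans ((f2 3 (by norm_num)).trans
      (f1 3 (by norm_num))))
  refine .seq (.fill hw rfl rfl rfl rfl rfl (m := N.n₁) (n := k) ?_ ?_ ?_ ?_ (by omega) (by omega)
    (fun i j => i * (m + m) + (N.n₂ + j)) (fun i j => σ.arr 3 (i * k + j))
    (fun i _ j hj i' _ j' hj' he => ?_) ?_ ?_)
  · simp [hv1]; omega
  · simp [hv5]; omega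
  · simp [hv1]
  · simp [hv5]
  · have := pair_inj (by omega) (by omega) he
    omega
  · intro i hi j hj s' hs h20 h21 hA hB
    have hl : σ.arr 3 (i * k + j) < 2 := by
      rw [hS.matrix ⟨i, hi⟩ ⟨j, hj⟩]; exact ZMod.val_lt _
    have e : s'.arr 3 = σ.arr 3 := (hA 3 (by norm_num)).trans e3
    simp only [fine_add, fine_mul, fine_var, fine_get, eval_add, eval_mul,
      eval_var, eval_get, hs 4, hs 2, hs 5, Nat.reduceLT, h20, h21, hv4, hv2, hv5, e]
    exact ⟨by omega, by omega, by trivial, by trivial⟩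
  intro a₆ f6 z6 y6
  -- the marks of the rows
  refine .fill hw rfl rfl rfl rfl rfl (m := 1) (n := m + 1) ?_ ?_ ?_ ?_ (by omega) (by omega)
    (fun i j => j) (fun i j => 0) (by omega) ?_ ?_
  · simp; omega
  · simp [hv4]; omega
  · simp
  · simp [hv4]
  · intro i hi j hj s hs h20 h21 hA hB
    simp only [fine_var, fine_zero, eval_var, eval_zero, h21]
    exact ⟨by omega, by trivial, by trivial, by trivial⟩
  intro a₇ f7 z7 y7
  dsimp only at f5 y5 f6 y6 f7
  have e6 : a₇ 6 = a₆ 6 := f7 6 (by norm_num)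
  have hB : ∀ i (hi : i < N.n₁) j (hj : j < N.n₂), a₇ 6 (i * (m + m) + j) =
      (boundaryMatrix K 1 (N.edge ⟨i, hi⟩) (N.tri ⟨j, hj⟩)).val := fun i hi j hj => by
    rw [e6, y6, z5 i hi j hj, hb i hi j hj]
    intro i' hi' j' hj' he
    have := (pair_inj (by omega) (by omega) he).2
    omega
  have hZ : ∀ i (hi : i < N.n₁) j (hj : j < k), a₇ 6 (i * (m + m) + (N.n₂ + j)) =
      (sentinelCycle T (s ⟨j, hj⟩) (N.edge ⟨i, hi⟩)).val := fun i hi j hj => by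
    rw [e6, z6 i hi j hj]
    exact hS.matrix ⟨i, hi⟩ ⟨j, hj⟩
  have hO : ∀ i < m, ∀ j < m + m, ¬ (i < N.n₁ ∧ j < N.n₂ + k) → a₇ 6 (i * (m + m) + j) = 0 := by
    intro i hi j hj hn
    have hne : ∀ d, ∀ i' < N.n₁, ∀ j' < d, d ≤ N.n₂ → i * (m + m) + j ≠ i' * (m + m) + j' :=
      fun d i' hi' j' hj' hd he => by
        obtain ⟨rfl, rfl⟩ := pair_inj hj (by omega) he
        omega
    rw [e6, y6, y5, y4, y3, y2, z1 i hi j hj]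
    · exact fun i' hi' j' hj' => hne _ i' hi' j' hj' le_rfl
    · exact fun i' hi' j' hj' => hne _ i' hi' j' hj' le_rfl
    · exact fun i' hi' j' hj' => hne _ i' hi' j' hj' le_rfl
    · exact fun i' hi' j' hj' => hne _ i' hi' j' hj' le_rfl
    · intro i' hi' j' hj' he
      obtain ⟨rfl, rfl⟩ := pair_inj hj (by omega) he
      omega
  refine hQ a₇ (fun β h6 h8 => ?_) (fun i hi j hj => ?_) (fun i j => ?_)
    (fun i hi hi' j hj => ?_) fun i hi => ?_
  · rw [f7 β h8, f6 β h6, f5 β h6, f4 β h6, f3 β h6, f2 β h6, f1 β h6]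
  · by_cases h : i < N.n₁ ∧ j < N.n₂ + k
    · rcases lt_or_ge j N.n₂ with h' | h'
      · rw [hB i h.1 j h']; exact Nat.lt_succ_iff.1 (ZMod.val_lt _)
      · obtain ⟨j', rfl⟩ := Nat.exists_eq_add_of_le h'
        rw [hZ i h.1 j' (by omega)]; exact Nat.lt_succ_iff.1 (ZMod.val_lt _)
    · rw [hO i hi j hj h]; norm_num
  · refine Fin.addCases (fun j => ?_) (fun j => ?_) j
    · have e1 := congrFun (cycleMatrix_col_castAdd (tri := N.tri) (T := T) (s := s) j) (N.edge i)
      rw [Matrix.col_apply] at e1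
      rw [e1, entry, Fin.val_castAdd, hB i i.2 j j.2, ZMod.natCast_val, ZMod.cast_id]
      rfl
    · have e1 := congrFun (cycleMatrix_col_natAdd (tri := N.tri) (T := T) (s := s) j) (N.edge i)
      rw [Matrix.col_apply] at e1
      rw [e1, entry, Fin.val_natAdd, hZ i i.2 j j.2, ZMod.natCast_val, ZMod.cast_id]
  · rw [entry, hO i hi j (by omega) (by omega), Nat.cast_zero]
  · exact z7 0 (by norm_num) (i + 1) (by omega)

end

/-! ### The program for the earliest basis and the annotation -/

section
open AExp

/-- Eliminate, list the pivots in array `4` and put the annotations into array `5`. -/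
def annotateCmd : Cmd :=
  .seq (assign 7 0) <|
  .seq (.call 6 1 [7, 4, 4]) <|
  .seq (collect 4 8 (var 2 + var 5) (isPos (get 7 (var 21)))) <|
  .seq (assign 9 0) <|
  .seq (fold 9 (var 2) (var 9 + isPos (get 7 (var 21)))) <|
  .seq (assign 10 (var 8 - var 9)) <|
  .seq (fill 5 (var 1) (var 10) (var 20 * var 10 + var 21) 0) <|
  .seq (fill 5 (var 5) (var 10) (get 2 (var 20) * var 10 + var 21)
    (get 6 ((get 7 (get 4 (var 9 + var 21)) - 1) * (var 4 + var 4) + (var 2 + var 20)))) <|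
  .seq (assign 0 (var 5)) <|
  .seq (assign 1 (var 9)) <|
  assign 2 (var 10)

variable {V : Type*} [DecidableEq V] [Finite V] {K : AbstractSimplicialComplex V} {N : Numbering K}
  {T : SimpleGraph V} {w M k m c L : ℕ} {P P' : Program} {τ : ℕ → ℕ} {σ : State}

/-- No linear system is solved separately: the solution for the `i`-th sentinel cycle is column `n₂
+ i` of the eliminated matrix, read in the pivot rows, and the annotation takes the rows belonging
to `H`. -/
theorem Does.annotate (hw : Big w M) (hP : ∀ p, P'.body (p + 3) = (P.body p).shift 3 16)
    (hP1 : P'.body 1 = eliminateCmd) (hP2 : P'.body 2 = applyBlockCmd)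
    (hM : Multiplies P c τ) (hmL : m = 2 ^ L) (hmw : (m + 2) ^ c ≤ 2 ^ w)
    (hmM : (m + m) * (m + m) ≤ M) {s : Fin k → Simplex K 1} (hT : IsSpanningTree K T)
    (hS : SentinelData N T s σ.arr) (h1 : N.n₁ ≤ m) (h2 : N.n₂ + k ≤ m) (hk : k ≤ N.n₁)
    (hbit : BitMatrix σ.arr m)
    (hA : ∀ (i : Fin N.n₁) (j : Fin (N.n₂ + k)),
      entry σ.arr m i j = cycleMatrix N.tri T s (N.edge i) j)
    (hA0 : ∀ i < m, N.n₁ ≤ i → ∀ j < N.n₂ + k, entry σ.arr m i j = 0)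
    (hu : ∀ i < m, σ.arr 8 (i + 1) = 0)
    (hv1 : σ.var 1 = N.n₁) (hv2 : σ.var 2 = N.n₂) (hv4 : σ.var 4 = m) (hv5 : σ.var 5 = k) :
    Does w P' 20 annotateCmd σ (eliminateTime τ L L + 7000 * (m * m + 1)) fun st =>
      ∃ (b g : ℕ) (ι : Fin (b + g) → Fin (N.n₂ + k)) (a : Simplex K 1 → Fin g → ZMod 2),
        IsThreeStepResult K N.tri T s ι a ∧ IsOutput N T s ι a st := by
  have hm0 : 0 < m := by rw [hmL]; positivity
  have h2M : m + m ≤ M := by nlinarith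
  have h3M : 4 * m ≤ M := by nlinarith
  have hM4 : 4 ≤ M := by nlinarith
  have hmm : m * m ≤ M := by nlinarith
  have hm1 : m ≤ m * m := by nlinarith
  set B : ℕ := 1000 * (m * m + 1) with hB
  refine Does.le (B := 110 + ((eliminateTime τ L L + 3 + 1) + (B + (110 + (B + (110 + (B + (B +
    (110 + (110 + 110)))))))))) ?_ (by omega)
  refine .seq (.assign hw (by norm_num) (by norm_num) rfl (by simp) ?_)
  refine .seq (.call (args := [7, 4, 4]) (by norm_num) (by simp) ?_)
  rw [DoesProc, hP1]
  refine Does.mono (.eliminate (m := m) (lo := 0) hw hP hP1 hP2 hM hmL hmw hmM L le_rfl _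
    (by omega) ?_ ?_ ?_ ?_ ?_) le_rfl ?_
  · simp [frame, State.setVar_var]
  · simp [frame, State.setVar_var, hv4, hmL]
  · simp [frame, State.setVar_var, hv4]
  · exact hbit
  · intro i hi
    show σ.arr 8 (i + 1) ≤ 1
    rw [hu i hi]; norm_num
  rw [← hmL]
  intro s₁ hR
  have hR : Reduced m 0 m σ.arr s₁.arr := hR
  set a' := s₁.arr with ha'
  set σ₁ : State := ⟨Function.update (σ.setVar 7 (eval σ 0)).var 6 (s₁.var 0), a'⟩ with hσ₁
  have v1 : σ₁.var 1 = N.n₁ := by simp [hσ₁, State.setVar_var, hv1]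
  have v2 : σ₁.var 2 = N.n₂ := by simp [hσ₁, State.setVar_var, hv2]
  have v4 : σ₁.var 4 = m := by simp [hσ₁, State.setVar_var, hv4]
  have v5 : σ₁.var 5 = k := by simp [hσ₁, State.setVar_var, hv5]
  have hA1 : σ₁.arr = a' := rfl
  change Does w P' 20 _ σ₁ _ _
  -- the numbers of columns in the basis
  set p : ℕ → Prop := fun q => a' 7 q ≠ 0 with hp
  -- The number of pivots among the triangle columns; `rank_left` identifies it with `rank ∂₂` at
  -- the end.
  set b := Nat.count p N.n₂ with hb
  obtain ⟨g, hg⟩ := Nat.exists_eq_add_of_le (Nat.count_monotone p (Nat.le_add_right N.n₂ k))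
  rw [← hb] at hg
  obtain ⟨ι, hι, hιp, hιs⟩ : ∃ ι : Fin (b + g) → Fin (N.n₂ + k), StrictMono ι ∧
      (∀ i, p (ι i) ∧ Nat.count p (ι i) = i) ∧ ∀ q : Fin (N.n₂ + k), p q → ∃ i, ι i = q := by
    rw [← hg]; exact exists_enumeration p (N.n₂ + k)
  obtain ⟨hgr, hco⟩ := hR.isGreedyBasis N.edge (cycleMatrix N.tri T s) h2 h1 hA hA0 hu hι
    (fun i => (hιp i).1) hιs
  have hbg : b + g ≤ m := by rw [← hg]; exact (Nat.count_le _).trans h2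
  have hpiv : ∀ j < m, a' 7 j ≤ m := fun j hj => hR.piv_le j (by omega) (by omega)
  have hcost : ∀ x y, x ≤ m → y ≤ m → 1000 * (x * y + 1) ≤ B := fun x y hx hy => by
    have := Nat.mul_le_mul hx hy
    omega
  refine .seq (.le (.collect (N := N.n₂ + k) hw (by norm_num) rfl rfl ?_ ?_ (by omega) p ?_ ?_)
    (by omega))
  · simp [v2, v5]; omega
  · simp [v2, v5]
  · intro q hq s hs h21 hA'
    have e7 : s.arr 7 = a' 7 := hA' 7 (by norm_num)
    have := hpiv q (by omega)
    simp only [fine_isPos, fine_get, fine_var, eval_isPos, eval_get, eval_var, h21, e7, hp]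
    refine ⟨by omega, ?_⟩
    split_ifs <;> simp_all
  intro a₂ f2 z2
  rw [hg]
  have l4 : ∀ j : Fin (b + g), a₂ 4 j = ι j := fun j => by
    have := z2 (ι j) (ι j).2 (hιp j).1
    rwa [(hιp j).2] at this
  have e7 : a₂ 7 = a' 7 := f2 7 (by norm_num)
  refine .seq (.assign hw (by norm_num) (by norm_num) rfl (by simp) ?_)
  rw [eval_zero]
  refine .seq (.le (.fold hw (by norm_num) rfl rfl (N := N.n₂) ?_ ?_ (by omega)
    (fun q => Nat.count p q) ?_ ?_ ?_) (by omega))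
  · simp [State.setVar_var, v2]; omega
  · simp [State.setVar_var, v2]
  · simp [State.setVar_var]
  · intro q hq s hs h9 h21 harr
    have e : s.arr 7 = a' 7 := by rw [harr]; exact e7
    have := hpiv q (by omega)
    have hc := Nat.count_le (p := p) (n := q)
    simp only [fine_add, fine_isPos, fine_get, fine_var, eval_add, eval_isPos, eval_get, eval_var,
      h21, e, h9, Nat.count_succ, hp] at hc ⊢
    refine ⟨by omega, ?_⟩
    split_ifs <;> simp_all
  rw [← hb]
  refine .seq (.assign hw (by norm_num) (by norm_num) rfl
    (by simp [State.setVar_var]; omega) ?_)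
  simp only [eval_sub, eval_var]
  set σ₃ := ((State.setVar ⟨Function.update σ₁.var 8 (b + g), a₂⟩ 9 0).setVar 9 b) with hσ₃
  have e₃ : σ₃.setVar 10 (σ₃.var 8 - σ₃.var 9) = σ₃.setVar 10 g := by
    simp [hσ₃, State.setVar_var]
  rw [e₃]
  set σ₄ := σ₃.setVar 10 g with hσ₄
  have u1 : σ₄.var 1 = N.n₁ := by simp [hσ₄, hσ₃, State.setVar_var, v1]
  have u2 : σ₄.var 2 = N.n₂ := by simp [hσ₄, hσ₃, State.setVar_var, v2]
  have u4 : σ₄.var 4 = m := by simp [hσ₄, hσ₃, State.setVar_var, v4]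
  have u5 : σ₄.var 5 = k := by simp [hσ₄, hσ₃, State.setVar_var, v5]
  have u9 : σ₄.var 9 = b := by simp [hσ₄, hσ₃, State.setVar_var]
  have u10 : σ₄.var 10 = g := by simp [hσ₄, State.setVar_var]
  have hA4 : σ₄.arr = a₂ := rfl
  have hgm : g ≤ m := by omega
  have hNg : N.n₁ * g ≤ m * m := Nat.mul_le_mul h1 hgm
  have hkg : k * g ≤ m * m := Nat.mul_le_mul (by omega) hgm
  refine .seq (.le (.fill (m := N.n₁) (n := g) hw rfl rfl rfl rfl rfl ?_ ?_ ?_ ?_ (by omega)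
    (by omega) (fun i j => i * g + j) (fun i j => 0)
    (fun i _ j hj i' _ j' hj' he => pair_inj hj hj' he) ?_ ?_) (hcost _ _ h1 hgm))
  · simp [u1]; omega
  · simp [u10]; omega
  · simp [u1]
  · simp [u10]
  · intro i hi j hj s hs h20 h21 hA hB
    simp only [fine_add, fine_mul, fine_var, fine_zero, eval_add, eval_mul, eval_var, eval_zero,
      hs 10, Nat.reduceLT, h20, h21, u10]
    exact ⟨by omega, by trivial, by trivial, by trivial⟩
  intro a₅ f5 z5 _
  have e2 : ∀ i : Fin k, a₅ 2 i = N.edge.symm (s i) := fun i => by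
    rw [f5 2 (by norm_num), hA4, f2 2 (by norm_num), ← hS.list i]
    exact congrFun (hR.frame 2 (by norm_num) (by norm_num) (by norm_num) (by norm_num)
      (by norm_num)) _
  -- The rows of array `5` are addressed through the list of sentinel edges, so distinctness of
  -- these edges is needed to keep the writes apart.
  have hsinj : ∀ i i' : Fin k, (N.edge.symm (s i) : ℕ) = N.edge.symm (s i') → i = i' :=
    fun i i' h => hS.injective (N.edge.symm.injective (Fin.ext h))
  refine .seq (.le (.fill (m := k) (n := g) hw rfl rfl rfl rfl rfl ?_ ?_ ?_ ?_ (by omega)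
    (by omega) (fun i j => a₅ 2 i * g + j)
    (fun i j => a' 6 ((a' 7 (a₂ 4 (b + j)) - 1) * (m + m) + (N.n₂ + i)))
    (fun i hi j hj i' hi' j' hj' he => ?_) ?_ ?_) (hcost _ _ (by omega) hgm))
  · simp [u5]; omega
  · simp [u10]; omega
  · simp [u5]
  · simp [u10]
  · obtain ⟨h3, h4⟩ := pair_inj hj hj' he
    rw [e2 ⟨i, hi⟩, e2 ⟨i', hi'⟩] at h3
    exact ⟨congrArg Fin.val (hsinj _ _ h3), h4⟩
  · intro i hi j hj s' hs h20 h21 hA hB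
    have g2 : s'.arr 2 = a₅ 2 := hA 2 (by norm_num)
    have g4 : s'.arr 4 = a₂ 4 := (hA 4 (by norm_num)).trans (f5 4 (by norm_num))
    have g6 : s'.arr 6 = a' 6 :=
      (hA 6 (by norm_num)).trans ((f5 6 (by norm_num)).trans (f2 6 (by norm_num)))
    have g7 : s'.arr 7 = a' 7 :=
      (hA 7 (by norm_num)).trans ((f5 7 (by norm_num)).trans e7)
    have l2 : a₅ 2 i < N.n₁ := by rw [e2 ⟨i, hi⟩]; exact (N.edge.symm (s ⟨i, hi⟩)).2
    have hj' : a₂ 4 (b + j) = ι ⟨b + j, by omega⟩ := l4 ⟨b + j, by omega⟩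
    have l4' : a₂ 4 (b + j) < m := by rw [hj']; have := (ι ⟨b + j, by omega⟩).2; omega
    have l7 := hpiv _ l4'
    have l6 := hR.bits (a' 7 (a₂ 4 (b + j)) - 1) (by omega) (N.n₂ + i) (by omega)
    simp only [fine_add, fine_mul, fine_var, fine_get, fine_sub, fine_one, eval_add, eval_mul,
      eval_var, eval_get, eval_sub, eval_one,
      hs 2, hs 4, hs 9, hs 10, Nat.reduceLT, h20, h21, u2, u4, u9, u10, g2, g4, g6, g7]
    exact ⟨by omega, by omega, by trivial, by trivial⟩
  intro a₆ f6 z6 y6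
  dsimp only at f6 y6
  refine .seq (.assign hw (by norm_num) (by norm_num) rfl (by simp [u5]; omega) ?_)
  refine .seq (.assign hw (by norm_num) (by norm_num) rfl (by simp [State.setVar_var, u9]; omega) ?_)
  refine .assign hw (by norm_num) (by norm_num) rfl (by simp [State.setVar_var, u10]; omega) ?_
  have hval : ∀ (i : Fin k) (j : Fin g), a₆ 5 (N.edge.symm (s i) * g + j) =
      a' 6 ((a' 7 (ι (Fin.natAdd b j)) - 1) * (m + m) + (N.n₂ + i)) := fun i j => by
    have := z6 i i.2 j j.2
    rw [e2 i] at this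
    rw [this]
    congr 4
    exact congrArg _ (l4 (Fin.natAdd b j))
  have hrow : ∀ i, a' 7 (ι i) - 1 < m := fun i => by
    have h3 := hpiv (ι i) (by have := (ι i).2; omega)
    have h4 : a' 7 (ι i) ≠ 0 := (hιp i).1
    omega
  have hzero : ∀ (e : Fin N.n₁) (j : Fin g), (∀ i, s i ≠ N.edge e) → a₆ 5 (e * g + j) = 0 := by
    intro e j hne
    rw [y6]
    · exact z5 e e.2 j j.2
    · intro i hi j' hj' he
      have := (pair_inj j.2 hj' he).1
      rw [e2 ⟨i, hi⟩] at this
      refine hne ⟨i, hi⟩ ?_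
      rw [Fin.ext this, Equiv.apply_symm_apply]
  have hmem : ∀ e, (∀ i, s i ≠ e) ↔ InTree T e := fun e => by
    have : e ∈ Set.range s ↔ ¬ InTree T e := by rw [hS.range]; rfl
    rw [← not_iff_not, ← this]
    simp
  have hle : ∀ (e : Fin N.n₁) (j : Fin g), a₆ 5 (e * g + j) ≤ 1 := by
    intro e j
    by_cases h : ∀ i, s i ≠ N.edge e
    · rw [hzero e j h]; norm_num
    · push Not at h
      obtain ⟨i, hi⟩ := h
      have := hval i j
      rw [hi, Equiv.symm_apply_apply] at this
      rw [this]
      exact hR.bits _ (hrow _) _ (by have := i.2; omega)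
  refine ⟨b, g, ι, fun e j => (a₆ 5 (N.edge.symm e * g + j) : ZMod 2), ?_, ?_⟩
  · refine ⟨hT, hS.injective, hS.range, ?_, hgr.isEarliestBasis, fun i => ?_, fun e he => ?_⟩
    · rw [← rank_cycleMatrix_left (tri := N.tri) (T := T) (s := s)]
      refine hgr.rank_left (Nat.le_add_right b g) fun i => ?_
      have h3 := hιp i
      constructor
      · intro h
        rw [← h3.2]; exact Nat.count_strict_mono h3.1 h
      · intro h
        by_contra hle
        have := Nat.count_monotone p (not_lt.1 hle)
        omega
    · refine ⟨fun l => entry a' m (a' 7 (ι l) - 1) (Fin.natAdd N.n₂ i), ?_, ?_⟩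
      · rw [← cycleMatrix_col_natAdd (tri := N.tri) (T := T) (s := s) i, hco]
        funext e
        simp only [Matrix.mulVec, dotProduct, Matrix.submatrix_apply, id, Finset.sum_apply,
          Pi.smul_apply, Matrix.col_apply, smul_eq_mul]
        exact Finset.sum_congr rfl fun l _ => mul_comm _ _
      · funext j
        rw [hval i j]; rfl
    · funext j
      obtain ⟨e, rfl⟩ := N.edge.surjective e
      rw [Equiv.symm_apply_apply, hzero e j ((hmem _).2 he), Nat.cast_zero]; rfl
  · refine ⟨by simp [State.setVar_var, u5], by simp [State.setVar_var, u9],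
      by simp [State.setVar_var, u10], fun i => ?_, fun i j => ?_, fun j => ?_, fun i j => ?_⟩
    · show a₆ 2 i = _
      rw [f6 2 (by norm_num), e2 i]
    · show a₆ 3 _ = _
      rw [f6 3 (by norm_num), f5 3 (by norm_num), hA4, f2 3 (by norm_num)]
      refine Eq.trans ?_ (hS.matrix i j)
      exact congrFun (hR.frame 3 (by norm_num) (by norm_num) (by norm_num) (by norm_num)
        (by norm_num)) _
    · show a₆ 4 j = _
      rw [f6 4 (by norm_num), f5 4 (by norm_num)]
      exact l4 j
    · show a₆ 5 _ = _
      rw [Matrix.of_apply]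
      show _ = ((a₆ 5 ((N.edge.symm (N.edge i) : ℕ) * g + j) : ℕ) : ZMod 2).val
      rw [Equiv.symm_apply_apply, val_natCast_of_le_one (hle i j)]

end

/-! ### The main program -/

section
open AExp

/-- The main procedure. -/
def mainCmd : Cmd :=
  .seq (assign 3 (var 0 + var 1 + var 2)) <|
  .seq (assign 4 1) <|
  .seq (fold 4 (var 3) (var 4 + isPos (var 3 - var 4) * var 4)) <|
  .seq growTreeCmd <|
  .seq sentinelCmd <|
  .seq prepareCmd annotateCmd

/-- The program that computes annotations, given a program for matrix multiplication. -/
def annotationProgram (P : Program) : Program :=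
  mainCmd :: eliminateCmd :: applyBlockCmd :: P.map (Cmd.shift 3 16)

theorem annotationProgram_body (P : Program) (p : ℕ) :
    (annotationProgram P).body (p + 3) = (P.body p).shift 3 16 :=
  List.getD_map P Cmd.skip (Cmd.shift 3 16)

/-- Doubling, starting with `1`, as long as the value is below `n`. -/
def doubling (n : ℕ) : ℕ → ℕ
  | 0 => 1
  | q + 1 => doubling n q + (if n - doubling n q = 0 then 0 else 1) * doubling n q

/-- Doubling happens only below `n`, which gives the bound `2 * n`. Until `n` is reached the value
exceeds the number of rounds, so `n` rounds suffice to find the size of the padding. -/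
theorem doubling_spec {n : ℕ} (hn : 0 < n) (q : ℕ) :
    (∃ L, doubling n q = 2 ^ L) ∧ doubling n q ≤ 2 * n ∧ (n ≤ doubling n q ∨ q < doubling n q) := by
  induction q with
  | zero => exact ⟨⟨0, rfl⟩, by simp only [doubling]; omega, by simp [doubling]⟩
  | succ q ih =>
    obtain ⟨⟨L, hL⟩, h1, h2⟩ := ih
    simp only [doubling]
    split_ifs with h
    · exact ⟨⟨L, by simpa using hL⟩, by omega, by omega⟩
    · refine ⟨⟨L + 1, by rw [hL, pow_succ]; ring⟩, by omega, by omega⟩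

variable {V : Type*} [DecidableEq V] [Finite V] {K : AbstractSimplicialComplex V} {N : Numbering K}
  {ν : ℕ → V} {w M c n : ℕ} {P P' : Program} {τ : ℕ → ℕ} {σ : State}

/-- There are at most `n₁` sentinel edges, so `[∂₂ | Z]` fits into a square of size `n₀ + n₁ + n₂`;
passing to a power of two enlarges this by a factor of at most `2`. -/
theorem Does.main (hw : Big w M) (hP : ∀ p, P'.body (p + 3) = (P.body p).shift 3 16)
    (hP1 : P'.body 1 = eliminateCmd) (hP2 : P'.body 2 = applyBlockCmd)
    (hM : Multiplies P c τ) (hE : EdgeList N ν (σ.arr 0)) (hF : TriangleList N ν (σ.arr 1))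
    (hK : (oneSkeleton K).Connected) (hn0 : 0 < N.n₀) (hn : N.n₀ + N.n₁ + N.n₂ = n)
    (hnM : 16 * (n * n) ≤ M) (hnw : (2 * n + 2) ^ c ≤ 2 ^ w)
    (hv0 : σ.var 0 = N.n₀) (hv1 : σ.var 1 = N.n₁) (hv2 : σ.var 2 = N.n₂) :
    ∃ L, 2 ^ L ≤ 2 * n ∧
    Does w P' 20 mainCmd σ (eliminateTime τ L L + 60000 * (2 ^ L * 2 ^ L + 1)) fun st =>
      ∃ (k b g : ℕ) (T : SimpleGraph V) (s : Fin k → Simplex K 1)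
        (ι : Fin (b + g) → Fin (N.n₂ + k)) (a : Simplex K 1 → Fin g → ZMod 2),
        IsThreeStepResult K N.tri T s ι a ∧ IsOutput N T s ι a st := by
  have hnpos : 0 < n := by omega
  obtain ⟨⟨L, hL⟩, hle, hge⟩ := doubling_spec hnpos n
  refine ⟨L, hL ▸ hle, ?_⟩
  set m := 2 ^ L with hm
  have hnm : n ≤ m := by omega
  have hm2 : m ≤ 2 * n := by omega
  have hmM : (m + m) * (m + m) ≤ M := by nlinarith
  have hmw : (m + 2) ^ c ≤ 2 ^ w := (Nat.pow_le_pow_left (by omega) c).trans hnw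
  have hnn : n ≤ n * n := by nlinarith
  have h01 : N.n₀ * N.n₁ ≤ n * n := Nat.mul_le_mul (by omega) (by omega)
  have h11 : N.n₁ * N.n₁ ≤ n * n := Nat.mul_le_mul (by omega) (by omega)
  set X := (m + 1) * (m + 1) with hX
  have hXm : X ≤ 4 * (m * m) := by nlinarith
  have hX1 : (N.n₀ + 1) * (N.n₁ + 1) ≤ X := Nat.mul_le_mul (by omega) (by omega)
  have hX2 : (N.n₁ + 1) * (N.n₁ + 1) ≤ X := Nat.mul_le_mul (by omega) (by omega)
  refine Does.le (B := 110 + (110 + (1000 * (n + 1) + (8000 * X + (2000 * X +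
    (9000 * (m * m + 1) + (eliminateTime τ L L + 7000 * (m * m + 1)))))))) ?_ (by nlinarith)
  refine .seq (.assign hw (by norm_num) (by norm_num) rfl (by simp [hv0, hv1, hv2]; omega) ?_)
  refine .seq (.assign hw (by norm_num) (by norm_num) rfl (by simp; omega) ?_)
  simp only [eval_add, eval_var, eval_one, hv0, hv1, hv2, hn]
  refine .seq (.fold hw (by norm_num) rfl rfl (N := n) ?_ ?_ (by omega) (doubling n) ?_ ?_ ?_)
  · simp [State.setVar_var]; omega
  · simp [State.setVar_var]
  · simp [State.setVar_var, doubling]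
  · intro q hq s hs h4 _ _
    have h3 : s.var 3 = n := by rw [hs 3 (by norm_num) (by norm_num)]; simp [State.setVar_var]
    have := (doubling_spec hnpos q).2.1
    simp only [fine_add, fine_mul, fine_var, fine_isPos, fine_sub, eval_add, eval_mul, eval_var,
      eval_isPos, eval_sub, h3, h4, doubling]
    exact ⟨by omega, by trivial⟩
  rw [hL]
  set σ₁ := ((σ.setVar 3 n).setVar 4 1).setVar 4 m with hσ₁
  have hA : σ₁.arr = σ.arr := rfl
  have k0 : σ₁.var 0 = N.n₀ := by simp [hσ₁, State.setVar_var, hv0]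
  have k1 : σ₁.var 1 = N.n₁ := by simp [hσ₁, State.setVar_var, hv1]
  have k2 : σ₁.var 2 = N.n₂ := by simp [hσ₁, State.setVar_var, hv2]
  have k4 : σ₁.var 4 = m := by simp [hσ₁, State.setVar_var]
  refine .seq' (.le (.growTree (N := N) (ν := ν) hw hE hK hn0 (by omega) (by omega) (by omega)
    k0 k1) (by omega)) ?_
  rintro σ₂ ⟨u, f, T, hT⟩
  have k1' : σ₂.var 1 = N.n₁ := by rw [u 1 (by norm_num), k1]
  have hE' : EdgeList N ν (σ₂.arr 0) := by rw [f 0 (by norm_num)]; exact hE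
  refine .seq' (.le (.sentinel (N := N) (ν := ν) hw hE' hT (by omega) (by omega) (by omega)
    (by omega) k1') (by omega)) ?_
  rintro σ₃ ⟨u', f', k, s, hk, hk5, hS⟩
  have hkn : N.n₂ + k ≤ m := by omega
  refine .seq (.prepare (N := N) (ν := ν) (T := T) (m := m) hw ?_ ?_ hS (by omega) (by omega) hkn
    (by omega) hmM ?_ ?_ ?_ hk5 ?_)
  · rw [f' 0 (by norm_num)]; exact hE'
  · rw [f' 1 (by norm_num), f 1 (by norm_num)]; exact hF
  · rw [u' 1 (by norm_num), k1']
  · rw [u' 2 (by norm_num), u 2 (by norm_num), k2]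
  · rw [u' 4 (by norm_num), u 4 (by norm_num), k4]
  intro arr g1 g2 g3 g4 g5
  refine Does.mono (.annotate (m := m) hw hP hP1 hP2 hM hm hmw hmM hT.tree (s := s) ?_ (by omega)
    hkn hk g2 g3 g4 g5 ?_ ?_ ?_ hk5) le_rfl fun st h => ?_
  · refine ⟨hS.injective, hS.range, fun i => ?_, fun i j => ?_⟩
    · show arr 2 i = _
      rw [g1 2 (by norm_num) (by norm_num)]; exact hS.list i
    · show arr 3 _ = _
      rw [g1 3 (by norm_num) (by norm_num)]; exact hS.matrix i j
  · exact (u' 1 (by norm_num)).trans k1'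
  · exact (u' 2 (by norm_num)).trans ((u 2 (by norm_num)).trans k2)
  · exact (u' 4 (by norm_num)).trans ((u 4 (by norm_num)).trans k4)
  · obtain ⟨b, g, ι, a, h1, h2⟩ := h
    exact ⟨k, b, g, T, s, ι, a, h1, h2⟩

end

/-! ### The running time -/

theorem two_pow_rpow (ω : ℝ) (l : ℕ) : ((2 ^ l : ℕ) : ℝ) ^ ω = ((2 : ℝ) ^ ω) ^ l := by
  push_cast
  rw [← Real.rpow_natCast, ← Real.rpow_natCast, ← Real.rpow_mul (by norm_num),
    ← Real.rpow_mul (by norm_num), mul_comm]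

/-- Copying a block costs `h ^ 2 ≤ h ^ ω` up to a constant, so the product dominates. With `h = 2 ^
l`, the `2 ^ (L - l)` blocks together cost `2 ^ L * (2 ^ ω / 2) ^ l`. -/
theorem applyTime_le {ω C : ℝ} (hω : 2 < ω) {τ : ℕ → ℕ}
    (hτ : ∀ n : ℕ, 0 < n → (τ n : ℝ) ≤ C * (n : ℝ) ^ ω) {l L : ℕ} (hl : l ≤ L) :
    (applyTime τ (2 ^ (L - l)) (2 ^ l) : ℝ) ≤ (12000 + C) * 2 ^ L * ((2 : ℝ) ^ ω / 2) ^ l := by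
  have h4 : (4 : ℝ) ≤ 2 ^ ω := by
    calc (4 : ℝ) = 2 ^ (2 : ℝ) := by norm_num
      _ ≤ 2 ^ ω := Real.rpow_le_rpow_of_exponent_le (by norm_num) hω.le
  set Q : ℝ := 2 ^ ω with hQ
  have h1 : (1 : ℝ) ≤ Q ^ l := one_le_pow₀ (by linarith)
  have h2 : (2 : ℝ) ^ l * 2 ^ l ≤ Q ^ l := by
    rw [← mul_pow]; exact pow_le_pow_left₀ (by norm_num) (by norm_num; exact h4) l
  have hτl : (τ (2 ^ l) : ℝ) ≤ C * Q ^ l := by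
    have := hτ (2 ^ l) (by positivity)
    rwa [two_pow_rpow] at this
  have hL : (2 : ℝ) ^ L = 2 ^ (L - l) * 2 ^ l := by rw [← pow_add]; congr 1; omega
  have hQl : Q ^ l = 2 ^ l * (Q / 2) ^ l := by rw [← mul_pow]; congr 1; ring
  have hb : (1 : ℝ) ≤ 2 ^ (L - l) := one_le_pow₀ (by norm_num)
  unfold applyTime
  push_cast
  calc (2 : ℝ) ^ (L - l) * (4000 * (2 ^ l * 2 ^ l + 1) + (τ (2 ^ l) : ℝ)) +
        2000 * (2 ^ l * 2 ^ l + 1)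
      ≤ 2 ^ (L - l) * (4000 * (Q ^ l + Q ^ l) + C * Q ^ l) + 2000 * (Q ^ l + Q ^ l) := by
        gcongr
    _ ≤ 2 ^ (L - l) * (4000 * (Q ^ l + Q ^ l) + C * Q ^ l) +
        2 ^ (L - l) * (2000 * (Q ^ l + Q ^ l)) := by
        have hX : 0 ≤ 2000 * (Q ^ l + Q ^ l) := by linarith
        linarith [le_mul_of_one_le_left hX hb]
    _ = (12000 + C) * (2 ^ (L - l) * Q ^ l) := by ring
    _ = (12000 + C) * 2 ^ L * (Q / 2) ^ l := by rw [hQl, hL]; ring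

/-- With `q = 2 ^ ω / 2`, the recursion has the form `T (l + 1) ≤ 2 T l + A 2 ^ L q ^ l`. Since `q >
2`, the bound `D 2 ^ L q ^ l` reproduces itself as soon as `A ≤ D (q - 2)`, and for `l = L` it
equals `D (2 ^ L) ^ ω`. -/
theorem exists_eliminateTime_le {ω C : ℝ} (hω : 2 < ω) (hC : 0 ≤ C) {τ : ℕ → ℕ}
    (hτ : ∀ n : ℕ, 0 < n → (τ n : ℝ) ≤ C * (n : ℝ) ^ ω) :
    ∃ D : ℝ, 0 ≤ D ∧ ∀ L : ℕ, (eliminateTime τ L L : ℝ) ≤ D * ((2 ^ L : ℕ) : ℝ) ^ ω := by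
  have h4 : (4 : ℝ) < 2 ^ ω := by
    calc (4 : ℝ) = 2 ^ (2 : ℝ) := by norm_num
      _ < 2 ^ ω := Real.rpow_lt_rpow_of_exponent_lt (by norm_num) hω
  set q : ℝ := 2 ^ ω / 2 with hq
  have hq2 : 0 < q - 2 := by rw [hq]; linarith
  have hq1 : 1 ≤ q := by linarith
  -- Two block updates, each with constant `12000 + C`, and the `1000` steps of overhead.
  set A : ℝ := 25000 + 2 * C with hA
  have hA0 : 0 ≤ A := by positivity
  -- The first term closes the induction step, and `18200 = 9000 + 9000 + 200` covers single
  -- columns.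
  set D : ℝ := A / (q - 2) + 18200 with hD
  have hD0 : 18200 ≤ D := by
    have : 0 ≤ A / (q - 2) := by positivity
    linarith
  have hDA : A ≤ D * (q - 2) := by
    rw [hD, add_mul, div_mul_cancel₀ _ hq2.ne']
    have : 0 ≤ 18200 * (q - 2) := by positivity
    linarith
  have key : ∀ L l : ℕ, l ≤ L → (eliminateTime τ L l : ℝ) ≤ D * (2 ^ L * q ^ l) := by
    intro L l
    have h2L : (1 : ℝ) ≤ 2 ^ L := one_le_pow₀ (by norm_num)
    induction l with
    | zero =>
      intro _
      simp only [eliminateTime]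
      push_cast
      nlinarith
    | succ l ih =>
      intro hl
      have h1 := ih (by omega)
      have h2 := applyTime_le hω hτ (show l ≤ L by omega)
      rw [← hq] at h2
      have hql : (1 : ℝ) ≤ q ^ l := one_le_pow₀ hq1
      set Y : ℝ := 2 ^ L * q ^ l with hY
      have hY1 : 1 ≤ Y := one_le_mul_of_one_le_of_one_le h2L hql
      simp only [eliminateTime]
      push_cast
      have h3 : A * Y ≤ D * (q - 2) * Y := mul_le_mul_of_nonneg_right hDA (by linarith)
      have h4 : D * (2 ^ L * q ^ (l + 1)) = D * (q - 2) * Y + 2 * (D * Y) := by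
        rw [hY, pow_succ]; ring
      have h5 : (12000 + C) * 2 ^ L * q ^ l = (12000 + C) * Y := by rw [hY]; ring
      rw [h5] at h2
      rw [h4]
      have h6 : A * Y = 2 * ((12000 + C) * Y) + 1000 * Y := by rw [hA]; ring
      linarith
  refine ⟨D, by linarith, fun L => (key L L le_rfl).trans_eq ?_⟩
  rw [two_pow_rpow, ← mul_pow, hq]
  congr 2
  ring

theorem add_card_le_size {V : Type*} [Finite V] {K : AbstractSimplicialComplex V}
    (N : Numbering K) : N.n₀ + N.n₁ + N.n₂ ≤ size K := by
  let f : Fin N.n₀ ⊕ Fin N.n₁ ⊕ Fin N.n₂ → K.faces :=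
    Sum.elim (fun i => ⟨{N.vert i}, K.singleton_mem _⟩)
      (Sum.elim (fun i => ⟨(N.edge i).1, (N.edge i).2.1⟩) fun i => ⟨(N.tri i).1, (N.tri i).2.1⟩)
  have hf : Function.Injective f := by
    have h1 : ∀ i, (N.edge i).1.card = 2 := fun i => (N.edge i).2.2
    have h2 : ∀ i, (N.tri i).1.card = 3 := fun i => (N.tri i).2.2
    rintro (i | i | i) (j | j | j) h <;> have h := congrArg Subtype.val h <;>
      simp only [f, Sum.elim_inl, Sum.elim_inr] at h
    · rw [Finset.singleton_inj] at h; rw [N.vert.injective h]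
    · have := h1 j; rw [← h] at this; simp at this
    · have := h2 j; rw [← h] at this; simp at this
    · have := h1 i; rw [h] at this; simp at this
    · rw [N.edge.injective (Subtype.ext h)]
    · have h3 := h1 i; have h4 := h2 j; rw [h] at h3; omega
    · have := h2 i; rw [h] at this; simp at this
    · have h3 := h2 i; have h4 := h1 j; rw [h] at h3; omega
    · rw [N.tri.injective (Subtype.ext h)]
  have := Nat.card_le_card_of_injective f hf
  simpa [size, Nat.card_coe_set_eq, add_assoc] using this

/-- Both `2` and `n` are at most `n + 2`, so `(16 n ^ 2) ^ 16 = 2 ^ 64 n ^ 32` stays below its 96th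
power. -/
theorem big_of_pow_le {w n e : ℕ} (hn : 0 < n) (he : 100 ≤ e) (h : (n + 2) ^ e ≤ 2 ^ w) :
    Big w (16 * (n * n)) := by
  refine ⟨by nlinarith, ?_⟩
  calc (16 * (n * n)) ^ 16 = 2 ^ 64 * n ^ 32 := by ring
    _ < (n + 2) ^ 64 * (n + 2) ^ 32 :=
      Nat.mul_lt_mul_of_le_of_lt (Nat.pow_le_pow_left (by omega) 64)
        (Nat.pow_lt_pow_left (by omega) (by norm_num)) (by positivity)
    _ = (n + 2) ^ 96 := by ring
    _ ≤ (n + 2) ^ e := Nat.pow_le_pow_right (by omega) (by omega)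
    _ ≤ 2 ^ w := h

theorem exists_annotation_program {ω : ℝ} (hω : 2 < ω) (hM : MatrixMultiplicationInTime ω) :
    ∃ (P : Program) (c : ℕ) (C : ℝ), ∀ (V : Type*) [Finite V] [DecidableEq V]
      (K : AbstractSimplicialComplex V), (oneSkeleton K).Connected →
      ∀ (N : Numbering K) (w : ℕ) (st : State), (size K + 2) ^ c ≤ 2 ^ w → IsInput N w st →
        ∃ (t : ℕ) (st' : State) (k b g : ℕ) (T : SimpleGraph V) (s : Fin k → Simplex K 1)
          (ι : Fin (b + g) → Fin (N.n₂ + k)) (a : Simplex K 1 → Fin g → ZMod 2),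
          P.Runs w st t st' ∧ (t : ℝ) ≤ C * (size K : ℝ) ^ ω ∧
          IsThreeStepResult K N.tri T s ι a ∧ IsOutput N T s ι a st' := by
  obtain ⟨P, c, C, hP⟩ := hM
  -- Step counts are integers, so the real bound may be rounded down; the absolute value makes the
  -- constant nonnegative.
  set τ : ℕ → ℕ := fun n => ⌊|C| * (n : ℝ) ^ ω⌋₊ with hτdef
  have hτ : ∀ n : ℕ, 0 < n → (τ n : ℝ) ≤ |C| * (n : ℝ) ^ ω := fun n _ =>
    Nat.floor_le (by positivity)
  have hmul : Multiplies P c τ := fun n hn A B w s hw hi h0 h1 => by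
    obtain ⟨t, s', hr, ht, hm⟩ := hP n hn A B w s hw hi h0 h1
    refine ⟨t, s', hr, Nat.le_floor (ht.trans ?_), hm⟩
    exact mul_le_mul_of_nonneg_right (le_abs_self C) (by positivity)
  obtain ⟨D, hD0, hD⟩ := exists_eliminateTime_le hω (abs_nonneg C) hτ
  -- The multiplication is called in sizes up to `2 * n`, and `2 * n + 2 ≤ (n + 2) ^ 2` explains `2
  -- * c`; the `100` excludes overflow. In the time bound, `2 ^ ω` pays for the padding, and
  -- `120000` for the quadratic parts.
  refine ⟨annotationProgram P, 2 * c + 100, (D + 120000) * 2 ^ ω, ?_⟩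
  intro V _ _ K hK N w st hw ⟨⟨hvar, harr⟩, hedge, htri⟩
  obtain ⟨v₀⟩ := hK.nonempty
  have hn0 : 0 < N.n₀ := Fin.pos (N.vert.symm v₀)
  obtain ⟨n, hn⟩ : ∃ n, N.n₀ + N.n₁ + N.n₂ = n := ⟨_, rfl⟩
  have hnS : n ≤ size K := hn ▸ add_card_le_size N
  have hnpos : 0 < n := by omega
  have hw' : (n + 2) ^ (2 * c + 100) ≤ 2 ^ w := (Nat.pow_le_pow_left (by omega) _).trans hw
  have hbig := big_of_pow_le hnpos (by omega) hw'
  have hnw : (2 * n + 2) ^ c ≤ 2 ^ w :=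
    calc (2 * n + 2) ^ c ≤ ((n + 2) ^ 2) ^ c := Nat.pow_le_pow_left (by nlinarith) c
      _ = (n + 2) ^ (2 * c) := by rw [← pow_mul]
      _ ≤ (n + 2) ^ (2 * c + 100) := Nat.pow_le_pow_right (by omega) (by omega)
      _ ≤ 2 ^ w := hw'
  have hwn : n < 2 ^ w := by
    refine lt_of_lt_of_le ?_ hw'
    calc n < (n + 2) ^ 1 := by rw [pow_one]; omega
      _ ≤ _ := Nat.pow_le_pow_right (by omega) (by omega)
  -- The value outside the range is irrelevant; some vertex exists because the complex is connected.
  set ν : ℕ → V := fun i => if h : i < N.n₀ then N.vert ⟨i, h⟩ else v₀ with hν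
  have hνv : ∀ i : Fin N.n₀, ν i = N.vert i := fun i => by simp [hν]
  have hE : EdgeList N ν (st.arr 0) := by
    refine ⟨hνv, fun e he => ?_, fun e he => ?_, fun e => ?_⟩
    · obtain ⟨x, y, h1, h2, -⟩ := hedge ⟨e, he⟩
      simp only at h1
      have := x.2
      omega
    · obtain ⟨x, y, h1, h2, -⟩ := hedge ⟨e, he⟩
      simp only at h2
      have := y.2
      omega
    · obtain ⟨x, y, h1, h2, h3⟩ := hedge e
      rw [h3, h1, h2, hνv, hνv]
  have hF : TriangleList N ν (st.arr 1) := by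
    refine ⟨fun t ht c hc => ?_, fun t => ?_⟩
    · obtain ⟨x, y, z, h1, h2, h3, -⟩ := htri ⟨t, ht⟩
      simp only at h1 h2 h3
      interval_cases c
      · rw [add_zero, h1]; exact x.2
      · rw [h2]; exact y.2
      · rw [h3]; exact z.2
    · obtain ⟨x, y, z, h1, h2, h3, h4⟩ := htri t
      rw [h4, h1, h2, h3, hνv, hνv, hνv]
  obtain ⟨L, hL, hdoes⟩ := Does.main (N := N) (ν := ν) (σ := st) (P' := annotationProgram P) hbig
    (annotationProgram_body P) rfl rfl hmul hE hF hK hn0 hn le_rfl hnw (by rw [hvar]; rfl)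
    (by rw [hvar]; rfl) (by rw [hvar]; rfl)
  have hwf : st.WF w := by
    refine ⟨fun x => ?_, harr⟩
    rw [hvar]
    refine frame_lt (fun a ha => ?_) x
    simp only [List.mem_cons, List.not_mem_nil, or_false] at ha
    omega
  obtain ⟨t, st', σ', hexec, ht, hagree, k, b, g, T, s, ι, a, h1, h2⟩ :=
    hdoes st hwf (State.Agree.refl _ _)
  refine ⟨t, st', k, b, g, T, s, ι, a, hexec, ?_, h1, ?_⟩
  · set m := 2 ^ L with hm
    have hm1 : (1 : ℝ) ≤ m := by rw [hm]; exact_mod_cast Nat.one_le_two_pow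
    have hsq : (m : ℝ) * m ≤ (m : ℝ) ^ ω := by
      calc (m : ℝ) * m = (m : ℝ) ^ (2 : ℝ) := by rw [Real.rpow_two, sq]
        _ ≤ (m : ℝ) ^ ω := Real.rpow_le_rpow_of_exponent_le hm1 hω.le
    have hone : (1 : ℝ) ≤ (m : ℝ) ^ ω := Real.one_le_rpow hm1 (by linarith)
    have hmS : (m : ℝ) ≤ 2 * size K := by exact_mod_cast hL.trans (by omega)
    have htR : (t : ℝ) ≤ eliminateTime τ L L + 60000 * (m * m + 1) := by exact_mod_cast ht
    calc (t : ℝ) ≤ (D + 120000) * (m : ℝ) ^ ω := by have := hD L; rw [← hm] at this; linarith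
      _ ≤ (D + 120000) * (2 * size K : ℝ) ^ ω := by
        gcongr
      _ = (D + 120000) * 2 ^ ω * (size K : ℝ) ^ ω := by
        rw [Real.mul_rpow (by norm_num) (by positivity), mul_assoc]
  · obtain ⟨o0, o1, o2, o3, o4, o5, o6⟩ := h2
    refine ⟨(hagree.2 0 (by norm_num)).trans o0, (hagree.2 1 (by norm_num)).trans o1,
      (hagree.2 2 (by norm_num)).trans o2, ?_, ?_, ?_, ?_⟩
    · rw [hagree.1]; exact o3
    · unfold HoldsMatrix at o4 ⊢; rw [hagree.1]; exact o4
    · rw [hagree.1]; exact o5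
    · unfold HoldsMatrix at o6 ⊢; rw [hagree.1]; exact o6

end EdgeAnnotation

theorem theorem4p1 :
    -- Correctness, for every choice of the spanning tree and of the orders of the columns.
    (∀ (V : Type*) [Finite V] [DecidableEq V] (K : AbstractSimplicialComplex V),
      EdgeAnnotation.IsTwoComplex K → (EdgeAnnotation.oneSkeleton K).Connected →
      ∀ (n₂ k : ℕ) (tri : Fin n₂ ≃ EdgeAnnotation.Simplex K 2) (T : SimpleGraph V)
        (s : Fin k → EdgeAnnotation.Simplex K 1),
      EdgeAnnotation.IsSpanningTree K T → Function.Injective s →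
      Set.range s = {e | ¬ EdgeAnnotation.InTree T e} →
        -- The three steps can be carried out.
        (∃ (b g : ℕ) (ι : Fin (b + g) → Fin (n₂ + k))
          (a : EdgeAnnotation.Simplex K 1 → Fin g → ZMod 2),
          EdgeAnnotation.IsThreeStepResult K tri T s ι a) ∧
        -- Their result is an annotation, which gives the coordinates in the homology basis `H`.
        (∀ (b g : ℕ) (ι : Fin (b + g) → Fin (n₂ + k))
          (a : EdgeAnnotation.Simplex K 1 → Fin g → ZMod 2),
          EdgeAnnotation.IsThreeStepResult K tri T s ι a →
            EdgeAnnotation.IsAnnotation K a ∧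
            ∃ (hH : ∀ j, EdgeAnnotation.basisCycle tri T s ι j ∈ EdgeAnnotation.cycles K)
              (H : Module.Basis (Fin g) (ZMod 2) (EdgeAnnotation.H1 K)),
              (∀ j, H j = EdgeAnnotation.homologyClass K
                ⟨EdgeAnnotation.basisCycle tri T s ι j, hH j⟩) ∧
              ∀ z : EdgeAnnotation.cycles K,
                EdgeAnnotation.annotationSum a z.1 =
                  H.equivFun (EdgeAnnotation.homologyClass K z))) ∧
    -- Running time.
    (∀ ω : ℝ, 2 < ω → EdgeAnnotation.MatrixMultiplicationInTime ω →
      ∃ (P : EdgeAnnotation.Program) (c : ℕ) (C : ℝ),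
        ∀ (V : Type*) [Finite V] [DecidableEq V] (K : AbstractSimplicialComplex V),
        EdgeAnnotation.IsTwoComplex K → (EdgeAnnotation.oneSkeleton K).Connected →
        ∀ (N : EdgeAnnotation.Numbering K) (w : ℕ) (st : EdgeAnnotation.State),
        (EdgeAnnotation.size K + 2) ^ c ≤ 2 ^ w → EdgeAnnotation.IsInput N w st →
          ∃ (t : ℕ) (st' : EdgeAnnotation.State) (k b g : ℕ) (T : SimpleGraph V)
            (s : Fin k → EdgeAnnotation.Simplex K 1) (ι : Fin (b + g) → Fin (N.n₂ + k))
            (a : EdgeAnnotation.Simplex K 1 → Fin g → ZMod 2),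
            P.Runs w st t st' ∧ (t : ℝ) ≤ C * (EdgeAnnotation.size K : ℝ) ^ ω ∧
            EdgeAnnotation.IsThreeStepResult K N.tri T s ι a ∧
            EdgeAnnotation.IsOutput N T s ι a st') := by
  refine ⟨?_, ?_⟩
  · intro V _ _ K _ _ n₂ k tri T s hT hs hr
    exact ⟨EdgeAnnotation.exists_isThreeStepResult hT hs hr, fun b g ι a h => h.isAnnotation⟩
  · intro ω hω hM
    obtain ⟨P, c, C, h⟩ := EdgeAnnotation.exists_annotation_program hω hM
    exact ⟨P, c, C, fun V _ _ K _ hK N w st hw hin => h V K hK N w st hw hin⟩
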